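/- **Setting.** Let $d\in\mathbb N$, $X\subset\mathbb R$, $\mu$ a probability measure on $X$, $\Omega=X^{\mathbb Z^d}$ with the product $\sigma$-algebra and $\mathbb P=\bigotimes_{k\in\mathbb Z^d}\mu$; put $(S_j\omega)_k=\omega_{k+j}$. On $\ell^2(\mathbb Z^d)$ with canonical basis $(\varphi_k)$ let $V_j$ be the unitary with $V_j\varphi_k=\varphi_{k-j}$. Let $\gamma_1,\dots,\gamma_d\in\mathbb Z^d$ be linearly independent, $\Gamma=\bigoplus_i\mathbb Z\gamma_i$, $B=\{\sum_i x_i\gamma_i:0\le x_i<1\}\cap\mathbb Z^d$, and for $n\ge 0$ let $\Lambda=\Lambda_n=\bigcup_{-n\le n_i\le n}\big(B+\sum_i n_i\gamma_i\big)$, $\mathcal H_\Lambda=\mathrm{span}\{\varphi_j:j\in\Lambda\}$, with orthogonal projection $P_\Lambda$. A contraction $T$ is *completely non unitary* (cnu) if $0$ is the only vector $x$ with $\|T^nx\|=\|x\|=\|T^{*n}x\|$ for all $n\ge0$. For a cnu contraction and $f(z)=\sum c_nz^n\in H^\infty(\mathbb D)$, $f(T)=\mathrm{s\text{-}}\lim_{\rho\to1^-}\sum_n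 c_n\rho^nT^n$. Let $A(\mathbb D)$ be the disc algebra (continuous on $\bar{\mathbb D}$, holomorphic on $\mathbb D$). Let $(T_\omega)_{\omega\in\Omega}$ be cnu contractions on $\ell^2(\mathbb Z^d)$, weakly measurable in $\omega$, with $T_{S_g\omega}=V_gT_\omega V_g^{-1}$ for all $g\in\Gamma$, $\omega\in\Omega$. The density of states functional is $$L(f)=\frac1{|B|}\sum_{b\in B}\mathbb E\,\langle\varphi_b|f(T_\omega)\varphi_b\rangle,\qquad f\in H^\infty(\mathbb D).$$ For all $\Lambda$ and $\omega$ let $T_\omega=T^\Lambda_\omega\oplus T^{\Lambda^C}_\omega+F^\Lambda_\omega$, where $T_\omega^\Lambda$ is a cnu contraction on $\mathcal H_\Lambda$, $T_\omega^{\Lambda^C}$ is a bounded operator on $\mathcal H_\Lambda^\perp$, $F^\Lambda_\omega$ is trace class, and, for each $\omega$, $\|P_\Lambda(T_\omega-T^\Lambda_\omega\oplus T^{\Lambda^C}_\omega)\|_1=o(|\Lambda|)$ as $n\to\infty$. Let $dm^\Lambda_\omega=|\Lambda|^{-1}\sum_j\delta_{\lambda_j}$ on $\bar{\mathbb D}$,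 the $\lambda_j$ being the eigenvalues of $T^\Lambda_\omega$ with algebraic multiplicities. Assume that there is a random (i.e. measurable in $\omega$, up to null sets) Borel measure $dm_\omega$ on $\bar{\mathbb D}$ such that, for almost every $\omega$, $dm^\Lambda_\omega\to dm_\omega$ weakly as $n\to\infty$, i.e. tested against every $f\in C(\bar{\mathbb D})$. Let $\bar m=\mathbb E(dm_\omega)\ge0$, that is $\bar m(A)=\mathbb E(m_\omega(A))$. **Theorem.** (1) For all $f\in A(\mathbb D)$, $f$ is $\bar m$-integrable and $$L(f)=\int_{\bar{\mathbb D}}f(x+iy)\,d\bar m(x,y).$$ (2) Let moreover $0<r<1$ and assume $\mathrm{spr}(T^\Lambda_\omega)\le r$ for all $\omega$ and all $\Lambda=\Lambda_n$. Then there is $\psi$, holomorphic on $\mathbb D/r=\{|z|<1/r\}$, such that: (a) $\displaystyle\psi(z)=\int_{\bar{\mathbb D}}\frac{d\bar m(x,y)}{1-z(x-iy)}$ for all $z\in\mathbb D/r$, the integral being absolutely convergent; (b) $\bar\psi\in L^1(\mathbb T)\setminus H^1_0(\mathbb D)$ (where $H_0^1(\mathbb D)$ is identified with the set of $\varphi\in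 L^1(\mathbb T)$ with $\int_0^{2\pi}e^{int}\varphi(e^{it})\,dt=0$ for all $n\ge0$), and for all $f\in H^\infty(\mathbb D)$, with radial boundary values $f(e^{it})=\lim_{\rho\to1^-}f(\rho e^{it})$, $$L(f)=\int_0^{2\pi}f(e^{it})\,\overline{\psi(e^{it})}\,\frac{dt}{2\pi},$$ the integrand being integrable; (c) with $P[\bar\psi]$ the Poisson integral of $\bar\psi|_{\mathbb T}$, the function $$m_{\bar\psi}(x,y)=\frac1{2\pi}(\partial_x+i\partial_y)\{(x-iy)P[\bar\psi](x,y)\}$$ is harmonic on $\mathbb D$, and $L(f)=\int_{\mathbb D}f(x+iy)\,m_{\bar\psi}(x,y)\,dx\,dy$ for all $f\in A(\mathbb D)$, the integrand being integrable; (d) for all $z\in\mathbb D$, the following integral being absolutely convergent, $$m_{\bar\psi}(z)=\frac1\pi\int_{\bar{\mathbb D}}\frac{d\bar m(x,y)}{(1-\bar z(x+iy))^2}.$$ -/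

import Mathlib

open MeasureTheory Filter Topology Complex Metric
open scoped ENNReal InnerProductSpace ComplexConjugate

noncomputable section

namespace DOS

/-! ### Function spaces on the unit disc -/

/-- `f` (only its values on the open unit disc matter) belongs to the Hardy class `H^∞(𝔻)`. -/
def IsHInf (f : ℂ → ℂ) : Prop :=
  DifferentiableOn ℂ f (ball 0 1) ∧ ∃ C : ℝ, ∀ z ∈ ball (0 : ℂ) 1, ‖f z‖ ≤ C

/-- `f` (only its values on the closed unit disc matter) belongs to the disc algebra `A(𝔻)`. -/
def IsDiscAlgebra (f : ℂ → ℂ) : Prop :=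
  ContinuousOn f (closedBall 0 1) ∧ DifferentiableOn ℂ f (ball 0 1)

/-- The `n`-th Taylor coefficient of `f` at the origin. -/
def taylorCoeff (f : ℂ → ℂ) (n : ℕ) : ℂ :=
  iteratedDeriv n f 0 / (n.factorial : ℂ)

/-- The radial boundary value `lim_{ρ → 1⁻} f (ρ ζ)` of `f` at `ζ` on the unit circle. -/
def radialLimit (f : ℂ → ℂ) (ζ : ℂ) : ℂ :=
  limUnder (𝓝[<] (1 : ℝ)) fun ρ : ℝ => f ((ρ : ℂ) * ζ)

/-- The function `φ` on the unit circle is the boundary value of an element of `H¹₀(𝔻)`: it is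
integrable and its Fourier coefficients of index `-n`, `n ≥ 0`, all vanish. -/
def IsHardyOneZero (φ : ℂ → ℂ) : Prop :=
  CircleIntegrable φ 0 1 ∧ ∀ n : ℕ, Real.circleAverage (fun ζ => ζ ^ n * φ ζ) 0 1 = 0

/-- The Poisson integral `P[φ]` of a function `φ` on the unit circle. -/
def poissonIntegral (φ : ℂ → ℂ) (z : ℂ) : ℂ :=
  Real.circleAverage (fun ζ => (poissonKernel 0 z ζ : ℂ) * φ ζ) 0 1

/-- `m_φ(x, y) = (1/2π) (∂_x + i ∂_y) {(x - i y) P[φ](x, y)}`. -/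
def discDensity (φ : ℂ → ℂ) (z : ℂ) : ℂ :=
  (1 / (2 * (Real.pi : ℂ))) *
    (fderiv ℝ (fun w : ℂ => conj w * poissonIntegral φ w) z 1 +
      I * fderiv ℝ (fun w : ℂ => conj w * poissonIntegral φ w) z I)

/-! ### Contractions and their functional calculus -/

section Hilbert

variable {E : Type*} [NormedAddCommGroup E] [InnerProductSpace ℂ E] [CompleteSpace E]

/-- `T` is a completely non unitary contraction: the subspace
`{x | ‖T ^ n x‖ = ‖x‖ = ‖T* ^ n x‖ for all n}`, on which `T` is unitary, is zero. -/
def IsCNUContraction (T : E →L[ℂ] E) : Prop :=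
  ‖T‖ ≤ 1 ∧
    ∀ x : E, (∀ n : ℕ, ‖(T ^ n) x‖ = ‖x‖ ∧ ‖(ContinuousLinearMap.adjoint T ^ n) x‖ = ‖x‖) → x = 0

/-- The vector `f(T) x`, where `f(T)` is the strong limit, as `ρ → 1⁻`, of
`f_ρ(T) = ∑ c_n ρ^n T^n` for `f(z) = ∑ c_n z^n`. -/
def funcCalc (f : ℂ → ℂ) (T : E →L[ℂ] E) (x : E) : E :=
  limUnder (𝓝[<] (1 : ℝ)) fun ρ : ℝ =>
    (∑' n : ℕ, (taylorCoeff f n * (ρ : ℂ) ^ n) • T ^ n : E →L[ℂ] E) x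

/-- The direct sum `A ⊕ A'` of an operator `A` on `K` and an operator `A'` on `Kᗮ`. -/
def directSum (K : Submodule ℂ E) [K.HasOrthogonalProjection]
    (A : K →L[ℂ] K) (A' : Kᗮ →L[ℂ] Kᗮ) : E →L[ℂ] E :=
  K.subtypeL ∘L A ∘L K.orthogonalProjectionOnto + Kᗮ.subtypeL ∘L A' ∘L Kᗮ.orthogonalProjectionOnto

/-- `|A| = (A* A)^{1/2}`. -/
def operatorAbs (A : E →L[ℂ] E) : E →L[ℂ] E := CFC.abs A

end Hilbert

/-! ### The lattice and the Hilbert space `ℓ²(ℤ^d)` -/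

/-- The lattice `ℤ^d`. -/
abbrev Lattice (d : ℕ) : Type := Fin d → ℤ

/-- The Hilbert space `ℓ²(ℤ^d)`. -/
abbrev L2 (d : ℕ) : Type := lp (fun _ : Lattice d => ℂ) 2

/-- The canonical basis vector `φ_k`. -/
def basisVec {d : ℕ} (k : Lattice d) : L2 d := lp.single 2 k (1 : ℂ)

lemma memLp_translate {d : ℕ} (j : Lattice d) (f : L2 d) :
    Memℓp (fun k : Lattice d => f (k + j)) 2 := by
  have h := lp.memℓp f
  have h2 : (0 : ℝ) < (2 : ℝ≥0∞).toReal := by norm_num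
  rw [memℓp_gen_iff h2] at h ⊢
  exact (Equiv.addRight j).summable_iff.mpr h

/-- The unitary translation `V_j`, `(V_j f)(k) = f (k + j)`. -/
def translation {d : ℕ} (j : Lattice d) : L2 d ≃ₗᵢ[ℂ] L2 d where
  toFun f := ⟨fun k => f (k + j), memLp_translate j f⟩
  invFun f := ⟨fun k => f (k + -j), memLp_translate (-j) f⟩
  left_inv f := by ext k; simp
  right_inv f := by ext k; simp
  map_add' f g := rfl
  map_smul' c f := rfl
  norm_map' f := by
    have h2 : (0 : ℝ) < (2 : ℝ≥0∞).toReal := by norm_num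
    refine (Real.rpow_left_inj (norm_nonneg _) (norm_nonneg _) h2.ne').mp ?_
    rw [lp.norm_rpow_eq_tsum h2, lp.norm_rpow_eq_tsum h2]
    exact (Equiv.addRight j).tsum_eq (fun k => ‖f k‖ ^ (2 : ℝ≥0∞).toReal)

/-- `V_j φ_k = φ_{k - j}`. -/
lemma translation_basisVec {d : ℕ} (j k : Lattice d) :
    translation j (basisVec k) = basisVec (k - j) := by
  ext l
  change (basisVec k : L2 d) (l + j) = (basisVec (k - j) : L2 d) l
  simp only [basisVec, lp.single_apply, Pi.single_apply, eq_sub_iff_add_eq]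

/-- The trace norm `‖A‖₁ = tr |A|`, computed in the canonical basis, as an extended number. -/
def traceNorm {d : ℕ} (A : L2 d →L[ℂ] L2 d) : ℝ≥0∞ :=
  ∑' k : Lattice d, ENNReal.ofReal (⟪basisVec k, operatorAbs A (basisVec k)⟫_ℂ).re

/-- `A` is a trace class operator. -/
def IsTraceClass {d : ℕ} (A : L2 d →L[ℂ] L2 d) : Prop := traceNorm A < ∞

/-! ### The periodic lattice and the finite volume boxes -/

lemma finite_cell {d : ℕ} (γ : Fin d → Lattice d) :
    {k : Lattice d | ∃ x : Fin d → ℝ, (∀ i, 0 ≤ x i ∧ x i < 1) ∧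
      ∀ l, (k l : ℝ) = ∑ i, x i * (γ i l : ℝ)}.Finite := by
  refine (Set.finite_Icc (fun l => -∑ i, |γ i l|) (fun l => ∑ i, |γ i l|)).subset ?_
  rintro k ⟨x, hx, hk⟩
  have key : ∀ l, |(k l : ℝ)| ≤ ((∑ i, |γ i l| : ℤ) : ℝ) := by
    intro l
    rw [hk l]
    push_cast
    refine (Finset.abs_sum_le_sum_abs _ _).trans (Finset.sum_le_sum fun i _ => ?_)
    rw [abs_mul, abs_of_nonneg (hx i).1]
    exact mul_le_of_le_one_left (abs_nonneg _) (hx i).2.le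
  have key' : ∀ l, |k l| ≤ ∑ i, |γ i l| := fun l => by exact_mod_cast key l
  exact ⟨fun l => (abs_le.mp (key' l)).1, fun l => (abs_le.mp (key' l)).2⟩

/-- The primitive cell `B = {∑ x_i γ_i | 0 ≤ x_i < 1} ∩ ℤ^d`. -/
def cell {d : ℕ} (γ : Fin d → Lattice d) : Finset (Lattice d) := (finite_cell γ).toFinset

/-- The box `Λ = ⋃_{-n ≤ n_i ≤ n} (B + ∑ n_i γ_i)`. -/
def box {d : ℕ} (γ : Fin d → Lattice d) (n : ℕ) : Finset (Lattice d) :=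
  ((Fintype.piFinset fun _ : Fin d => Finset.Icc (-(n : ℤ)) n) ×ˢ cell γ).image
    fun p => p.2 + ∑ i, p.1 i • γ i

/-- `H_Λ = span {φ_j | j ∈ Λ}`. -/
abbrev boxSpace {d : ℕ} (Λ : Finset (Lattice d)) : Submodule ℂ (L2 d) :=
  Submodule.span ℂ (basisVec '' (Λ : Set (Lattice d)))

instance {d : ℕ} (Λ : Finset (Lattice d)) : FiniteDimensional ℂ (boxSpace Λ) :=
  FiniteDimensional.span_of_finite ℂ (Λ.finite_toSet.image _)

instance {d : ℕ} (Λ : Finset (Lattice d)) : CompleteSpace (boxSpace Λ) :=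
  FiniteDimensional.complete ℂ _

/-! ### Eigenvalue counting measures -/

/-- The closed unit disc. -/
abbrev ClosedDisc : Type := closedBall (0 : ℂ) 1

/-- The normalised counting measure `|Λ|⁻¹ ∑_j δ_{λ_j}` on the closed unit disc of the eigenvalues
`λ_j` of an operator on `H_Λ`, repeated according to algebraic multiplicity. -/
def countingMeasure {d : ℕ} {Λ : Finset (Lattice d)} (A : boxSpace Λ →L[ℂ] boxSpace Λ) :
    Measure ClosedDisc :=
  ((Λ.card : ℝ≥0∞)⁻¹ •
    ((A : boxSpace Λ →ₗ[ℂ] boxSpace Λ).charpoly.roots.map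
      (Measure.dirac : ℂ → Measure ℂ)).sum).comap Subtype.val

/-! ### Randomness -/

/-- The sample space `X^{ℤ^d}`. -/
abbrev Config (d : ℕ) (X : Set ℝ) : Type := Lattice d → X

/-- The shift `S_j(ω)_k = ω_{k+j}`. -/
def shift {d : ℕ} {X : Set ℝ} (j : Lattice d) (ω : Config d X) : Config d X := fun k => ω (k + j)

/-- The product probability measure `⊗_{k ∈ ℤ^d} μ`. -/
def prodLaw (d : ℕ) {X : Set ℝ} (μ : Measure X) : Measure (Config d X) :=
  Measure.infinitePi fun _ => μ

/-- The DOS functional `L(f) = |B|⁻¹ ∑_{b ∈ B} 𝔼 ⟨φ_b, f(T_ω) φ_b⟩`. -/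
def dosFunctional {d : ℕ} {X : Set ℝ} (μ : Measure X) (γ : Fin d → Lattice d)
    (T : Config d X → (L2 d →L[ℂ] L2 d)) (f : ℂ → ℂ) : ℂ :=
  ((cell γ).card : ℂ)⁻¹ *
    ∑ b ∈ cell γ, ∫ ω, ⟪basisVec b, funcCalc f (T ω) (basisVec b)⟫_ℂ ∂(prodLaw d μ)

/-- The averaged measure `𝔼(dm_ω)`, given by `A ↦ 𝔼(m_ω(A))`. -/
def meanMeasure {d : ℕ} {X : Set ℝ} (μ : Measure X) (m : Config d X → Measure ClosedDisc) :
    Measure ClosedDisc :=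
  (prodLaw d μ).bind m

end DOS

end

open DOS

noncomputable section

namespace DOS

set_option linter.unusedSectionVars false

/-! ### Circle averages of power series -/

section CircleAverages

/-! Everything is read off from the moments M_k = ∫ w^k of the averaged measure.

First, L(z^k) = M_k (`dosMoment_eq_integral`). Inside the local trace of T^k the factors T are
replaced by A = T^Λ one at a time. Each exchange costs at most ‖P_Λ F‖₁, so the total error is k‖P_Λ
F‖₁ = o(|Λ|), and tr A^k is |Λ| times the k-th moment of the eigenvalue counting measure. Hence for
almost every ω the box average of ⟪φ_j, T^k φ_j⟫ tends to the k-th moment of m_ω. Covariance and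
shift invariance make the expectation of this box average equal to L(z^k) for every box, so
dominated convergence suffices and no ergodic theorem is used.

Second, L(f) is the Abel limit of ∑ c_n ρ^n L(z^n) (`tendsto_dosFunctional`). This needs the strong
convergence of f(ρT) as ρ → 1 together with a uniform bound. The bound is von Neumann's inequality
(`IsBoundedSeries.norm_abelSum_le`), which follows from the positivity of an operator valued Poisson
kernel. The convergence (`IsBoundedSeries.exists_tendsto_abelSum`) is proved for an isometric
dilation V of T. It holds on wandering vectors because ∑ |c_n|² < ∞. The orthogonal complement of
the vectors of convergence lies in the original space, and T acts unitarily on it, so it is zero for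
a cnu contraction.

For f in the disc algebra the Abel sums equal ∫ f(ρw) and tend to ∫ f(w), which is part (1). If all
spectral radii are at most r, the measure lives in |w| ≤ r, so |M_n| ≤ r^n, L(f) = ∑ c_n M_n, and
ψ(z) = ∑ conj(M_n) z^n. Part (2) then compares coefficients: geometric series for the Borel
transform, orthogonality of the powers on the circle and on the disc for the two representations,
with density π⁻¹ ∑ (n+1) M_n z̄^n. The function conj ψ is not in H¹₀ because its mean is the total
mass 1. Radial boundary values exist by Fatou's theorem (`IsHInf.ae_exists_tendsto_radial`),
obtained from a Lipschitz primitive of f. -/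

lemma circleAverage_eq_integral {F : Type*} [NormedAddCommGroup F] [NormedSpace ℝ F]
    (u : ℂ → F) :
    Real.circleAverage u 0 1 = (2 * Real.pi)⁻¹ • ∫ θ in 0..2 * Real.pi, u (circleMap 0 1 θ) := rfl

lemma norm_circleMap_one (θ : ℝ) : ‖circleMap 0 1 θ‖ = 1 := by simp

lemma hasSum_circleAverage {u : ℕ → ℂ → ℂ} {g : ℂ → ℂ} {b : ℕ → ℝ}
    (hu : ∀ n, ContinuousOn (u n) (sphere 0 1)) (hb : ∀ n, ∀ ζ : ℂ, ‖ζ‖ = 1 → ‖u n ζ‖ ≤ b n)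
    (hsum : Summable b) (hg : ∀ ζ : ℂ, ‖ζ‖ = 1 → HasSum (fun n => u n ζ) (g ζ)) :
    HasSum (fun n => Real.circleAverage (u n) 0 1) (Real.circleAverage g 0 1) := by
  simp only [circleAverage_eq_integral]
  refine HasSum.const_smul _ ?_
  refine intervalIntegral.hasSum_integral_of_dominated_convergence (fun n _ => b n) ?_ ?_ ?_ ?_ ?_
  · intro n
    refine Continuous.aestronglyMeasurable ?_
    exact (hu n).comp_continuous (continuous_circleMap 0 1) fun θ => by simp
  · exact fun n => ae_of_all _ fun θ _ => hb n _ (norm_circleMap_one θ)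
  · exact ae_of_all _ fun θ _ => hsum
  · exact intervalIntegrable_const
  · exact ae_of_all _ fun θ _ => hg _ (norm_circleMap_one θ)

/-- On the circle conj ζ inverts ζ, so each product reduces to 1, to a positive power, or to the
conjugate of one; positive powers average to their value at the centre. -/
lemma circleAverage_pow_mul_conj_pow (n m : ℕ) :
    Real.circleAverage (fun ζ => ζ ^ n * conj ζ ^ m) 0 1 = if n = m then 1 else 0 := by
  have hz : ∀ k : ℕ, k ≠ 0 → Real.circleAverage (fun ζ : ℂ => ζ ^ k) 0 1 = 0 := by
    intro k hk
    have : DiffContOnCl ℂ (fun ζ : ℂ => ζ ^ k) (ball 0 |1|) :=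
      (differentiable_id.pow k).diffContOnCl
    rw [this.circleAverage]
    simp [hk]
  have hone : ∀ ζ : ℂ, ζ ∈ sphere (0 : ℂ) |1| → ζ * conj ζ = 1 := by
    intro ζ hζ
    have : ‖ζ‖ = 1 := by simpa using hζ
    rw [mul_conj, normSq_eq_norm_sq, this]; simp
  rcases lt_trichotomy n m with h | h | h
  · rw [if_neg h.ne]
    obtain ⟨k, rfl⟩ := Nat.exists_eq_add_of_lt h
    have e : Set.EqOn (fun ζ : ℂ => ζ ^ n * conj ζ ^ (n + k + 1)) (fun ζ => conj (ζ ^ (k + 1)))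
        (sphere 0 |1|) := by
      intro ζ hζ
      have := hone ζ hζ
      simp only [map_pow]
      rw [show n + k + 1 = n + (k + 1) by ring, pow_add, ← mul_assoc, ← mul_pow, this, one_pow,
        one_mul]
    rw [Real.circleAverage_congr_sphere e]
    have := (Complex.conjCLE.toContinuousLinearMap).circleAverage_comp_comm
      (f := fun ζ : ℂ => ζ ^ (k + 1)) (c := 0) (R := 1)
      (ContinuousOn.circleIntegrable' (by fun_prop))
    rw [hz _ (Nat.succ_ne_zero k)] at this
    simpa [Function.comp_def] using this
  · subst h
    rw [if_pos rfl]
    have e : Set.EqOn (fun ζ : ℂ => ζ ^ n * conj ζ ^ n) (fun ζ => 1) (sphere 0 |1|) := by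
      intro ζ hζ
      have := hone ζ hζ
      simp only
      rw [← mul_pow, this, one_pow]
    rw [Real.circleAverage_congr_sphere e, Real.circleAverage_const]
  · rw [if_neg h.ne']
    obtain ⟨k, rfl⟩ := Nat.exists_eq_add_of_lt h
    have e : Set.EqOn (fun ζ : ℂ => ζ ^ (m + k + 1) * conj ζ ^ m) (fun ζ => ζ ^ (k + 1))
        (sphere 0 |1|) := by
      intro ζ hζ
      have := hone ζ hζ
      simp only
      rw [show m + k + 1 = (k + 1) + m by ring, pow_add, mul_assoc, ← mul_pow, this, one_pow,
        mul_one]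
    rw [Real.circleAverage_congr_sphere e, hz _ (Nat.succ_ne_zero k)]

variable {a : ℕ → ℂ}

lemma hasSum_powerSeries (ha : Summable fun n => ‖a n‖) {ζ : ℂ} (hζ : ‖ζ‖ = 1) :
    HasSum (fun n => a n * ζ ^ n) (∑' n, a n * ζ ^ n) := by
  refine (Summable.of_norm ?_).hasSum
  simpa [hζ] using ha

lemma continuousOn_powerSeries (ha : Summable fun n => ‖a n‖) :
    ContinuousOn (fun ζ : ℂ => ∑' n, a n * ζ ^ n) (sphere 0 1) := by
  refine continuousOn_tsum (fun n => by fun_prop) ha fun n ζ hζ => ?_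
  have : ‖ζ‖ = 1 := by simpa using hζ
  simp [this]

lemma circleAverage_powerSeries_mul_conj_pow (ha : Summable fun n => ‖a n‖) (m : ℕ) :
    Real.circleAverage (fun ζ => (∑' n, a n * ζ ^ n) * conj ζ ^ m) 0 1 = a m := by
  have h := hasSum_circleAverage (u := fun n ζ => a n * (ζ ^ n * conj ζ ^ m))
    (g := fun ζ => (∑' n, a n * ζ ^ n) * conj ζ ^ m) (b := fun n => ‖a n‖)
    (fun n => (Continuous.continuousOn (by fun_prop))) (fun n ζ hζ => by simp [hζ]) ha
    (fun ζ hζ => by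
      simpa only [mul_assoc] using (hasSum_powerSeries ha hζ).mul_right (conj ζ ^ m))
  refine h.unique ?_
  have e : ∀ n, Real.circleAverage (fun ζ => a n * (ζ ^ n * conj ζ ^ m)) 0 1 =
      if n = m then a m else 0 := by
    intro n
    have := Real.circleAverage_fun_smul (a := a n) (f := fun ζ : ℂ => ζ ^ n * conj ζ ^ m)
      (c := 0) (R := 1)
    simp only [smul_eq_mul] at this
    rw [this, circleAverage_pow_mul_conj_pow]
    split_ifs with h
    · simp [h]
    · simp
  simp only [e]
  simpa using hasSum_ite_eq m (a m)

lemma circleAverage_powerSeries_mul_pow (ha : Summable fun n => ‖a n‖) (m : ℕ) :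
    Real.circleAverage (fun ζ => (∑' n, a n * ζ ^ n) * ζ ^ m) 0 1 = if m = 0 then a 0 else 0 := by
  -- The factor `conj ζ ^ 0` brings each term into the form of `circleAverage_pow_mul_conj_pow`.
  have h := hasSum_circleAverage (u := fun n ζ => a n * (ζ ^ (n + m) * conj ζ ^ 0))
    (g := fun ζ => (∑' n, a n * ζ ^ n) * ζ ^ m) (b := fun n => ‖a n‖)
    (fun n => (Continuous.continuousOn (by fun_prop))) (fun n ζ hζ => by simp [hζ]) ha
    (fun ζ hζ => by
      simpa only [pow_zero, mul_one, mul_assoc, pow_add] using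
        (hasSum_powerSeries ha hζ).mul_right (ζ ^ m))
  refine h.unique ?_
  have e : ∀ n, Real.circleAverage (fun ζ => a n * (ζ ^ (n + m) * conj ζ ^ 0)) 0 1 =
      if n = 0 then (if m = 0 then a 0 else 0) else 0 := by
    intro n
    have := Real.circleAverage_fun_smul (a := a n) (f := fun ζ : ℂ => ζ ^ (n + m) * conj ζ ^ 0)
      (c := 0) (R := 1)
    simp only [smul_eq_mul] at this
    rw [this, circleAverage_pow_mul_conj_pow]
    by_cases hn : n = 0 <;> by_cases hm : m = 0 <;> simp [hn, hm]
  simp only [e]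
  simpa using hasSum_ite_eq 0 (if m = 0 then a 0 else 0)

/-- Pairing of a power series with an antiholomorphic power series on the unit circle. -/
lemma hasSum_circleAverage_mul_conj (ha : Summable fun n => ‖a n‖) {b : ℕ → ℂ}
    (hb : Summable fun n => ‖b n‖) :
    HasSum (fun n => a n * b n)
      (Real.circleAverage (fun ζ => (∑' n, a n * ζ ^ n) * ∑' n, b n * conj ζ ^ n) 0 1) := by
  have hC : ∀ ζ : ℂ, ‖ζ‖ = 1 → ‖∑' n, a n * ζ ^ n‖ ≤ ∑' n, ‖a n‖ := fun ζ hζ => by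
    refine (norm_tsum_le_tsum_norm (by simpa [hζ] using ha)).trans_eq ?_
    simp [hζ]
  have h := hasSum_circleAverage (u := fun n ζ => b n * ((∑' n, a n * ζ ^ n) * conj ζ ^ n))
    (g := fun ζ => (∑' n, a n * ζ ^ n) * ∑' n, b n * conj ζ ^ n)
    (b := fun n => ‖b n‖ * ∑' n, ‖a n‖)
    (fun n => continuousOn_const.mul ((continuousOn_powerSeries ha).mul
      (Continuous.continuousOn (by fun_prop))))
    (fun n ζ hζ => by simpa [hζ] using mul_le_mul_of_nonneg_left (hC ζ hζ) (norm_nonneg (b n)))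
    (hb.mul_right _)
    (fun ζ hζ => by
      have hc : ‖conj ζ‖ = 1 := by simpa using hζ
      convert (hasSum_powerSeries hb hc).mul_left (∑' n, a n * ζ ^ n) using 2 with n
      · rfl
      · ring)
  convert h using 2 with n
  have := Real.circleAverage_fun_smul (a := b n)
    (f := fun ζ : ℂ => (∑' n, a n * ζ ^ n) * conj ζ ^ n) (c := 0) (R := 1)
  simp only [smul_eq_mul] at this
  rw [this, circleAverage_powerSeries_mul_conj_pow ha, mul_comm]

/-- Pairing of two power series on the unit circle. -/
lemma circleAverage_powerSeries_mul (ha : Summable fun n => ‖a n‖) {b : ℕ → ℂ}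
    (hb : Summable fun n => ‖b n‖) :
    Real.circleAverage (fun ζ => (∑' n, a n * ζ ^ n) * ∑' n, b n * ζ ^ n) 0 1 = a 0 * b 0 := by
  have hC : ∀ ζ : ℂ, ‖ζ‖ = 1 → ‖∑' n, a n * ζ ^ n‖ ≤ ∑' n, ‖a n‖ := fun ζ hζ => by
    refine (norm_tsum_le_tsum_norm (by simpa [hζ] using ha)).trans_eq ?_
    simp [hζ]
  have h := hasSum_circleAverage (u := fun n ζ => b n * ((∑' n, a n * ζ ^ n) * ζ ^ n))
    (g := fun ζ => (∑' n, a n * ζ ^ n) * ∑' n, b n * ζ ^ n)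
    (b := fun n => ‖b n‖ * ∑' n, ‖a n‖)
    (fun n => continuousOn_const.mul ((continuousOn_powerSeries ha).mul
      (Continuous.continuousOn (by fun_prop))))
    (fun n ζ hζ => by simpa [hζ] using mul_le_mul_of_nonneg_left (hC ζ hζ) (norm_nonneg (b n)))
    (hb.mul_right _)
    (fun ζ hζ => by
      convert (hasSum_powerSeries hb hζ).mul_left (∑' n, a n * ζ ^ n) using 2 with n
      · rfl
      · ring)
  refine h.unique ?_
  have e : ∀ n, Real.circleAverage (fun ζ => b n * ((∑' n, a n * ζ ^ n) * ζ ^ n)) 0 1 =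
      if n = 0 then a 0 * b 0 else 0 := by
    intro n
    have := Real.circleAverage_fun_smul (a := b n)
      (f := fun ζ : ℂ => (∑' n, a n * ζ ^ n) * ζ ^ n) (c := 0) (R := 1)
    simp only [smul_eq_mul] at this
    rw [this, circleAverage_powerSeries_mul_pow ha]
    by_cases hn : n = 0 <;> simp [hn, mul_comm]
  simp only [e]
  simpa using hasSum_ite_eq 0 (a 0 * b 0)

/-- Parseval bound: a power series bounded by `M` on the unit circle has `∑ |a_n|² ≤ M²`. -/
lemma sum_sq_le_of_norm_powerSeries_le (ha : Summable fun n => ‖a n‖) {M : ℝ}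
    (hM : ∀ ζ : ℂ, ‖ζ‖ = 1 → ‖∑' n, a n * ζ ^ n‖ ≤ M) (s : Finset ℕ) :
    ∑ n ∈ s, ‖a n‖ ^ 2 ≤ M ^ 2 := by
  -- With b = conj a the pairing is the mean of |∑ a_n ζ^n|², which is at most M².
  have h := hasSum_circleAverage_mul_conj ha (b := fun n => conj (a n)) (by simpa using ha)
  have h2 : HasSum (fun n => ‖a n‖ ^ 2)
      (Real.circleAverage (fun ζ => (∑' n, a n * ζ ^ n) * ∑' n, conj (a n) * conj ζ ^ n) 0 1).re := by
    convert Complex.hasSum_re h using 2 with n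
    rw [mul_conj, normSq_eq_norm_sq, ofReal_re]
  refine (sum_le_hasSum s (fun n _ => by positivity) h2).trans ?_
  refine (Complex.re_le_norm _).trans ?_
  have hM0 : 0 ≤ M := (norm_nonneg _).trans (hM 1 (by simp))
  rw [circleAverage_eq_integral, norm_smul]
  have hi := intervalIntegral.norm_integral_le_of_norm_le_const (a := 0) (b := 2 * Real.pi)
    (C := M ^ 2) (f := fun θ => (∑' n, a n * (circleMap 0 1 θ) ^ n) *
      ∑' n, conj (a n) * conj (circleMap 0 1 θ) ^ n) (fun θ _ => by
      have e : ∑' n, conj (a n) * conj (circleMap 0 1 θ) ^ n =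
          conj (∑' n, a n * (circleMap 0 1 θ) ^ n) := by
        rw [conj_tsum]; simp
      rw [e, norm_mul, RCLike.norm_conj, ← sq]
      exact pow_le_pow_left₀ (norm_nonneg _) (hM _ (norm_circleMap_one θ)) 2)
  have hpi := Real.pi_pos
  refine (mul_le_mul_of_nonneg_left hi (norm_nonneg _)).trans_eq ?_
  rw [sub_zero, abs_of_pos (by positivity), Real.norm_of_nonneg (by positivity)]
  field_simp

end CircleAverages

/-! ### Von Neumann's inequality -/

section VonNeumann

lemma clm_mul_apply {F : Type*} [NormedAddCommGroup F] [NormedSpace ℂ F] (A B : F →L[ℂ] F) (x : F) :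
    (A * B) x = A (B x) := rfl

lemma clm_pow_succ_apply {F : Type*} [NormedAddCommGroup F] [NormedSpace ℂ F] (A : F →L[ℂ] F)
    (n : ℕ) (x : F) : (A ^ (n + 1)) x = A ((A ^ n) x) := by
  rw [pow_succ']; rfl

variable {E : Type*} [NormedAddCommGroup E] [InnerProductSpace ℂ E]

lemma norm_pow_apply_le {A : E →L[ℂ] E} {q : ℝ} (hA : ‖A‖ ≤ q) (n : ℕ) (x : E) :
    ‖(A ^ n) x‖ ≤ q ^ n * ‖x‖ := by
  induction n with
  | zero => simp
  | succ n ih =>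
    rw [clm_pow_succ_apply]
    refine (A.le_of_opNorm_le hA _).trans ?_
    have : 0 ≤ q := (norm_nonneg _).trans hA
    calc q * ‖(A ^ n) x‖ ≤ q * (q ^ n * ‖x‖) := by gcongr
      _ = _ := by ring

lemma summable_orbit {A : E →L[ℂ] E} (hA : ‖A‖ < 1) (x : E) : Summable fun n : ℕ => ‖(A ^ n) x‖ :=
  .of_nonneg_of_le (fun _ => norm_nonneg _) (fun n => norm_pow_apply_le le_rfl n x)
    ((summable_geometric_of_lt_one (norm_nonneg _) hA).mul_right _)

variable [CompleteSpace E]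

/-- The defect operator of a contraction. -/
lemma exists_defect {A : E →L[ℂ] E} (hA : ‖A‖ ≤ 1) :
    ∃ D : E →L[ℂ] E, ∀ u v, ⟪D u, D v⟫_ℂ = ⟪u, v⟫_ℂ - ⟪A u, A v⟫_ℂ := by
  -- The defect operator is (1 - A* A)^{1/2}; positivity of `S` is ‖A x‖ ≤ ‖x‖.
  set S : E →L[ℂ] E := 1 - star A * A with hS
  have hSn : 0 ≤ S := by
    rw [ContinuousLinearMap.nonneg_iff_isPositive, ContinuousLinearMap.isPositive_iff_complex]
    intro x
    have hx : ⟪S x, x⟫_ℂ = ((‖x‖ ^ 2 - ‖A x‖ ^ 2 : ℝ) : ℂ) := by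
      simp only [hS, sub_apply, one_apply_eq_self,
        clm_mul_apply, ContinuousLinearMap.star_eq_adjoint, inner_sub_left,
        ContinuousLinearMap.adjoint_inner_left, inner_self_eq_norm_sq_to_K]
      push_cast
      rfl
    have h1 : ‖A x‖ ≤ ‖x‖ := by simpa using A.le_of_opNorm_le hA x
    rw [hx]
    refine ⟨by rw [RCLike.re_to_complex, ofReal_re], ?_⟩
    rw [RCLike.re_to_complex, ofReal_re]
    nlinarith [norm_nonneg (A x)]
  have hsa : IsSelfAdjoint (CFC.sqrt S) := (CFC.sqrt_nonneg S).isSelfAdjoint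
  refine ⟨CFC.sqrt S, fun u v => ?_⟩
  have h2 : CFC.sqrt S * CFC.sqrt S = S := CFC.sqrt_mul_sqrt_self S hSn
  rw [← ContinuousLinearMap.adjoint_inner_right, ← ContinuousLinearMap.star_eq_adjoint,
    hsa.star_eq, ← clm_mul_apply, h2]
  simp only [hS, sub_apply, one_apply_eq_self, clm_mul_apply,
    ContinuousLinearMap.star_eq_adjoint, inner_sub_right, ContinuousLinearMap.adjoint_inner_right]

variable {A : E →L[ℂ] E}

/-- The orbit series `∑ ζ̄ⁿ Aⁿ x`. -/
def orbitSeries (A : E →L[ℂ] E) (x : E) (ζ : ℂ) : E := ∑' n : ℕ, conj ζ ^ n • (A ^ n) x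

lemma hasSum_orbitSeries (hA : ‖A‖ < 1) (x : E) {ζ : ℂ} (hζ : ‖ζ‖ = 1) :
    HasSum (fun n : ℕ => conj ζ ^ n • (A ^ n) x) (orbitSeries A x ζ) := by
  refine (Summable.of_norm ?_).hasSum
  simpa [norm_smul, hζ] using summable_orbit hA x

lemma continuousOn_orbitSeries (hA : ‖A‖ < 1) (x : E) :
    ContinuousOn (orbitSeries A x) (sphere 0 1) := by
  refine continuousOn_tsum (fun n => Continuous.continuousOn ?_) (summable_orbit hA x)
    fun _ ζ hζ => ?_
  · have : Continuous fun ζ : ℂ => conj ζ := continuous_conj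
    fun_prop
  · have : ‖ζ‖ = 1 := by simpa using hζ
    simp [this, norm_smul]

/-- The series is the resolvent (1 - ζ̄ A)⁻¹ x: multiplying it by ζ̄ A only drops the zeroth term.
-/
lemma conj_smul_apply_orbitSeries (hA : ‖A‖ < 1) (x : E) {ζ : ℂ} (hζ : ‖ζ‖ = 1) :
    conj ζ • A (orbitSeries A x ζ) = orbitSeries A x ζ - x := by
  have h := hasSum_orbitSeries hA x hζ
  have h1 := (h.mapL A).const_smul (conj ζ)
  have h2 := (hasSum_nat_add_iff' 1).mpr h
  refine h1.unique ?_
  convert h2 using 2 with n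
  · simp only [map_smul, smul_smul, clm_pow_succ_apply, ← pow_succ']
  · simp

/-- This is the operator Poisson kernel. Since |ζ| = 1, the resolvent identity replaces A s by s - x
in the subtracted inner product, and the quadratic terms cancel. The left side shows that the kernel
is positive on the diagonal, which is the source of von Neumann's inequality. -/
lemma inner_defect_orbitSeries (hA : ‖A‖ < 1) {D : E →L[ℂ] E}
    (hD : ∀ u v, ⟪D u, D v⟫_ℂ = ⟪u, v⟫_ℂ - ⟪A u, A v⟫_ℂ) (x y : E) {ζ : ℂ} (hζ : ‖ζ‖ = 1) :
    ⟪D (orbitSeries A y ζ), D (orbitSeries A x ζ)⟫_ℂ =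
      (∑' n : ℕ, ⟪(A ^ n) y, x⟫_ℂ * ζ ^ n) + (∑' n : ℕ, ⟪y, (A ^ n) x⟫_ℂ * conj ζ ^ n)
        - ⟪y, x⟫_ℂ := by
  have h1 : ⟪A (orbitSeries A y ζ), A (orbitSeries A x ζ)⟫_ℂ =
      ⟪orbitSeries A y ζ - y, orbitSeries A x ζ - x⟫_ℂ := by
    rw [← conj_smul_apply_orbitSeries hA x hζ, ← conj_smul_apply_orbitSeries hA y hζ,
      inner_smul_left, inner_smul_right, ← mul_assoc, conj_conj, mul_conj, normSq_eq_norm_sq, hζ]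
    simp
  have h2 : ∑' n : ℕ, ⟪(A ^ n) y, x⟫_ℂ * ζ ^ n = ⟪orbitSeries A y ζ, x⟫_ℂ := by
    have := (hasSum_orbitSeries hA y hζ).mapL (innerSL ℂ x)
    have h3 := (Complex.hasSum_conj'.mpr this)
    simp only [innerSL_apply_apply, inner_smul_right, map_mul, inner_conj_symm, map_pow,
      conj_conj] at h3
    rw [← h3.tsum_eq]
    simp only [mul_comm]
  have h3 : ∑' n : ℕ, ⟪y, (A ^ n) x⟫_ℂ * conj ζ ^ n = ⟪y, orbitSeries A x ζ⟫_ℂ := by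
    have := (hasSum_orbitSeries hA x hζ).mapL (innerSL ℂ y)
    simp only [innerSL_apply_apply, inner_smul_right] at this
    rw [← this.tsum_eq]
    simp only [mul_comm]
  rw [hD, h1, h2, h3]
  simp only [inner_sub_left, inner_sub_right]
  ring

lemma summable_inner_orbit (hA : ‖A‖ < 1) (x y : E) :
    Summable fun n : ℕ => ‖⟪y, (A ^ n) x⟫_ℂ‖ :=
  .of_nonneg_of_le (fun _ => norm_nonneg _) (fun _ => norm_inner_le_norm y _)
    ((summable_orbit hA x).mul_left _)

lemma summable_inner_orbit' (hA : ‖A‖ < 1) (x y : E) :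
    Summable fun n : ℕ => ‖⟪(A ^ n) y, x⟫_ℂ‖ := by
  simpa only [norm_inner_symm] using summable_inner_orbit hA y x

/-- The Poisson kernel representation of the functional calculus of a strict contraction. -/
lemma circleAverage_mul_inner_defect (hA : ‖A‖ < 1) {D : E →L[ℂ] E}
    (hD : ∀ u v, ⟪D u, D v⟫_ℂ = ⟪u, v⟫_ℂ - ⟪A u, A v⟫_ℂ) {a : ℕ → ℂ}
    (ha : Summable fun n => ‖a n‖) (x y : E) :
    Real.circleAverage (fun ζ => (∑' n, a n * ζ ^ n) *
      ⟪D (orbitSeries A y ζ), D (orbitSeries A x ζ)⟫_ℂ) 0 1 = ∑' n, a n * ⟪y, (A ^ n) x⟫_ℂ := by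
  have hp := continuousOn_powerSeries ha
  -- Against ∑ a_n ζ^n the holomorphic half of the kernel and the subtracted constant both average
  -- to a_0 ⟪y, x⟫ and cancel; the antiholomorphic half survives.
  have h1 := circleAverage_powerSeries_mul ha (summable_inner_orbit' hA x y)
  have h2 := (hasSum_circleAverage_mul_conj ha (summable_inner_orbit hA x y)).tsum_eq
  have h3 : Real.circleAverage (fun ζ => (∑' n, a n * ζ ^ n) * ⟪y, x⟫_ℂ) 0 1 = a 0 * ⟪y, x⟫_ℂ := by
    have := Real.circleAverage_fun_smul (a := ⟪y, x⟫_ℂ)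
      (f := fun ζ : ℂ => ∑' n, a n * ζ ^ n) (c := 0) (R := 1)
    simp only [smul_eq_mul] at this
    simp only [mul_comm _ ⟪y, x⟫_ℂ, this]
    have h0 := circleAverage_powerSeries_mul_pow ha 0
    simp only [pow_zero, mul_one, if_true] at h0
    rw [h0]
  have hc1 : ContinuousOn (fun ζ : ℂ => ∑' n : ℕ, ⟪(A ^ n) y, x⟫_ℂ * ζ ^ n) (sphere 0 1) :=
    continuousOn_powerSeries (summable_inner_orbit' hA x y)
  have hc2 : ContinuousOn (fun ζ : ℂ => ∑' n : ℕ, ⟪y, (A ^ n) x⟫_ℂ * conj ζ ^ n) (sphere 0 1) :=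
    (continuousOn_powerSeries (summable_inner_orbit hA x y)).comp continuous_conj.continuousOn
      fun ζ hζ => by simpa using hζ
  have hi1 := (hp.mul hc1).circleIntegrable zero_le_one
  have hi2 := (hp.mul hc2).circleIntegrable zero_le_one
  have hi3 := (hp.mul (continuousOn_const (c := ⟪y, x⟫_ℂ))).circleIntegrable zero_le_one
  have e : Set.EqOn (fun ζ => (∑' n, a n * ζ ^ n) *
      ⟪D (orbitSeries A y ζ), D (orbitSeries A x ζ)⟫_ℂ)
      (fun ζ => ((∑' n, a n * ζ ^ n) * (∑' n : ℕ, ⟪(A ^ n) y, x⟫_ℂ * ζ ^ n) +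
        (∑' n, a n * ζ ^ n) * (∑' n : ℕ, ⟪y, (A ^ n) x⟫_ℂ * conj ζ ^ n)) -
        (∑' n, a n * ζ ^ n) * ⟪y, x⟫_ℂ) (sphere 0 |1|) := by
    intro ζ hζ
    have : ‖ζ‖ = 1 := by simpa using hζ
    simp only [inner_defect_orbitSeries hA hD x y this]
    ring
  rw [Real.circleAverage_congr_sphere e]
  refine ((Real.circleAverage_sub (hi1.add hi2) hi3).trans
    (congrArg (· - _) (Real.circleAverage_add hi1 hi2))).trans ?_
  refine (congrArg₂ (· - ·) (congrArg₂ (· + ·) h1 h2.symm) h3).trans ?_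
  simp

/-- Total mass of the kernel: the Poisson representation with y = x applied to the constant series
1. -/
lemma circleAverage_norm_sq_defect (hA : ‖A‖ < 1) {D : E →L[ℂ] E}
    (hD : ∀ u v, ⟪D u, D v⟫_ℂ = ⟪u, v⟫_ℂ - ⟪A u, A v⟫_ℂ) (x : E) :
    Real.circleAverage (fun ζ => ‖D (orbitSeries A x ζ)‖ ^ 2) 0 1 = ‖x‖ ^ 2 := by
  have ha : Summable fun n => ‖(if n = 0 then 1 else 0 : ℂ)‖ :=
    summable_of_ne_finset_zero (s := {0}) fun n hn => by
      simp only [Finset.mem_singleton] at hn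
      simp [hn]
  have h := circleAverage_mul_inner_defect hA hD ha x x
  have hci : CircleIntegrable (fun ζ => ‖D (orbitSeries A x ζ)‖ ^ 2) 0 1 :=
    ((D.continuous.comp_continuousOn (continuousOn_orbitSeries hA x)).norm.pow 2).circleIntegrable
      zero_le_one
  have h2 := (Complex.ofRealCLM).circleAverage_comp_comm hci
  simp only [Function.comp_def, ofRealCLM_apply] at h2
  simp only [ite_mul, one_mul, zero_mul, tsum_ite_eq, pow_zero, one_apply_eq_self,
    inner_self_eq_norm_sq_to_K, coe_algebraMap] at h
  have h3 := h2.symm.trans ((congrArg (fun g => Real.circleAverage g 0 1) (by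
    funext ζ; push_cast; rfl)).trans h)
  exact_mod_cast h3

/-- **Von Neumann's inequality** for strict contractions. -/
theorem norm_tsum_smul_pow_le (hA : ‖A‖ < 1) {a : ℕ → ℂ} (ha : Summable fun n => ‖a n‖) {M : ℝ}
    (hM : ∀ ζ : ℂ, ‖ζ‖ = 1 → ‖∑' n, a n * ζ ^ n‖ ≤ M) :
    ‖∑' n, a n • A ^ n‖ ≤ M := by
  have hM0 : 0 ≤ M := (norm_nonneg _).trans (hM 1 (by simp))
  obtain ⟨D, hD⟩ := exists_defect hA.le
  obtain ⟨C, hC⟩ : ∃ C, ∀ n, ‖a n‖ ≤ C := ⟨_, fun n => ha.le_tsum n fun _ _ => norm_nonneg _⟩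
  have hsum : Summable fun n => a n • A ^ n := by
    refine .of_norm_bounded_eventually_nat ((summable_geometric_of_lt_one (norm_nonneg _) hA).mul_left C) ?_
    filter_upwards [eventually_gt_atTop 0] with n hn
    rw [norm_smul]
    exact mul_le_mul (hC n) (norm_pow_le' A hn) (norm_nonneg _) ((norm_nonneg _).trans (hC 0))
  -- The arithmetic-geometric inequality bounds the kernel by two squares whose averages are known,
  -- in place of Cauchy–Schwarz for integrals; optimality is restored afterwards by rescaling y.
  have key : ∀ x y : E, ‖⟪y, (∑' n, a n • A ^ n) x⟫_ℂ‖ ≤ M * ((‖y‖ ^ 2 + ‖x‖ ^ 2) / 2) := by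
    intro x y
    have e : ⟪y, (∑' n, a n • A ^ n) x⟫_ℂ = ∑' n, a n * ⟪y, (A ^ n) x⟫_ℂ := by
      have h := (hsum.hasSum.mapL (ContinuousLinearMap.apply ℂ E x)).mapL (innerSL ℂ y)
      simpa [inner_smul_right] using h.tsum_eq.symm
    rw [e, ← circleAverage_mul_inner_defect hA hD ha x y]
    have hcx := D.continuous.comp_continuousOn (continuousOn_orbitSeries hA x)
    have hcy := D.continuous.comp_continuousOn (continuousOn_orbitSeries hA y)
    have hix : CircleIntegrable (fun ζ => ‖D (orbitSeries A x ζ)‖ ^ 2) 0 1 :=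
      (hcx.norm.pow 2).circleIntegrable zero_le_one
    have hiy : CircleIntegrable (fun ζ => ‖D (orbitSeries A y ζ)‖ ^ 2) 0 1 :=
      (hcy.norm.pow 2).circleIntegrable zero_le_one
    have hR : Real.circleAverage (fun ζ => (M / 2) • (‖D (orbitSeries A y ζ)‖ ^ 2 +
        ‖D (orbitSeries A x ζ)‖ ^ 2)) 0 1 = M * ((‖y‖ ^ 2 + ‖x‖ ^ 2) / 2) := by
      rw [Real.circleAverage_fun_smul, Real.circleAverage_fun_add hiy hix,
        circleAverage_norm_sq_defect hA hD, circleAverage_norm_sq_defect hA hD, smul_eq_mul]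
      ring
    rw [← hR, circleAverage_eq_integral, circleAverage_eq_integral, norm_smul, smul_eq_mul,
      Real.norm_of_nonneg (by positivity)]
    refine mul_le_mul_of_nonneg_left ?_ (by positivity)
    refine intervalIntegral.norm_integral_le_of_norm_le (by positivity) (ae_of_all _ fun θ _ => ?_)
      ((IntervalIntegrable.add hiy hix).const_mul (M / 2))
    have h1 := hM _ (norm_circleMap_one θ)
    have h2 := norm_inner_le_norm (𝕜 := ℂ) (D (orbitSeries A y (circleMap 0 1 θ)))
      (D (orbitSeries A x (circleMap 0 1 θ)))
    rw [norm_mul, smul_eq_mul]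
    refine (mul_le_mul h1 h2 (norm_nonneg _) hM0).trans ?_
    nlinarith [sq_nonneg (‖D (orbitSeries A y (circleMap 0 1 θ))‖ -
      ‖D (orbitSeries A x (circleMap 0 1 θ))‖)]
  refine ContinuousLinearMap.opNorm_le_bound _ hM0 fun x => ?_
  set z := (∑' n, a n • A ^ n) x with hz
  rcases eq_or_ne z 0 with h0 | h0
  · rw [h0, norm_zero]; positivity
  rcases eq_or_ne x 0 with hx0 | hx0
  · exact absurd (by rw [hz, hx0, map_zero]) h0
  have hzp : 0 < ‖z‖ := norm_pos_iff.mpr h0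
  have hxp : 0 < ‖x‖ := norm_pos_iff.mpr hx0
  -- This y has the direction of z and the norm of x, so that `key` reads ‖x‖ ‖z‖ ≤ M ‖x‖².
  have h := key x (((‖x‖ / ‖z‖ : ℝ) : ℂ) • z)
  rw [← hz, inner_smul_left, norm_mul, norm_smul, inner_self_eq_norm_sq_to_K] at h
  simp only [RCLike.norm_conj, norm_real, norm_div, norm_norm, norm_pow, coe_algebraMap] at h
  rw [div_mul_cancel₀ _ hzp.ne'] at h
  have h5 : ‖x‖ / ‖z‖ * ‖z‖ ^ 2 = ‖x‖ * ‖z‖ := by field_simp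
  rw [h5] at h
  nlinarith

end VonNeumann

/-! ### The `H^∞` functional calculus of completely non unitary contractions -/

section FunctionalCalculus

/-- `∑ c_n z^n` converges on the open unit disc and is bounded by `M` there. -/
structure IsBoundedSeries (c : ℕ → ℂ) (M : ℝ) : Prop where
  summable : ∀ ρ : ℝ, 0 ≤ ρ → ρ < 1 → Summable fun n => ‖c n‖ * ρ ^ n
  bound : ∀ z : ℂ, ‖z‖ < 1 → ‖∑' n, c n * z ^ n‖ ≤ M

lemma hasSum_taylorCoeff {f : ℂ → ℂ} (hf : DifferentiableOn ℂ f (ball 0 1)) {z : ℂ}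
    (hz : ‖z‖ < 1) : HasSum (fun n => taylorCoeff f n * z ^ n) (f z) := by
  convert Complex.hasSum_taylorSeries_on_ball hf (by simpa using hz : z ∈ ball (0 : ℂ) 1) using 2
    with n
  · rfl
  · simp only [taylorCoeff, sub_zero, smul_eq_mul]
    ring

lemma summable_norm_taylorCoeff {f : ℂ → ℂ} (hf : DifferentiableOn ℂ f (ball 0 1)) {ρ : ℝ}
    (h0 : 0 ≤ ρ) (h1 : ρ < 1) : Summable fun n => ‖taylorCoeff f n‖ * ρ ^ n := by
  have h := (hasSum_taylorCoeff hf (z := (ρ : ℂ))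
    (by rwa [norm_real, Real.norm_of_nonneg h0])).summable.norm
  simpa [norm_mul, norm_pow, abs_of_nonneg h0] using h

lemma IsHInf.exists_isBoundedSeries {f : ℂ → ℂ} (hf : IsHInf f) :
    ∃ M, IsBoundedSeries (taylorCoeff f) M := by
  obtain ⟨hd, M, hM⟩ := hf
  refine ⟨M, fun ρ h0 h1 => summable_norm_taylorCoeff hd h0 h1, fun z hz => ?_⟩
  rw [(hasSum_taylorCoeff hd hz).tsum_eq]
  exact hM z (by simpa using hz)

/-- `∑ c_n ρ^n T^n`. -/
def abelSum {E : Type*} [NormedAddCommGroup E] [NormedSpace ℂ E] (c : ℕ → ℂ) (T : E →L[ℂ] E)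
    (ρ : ℝ) : E →L[ℂ] E := ∑' n : ℕ, (c n * (ρ : ℂ) ^ n) • T ^ n

variable {c : ℕ → ℂ} {M : ℝ}

lemma IsBoundedSeries.summable_norm_mul_pow (hc : IsBoundedSeries c M) {ρ : ℝ} (h0 : 0 ≤ ρ)
    (h1 : ρ < 1) : Summable fun n => ‖c n * (ρ : ℂ) ^ n‖ := by
  simpa [norm_mul, norm_pow, abs_of_nonneg h0] using hc.summable ρ h0 h1

lemma IsBoundedSeries.norm_tsum_le (hc : IsBoundedSeries c M) {ρ : ℝ} (h0 : 0 ≤ ρ)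
    (h1 : ρ < 1) {ζ : ℂ} (hζ : ‖ζ‖ = 1) : ‖∑' n, (c n * (ρ : ℂ) ^ n) * ζ ^ n‖ ≤ M := by
  have := hc.bound (ρ * ζ) (by rwa [norm_mul, hζ, mul_one, norm_real, Real.norm_of_nonneg h0])
  simpa only [mul_pow, mul_assoc] using this

/-- Parseval on each circle of radius ρ < 1 bounds every finite sum by M², and then ρ → 1. -/
lemma IsBoundedSeries.summable_sq (hc : IsBoundedSeries c M) : Summable fun n => ‖c n‖ ^ 2 := by
  refine summable_of_sum_le (c := M ^ 2) (fun n => by positivity) fun s => ?_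
  have h : ∀ ρ : ℝ, 0 ≤ ρ → ρ < 1 → ∑ n ∈ s, (‖c n‖ * ρ ^ n) ^ 2 ≤ M ^ 2 := fun ρ h0 h1 => by
    have := sum_sq_le_of_norm_powerSeries_le (hc.summable_norm_mul_pow h0 h1)
      (fun ζ hζ => hc.norm_tsum_le h0 h1 hζ) s
    simpa [norm_mul, norm_pow, abs_of_nonneg h0] using this
  have ht : Tendsto (fun ρ : ℝ => ∑ n ∈ s, (‖c n‖ * ρ ^ n) ^ 2) (𝓝[<] 1)
      (𝓝 (∑ n ∈ s, (‖c n‖ * 1 ^ n) ^ 2)) := by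
    refine (Continuous.tendsto ?_ 1).mono_left nhdsWithin_le_nhds
    fun_prop
  have := le_of_tendsto ht (by
    filter_upwards [Ioo_mem_nhdsLT (zero_lt_one' ℝ)] with ρ hρ using h ρ hρ.1.le hρ.2)
  simpa using this

section Normed

variable {E : Type*} [NormedAddCommGroup E] [NormedSpace ℂ E] {T : E →L[ℂ] E}

lemma norm_pow_le_one (hT : ‖T‖ ≤ 1) (n : ℕ) : ‖T ^ n‖ ≤ 1 := by
  refine ContinuousLinearMap.opNorm_le_bound _ zero_le_one fun x => ?_
  induction n with
  | zero => simp
  | succ n ih =>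
    rw [clm_pow_succ_apply]
    exact (T.le_of_opNorm_le hT _).trans (by simpa using ih)

lemma IsBoundedSeries.summable_norm_smul_pow (hc : IsBoundedSeries c M) (hT : ‖T‖ ≤ 1) {ρ : ℝ}
    (h0 : 0 ≤ ρ) (h1 : ρ < 1) : Summable fun n => ‖(c n * (ρ : ℂ) ^ n) • T ^ n‖ := by
  refine .of_nonneg_of_le (fun _ => norm_nonneg _) (fun n => ?_) (hc.summable_norm_mul_pow h0 h1)
  rw [norm_smul]
  exact mul_le_of_le_one_right (norm_nonneg _) (norm_pow_le_one hT n)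

variable [CompleteSpace E]

lemma IsBoundedSeries.hasSum_abelSum (hc : IsBoundedSeries c M) (hT : ‖T‖ ≤ 1) {ρ : ℝ}
    (h0 : 0 ≤ ρ) (h1 : ρ < 1) :
    HasSum (fun n => (c n * (ρ : ℂ) ^ n) • T ^ n) (abelSum c T ρ) :=
  (hc.summable_norm_smul_pow hT h0 h1).of_norm.hasSum

lemma IsBoundedSeries.hasSum_abelSum_apply (hc : IsBoundedSeries c M) (hT : ‖T‖ ≤ 1) {ρ : ℝ}
    (h0 : 0 ≤ ρ) (h1 : ρ < 1) (x : E) :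
    HasSum (fun n => (c n * (ρ : ℂ) ^ n) • (T ^ n) x) (abelSum c T ρ x) :=
  (hc.hasSum_abelSum hT h0 h1).mapL (ContinuousLinearMap.apply ℂ E x)

/-- A bounded operator intertwining two contractions intertwines their functional calculi. -/
lemma IsBoundedSeries.abelSum_intertwine {F : Type*} [NormedAddCommGroup F] [NormedSpace ℂ F]
    [CompleteSpace F] (hc : IsBoundedSeries c M) (hT : ‖T‖ ≤ 1) {S : F →L[ℂ] F} (hS : ‖S‖ ≤ 1)
    {J : E →L[ℂ] F} (hJ : ∀ x, J (T x) = S (J x)) {ρ : ℝ} (h0 : 0 ≤ ρ) (h1 : ρ < 1) (x : E) :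
    J (abelSum c T ρ x) = abelSum c S ρ (J x) := by
  have hpow : ∀ n : ℕ, J ((T ^ n) x) = (S ^ n) (J x) := fun n => by
    induction n with
    | zero => rfl
    | succ n ih => rw [clm_pow_succ_apply, clm_pow_succ_apply, hJ, ih]
  have h := (hc.hasSum_abelSum_apply hT h0 h1 x).mapL J
  simp only [map_smul, hpow] at h
  exact h.unique (hc.hasSum_abelSum_apply hS h0 h1 (J x))

end Normed

variable {E : Type*} [NormedAddCommGroup E] [InnerProductSpace ℂ E] [CompleteSpace E]
  {T : E →L[ℂ] E}

/-- **Von Neumann's inequality** for the functional calculus. -/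
lemma IsBoundedSeries.norm_abelSum_le (hc : IsBoundedSeries c M) (hT : ‖T‖ ≤ 1) {ρ : ℝ}
    (h0 : 0 ≤ ρ) (h1 : ρ < 1) : ‖abelSum c T ρ‖ ≤ M := by
  -- Split ρ = √ρ · √ρ: one factor makes T a strict contraction, the other makes the coefficients
  -- absolutely summable.
  have hs0 : 0 ≤ √ρ := Real.sqrt_nonneg ρ
  have hs1 : √ρ < 1 := by rwa [Real.sqrt_lt' one_pos, one_pow]
  have hA : ‖((√ρ : ℝ) : ℂ) • T‖ < 1 := by
    rw [norm_smul, norm_real, Real.norm_of_nonneg hs0]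
    nlinarith [norm_nonneg T]
  have h := norm_tsum_smul_pow_le hA (hc.summable_norm_mul_pow hs0 hs1)
    (fun ζ hζ => hc.norm_tsum_le hs0 hs1 hζ)
  convert h using 2
  unfold abelSum
  congr 1
  funext n
  rw [smul_pow, smul_smul, mul_assoc, ← mul_pow, ← ofReal_mul, Real.mul_self_sqrt h0]

lemma IsBoundedSeries.norm_abelSum_apply_le (hc : IsBoundedSeries c M) (hT : ‖T‖ ≤ 1) {ρ : ℝ}
    (h0 : 0 ≤ ρ) (h1 : ρ < 1) (x : E) : ‖abelSum c T ρ x‖ ≤ M * ‖x‖ :=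
  (abelSum c T ρ).le_of_opNorm_le (hc.norm_abelSum_le hT h0 h1) x

/-- The vectors on which the functional calculus converges. -/
def convergenceSpace (c : ℕ → ℂ) (T : E →L[ℂ] E) : Submodule ℂ E where
  carrier := {x | ∃ y, Tendsto (fun ρ : ℝ => abelSum c T ρ x) (𝓝[<] 1) (𝓝 y)}
  add_mem' := by
    rintro x x' ⟨y, hy⟩ ⟨y', hy'⟩
    exact ⟨y + y', by simpa using hy.add hy'⟩
  zero_mem' := ⟨0, by simp⟩
  smul_mem' := by
    rintro a x ⟨y, hy⟩
    exact ⟨a • y, by simpa using hy.const_smul a⟩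

lemma mem_convergenceSpace {x : E} : x ∈ convergenceSpace c T ↔
    ∃ y, Tendsto (fun ρ : ℝ => abelSum c T ρ x) (𝓝[<] 1) (𝓝 y) := Iff.rfl

lemma mem_convergenceSpace_iff_cauchy {x : E} : x ∈ convergenceSpace c T ↔
    Cauchy (map (fun ρ : ℝ => abelSum c T ρ x) (𝓝[<] 1)) := by
  rw [mem_convergenceSpace, cauchy_map_iff_exists_tendsto]

/-- Von Neumann's bound is uniform in ρ, so the Cauchy property passes to limits of vectors by an
ε/3 argument. -/
lemma IsBoundedSeries.isClosed_convergenceSpace (hc : IsBoundedSeries c M) (hT : ‖T‖ ≤ 1) :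
    IsClosed (convergenceSpace c T : Set E) := by
  refine isClosed_of_closure_subset fun x hx => ?_
  have hM : 0 ≤ M := (norm_nonneg _).trans (hc.norm_abelSum_le hT le_rfl zero_lt_one)
  rw [SetLike.mem_coe, mem_convergenceSpace_iff_cauchy, cauchy_map_iff']
  rw [Metric.uniformity_basis_dist.tendsto_right_iff]
  intro ε hε
  -- M + 1 rather than M, since M may be 0.
  obtain ⟨y, hy, hxy⟩ := Metric.mem_closure_iff.mp hx (ε / (3 * (M + 1))) (by positivity)
  rw [SetLike.mem_coe, mem_convergenceSpace_iff_cauchy, cauchy_map_iff'] at hy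
  have hy2 := (Metric.uniformity_basis_dist.tendsto_right_iff.mp hy) (ε / 3) (by positivity)
  have hI : Set.Ioo (0 : ℝ) 1 ×ˢ Set.Ioo (0 : ℝ) 1 ∈ 𝓝[<] (1 : ℝ) ×ˢ 𝓝[<] (1 : ℝ) :=
    prod_mem_prod (Ioo_mem_nhdsLT (zero_lt_one' ℝ)) (Ioo_mem_nhdsLT (zero_lt_one' ℝ))
  filter_upwards [hy2, hI] with p hp hpI
  have hb : ∀ ρ : ℝ, ρ ∈ Set.Ioo (0 : ℝ) 1 → ‖abelSum c T ρ x - abelSum c T ρ y‖ < ε / 3 := by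
    intro ρ hρ
    rw [← map_sub]
    refine (hc.norm_abelSum_apply_le hT hρ.1.le hρ.2 _).trans_lt ?_
    rw [dist_eq_norm] at hxy
    calc M * ‖x - y‖ ≤ (M + 1) * ‖x - y‖ := by gcongr; linarith
      _ < (M + 1) * (ε / (3 * (M + 1))) := by gcongr
      _ = ε / 3 := by field_simp
  have h1 := hb p.1 hpI.1
  have h2 := hb p.2 hpI.2
  simp only [dist_eq_norm] at hp ⊢
  rw [norm_sub_rev] at h2
  calc ‖abelSum c T p.1 x - abelSum c T p.2 x‖
      = ‖(abelSum c T p.1 x - abelSum c T p.1 y) + (abelSum c T p.1 y - abelSum c T p.2 y)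
        + (abelSum c T p.2 y - abelSum c T p.2 x)‖ := by congr 1; abel
    _ ≤ _ := norm_add₃_le
    _ < ε / 3 + ε / 3 + ε / 3 := by gcongr
    _ = ε := by ring

section Isometry

variable {V : E →L[ℂ] E}

lemma norm_le_one_of_isometry (hV : ∀ x, ‖V x‖ = ‖x‖) : ‖V‖ ≤ 1 :=
  ContinuousLinearMap.opNorm_le_bound _ zero_le_one fun x => by rw [hV, one_mul]

lemma norm_pow_apply_of_isometry (hV : ∀ x, ‖V x‖ = ‖x‖) (n : ℕ) (x : E) :
    ‖(V ^ n) x‖ = ‖x‖ := by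
  induction n with
  | zero => rfl
  | succ n ih => rw [clm_pow_succ_apply, hV, ih]

lemma inner_map_map_of_isometry (hV : ∀ x, ‖V x‖ = ‖x‖) (x y : E) :
    ⟪V x, V y⟫_ℂ = ⟪x, y⟫_ℂ :=
  (LinearIsometry.mk V.toLinearMap hV).inner_map_map x y

lemma inner_pow_map_pow_of_isometry (hV : ∀ x, ‖V x‖ = ‖x‖) (n : ℕ) (x y : E) :
    ⟪(V ^ n) x, (V ^ n) y⟫_ℂ = ⟪x, y⟫_ℂ := by
  induction n with
  | zero => rfl
  | succ n ih => rw [clm_pow_succ_apply, clm_pow_succ_apply, inner_map_map_of_isometry hV, ih]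

lemma inner_pow_eq_zero_of_wandering (hV : ∀ x, ‖V x‖ = ‖x‖) {w : E}
    (hw : ∀ n : ℕ, ⟪w, (V ^ (n + 1)) w⟫_ℂ = 0) {i j : ℕ} (hij : i ≠ j) :
    ⟪(V ^ i) w, (V ^ j) w⟫_ℂ = 0 := by
  have key : ∀ i k : ℕ, ⟪(V ^ i) w, (V ^ (i + k + 1)) w⟫_ℂ = 0 := fun i k => by
    rw [add_assoc, pow_add, clm_mul_apply, inner_pow_map_pow_of_isometry hV, hw]
  rcases lt_or_gt_of_ne hij with h | h
  · obtain ⟨k, rfl⟩ := Nat.exists_eq_add_of_lt h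
    exact key i k
  · obtain ⟨k, rfl⟩ := Nat.exists_eq_add_of_lt h
    rw [← inner_conj_symm, key, map_zero]

lemma orthogonalFamily_of_wandering (hV : ∀ x, ‖V x‖ = ‖x‖) {w : E} (hw1 : ‖w‖ = 1)
    (hw : ∀ n : ℕ, ⟪w, (V ^ (n + 1)) w⟫_ℂ = 0) :
    Orthonormal ℂ fun n : ℕ => (V ^ n) w :=
  ⟨fun n => by rw [norm_pow_apply_of_isometry hV, hw1],
    fun _ _ hij => inner_pow_eq_zero_of_wandering hV hw hij⟩

lemma hasSum_norm_sq_of_orthonormal {e : ℕ → E} (he : Orthonormal ℂ e) {b : ℕ → ℂ} {z : E}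
    (hz : HasSum (fun n => b n • e n) z) : HasSum (fun n => ‖b n‖ ^ 2) (‖z‖ ^ 2) := by
  have h : Tendsto (fun s : Finset ℕ => ‖∑ n ∈ s, b n • e n‖ ^ 2) atTop (𝓝 (‖z‖ ^ 2)) :=
    (Filter.Tendsto.norm hz).pow 2
  refine h.congr fun s => ?_
  simpa using he.orthogonalFamily.norm_sum b s

/-- The orbit of a wandering vector is orthogonal, so ∑ c_n V^n w converges because ∑ |c_n|² < ∞,
and the Abel limit becomes dominated convergence in ℓ². -/
lemma IsBoundedSeries.mem_convergenceSpace_of_wandering (hc : IsBoundedSeries c M)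
    (hV : ∀ x, ‖V x‖ = ‖x‖) {w : E} (hw : ∀ n : ℕ, ⟪w, (V ^ (n + 1)) w⟫_ℂ = 0) :
    w ∈ convergenceSpace c V := by
  wlog hw1 : ‖w‖ = 1 generalizing w
  · rcases eq_or_ne w 0 with rfl | h0
    · exact zero_mem _
    have hn : ‖w‖ ≠ 0 := norm_ne_zero_iff.mpr h0
    have h := this (w := ((‖w‖⁻¹ : ℝ) : ℂ) • w)
      (fun n => by rw [map_smul, inner_smul_left, inner_smul_right, hw]; simp)
      (by rw [norm_smul, norm_real, norm_inv, norm_norm, inv_mul_cancel₀ hn])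
    have h2 := (convergenceSpace c V).smul_mem (‖w‖ : ℂ) h
    rwa [smul_smul, ← ofReal_mul, mul_inv_cancel₀ hn, ofReal_one, one_smul] at h2
  have he := orthogonalFamily_of_wandering hV hw1 hw
  have hsum : Summable fun n => c n • (V ^ n) w := by
    have := (he.orthogonalFamily.summable_iff_norm_sq_summable c).mpr hc.summable_sq
    simpa using this
  refine ⟨∑' n, c n • (V ^ n) w, ?_⟩
  rw [tendsto_iff_norm_sub_tendsto_zero]
  have hsq : ∀ ρ ∈ Set.Ioo (0 : ℝ) 1, ‖abelSum c V ρ w - ∑' n, c n • (V ^ n) w‖ ^ 2 =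
      ∑' n, ‖c n * ((ρ : ℂ) ^ n - 1)‖ ^ 2 := by
    intro ρ hρ
    have h := (hc.hasSum_abelSum_apply (norm_le_one_of_isometry hV) hρ.1.le hρ.2 w).sub hsum.hasSum
    simp only [← sub_smul] at h
    rw [← (hasSum_norm_sq_of_orthonormal he h).tsum_eq]
    congr 1
    funext n
    rw [mul_sub, mul_one]
  have ht : Tendsto (fun ρ : ℝ => ∑' n, ‖c n * ((ρ : ℂ) ^ n - 1)‖ ^ 2) (𝓝[<] 1)
      (𝓝 (∑' _ : ℕ, (0 : ℝ))) := by
    refine tendsto_tsum_of_dominated_convergence (hc.summable_sq) (fun n => ?_) ?_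
    · have : Continuous fun ρ : ℝ => ‖c n * ((ρ : ℂ) ^ n - 1)‖ ^ 2 := by fun_prop
      have h := (this.tendsto 1).mono_left (nhdsWithin_le_nhds (s := Set.Iio 1))
      simpa using h
    · filter_upwards [Ioo_mem_nhdsLT (zero_lt_one' ℝ)] with ρ hρ n
      rw [Real.norm_of_nonneg (by positivity), norm_mul]
      refine pow_le_pow_left₀ (by positivity) (mul_le_of_le_one_right (norm_nonneg _) ?_) 2
      have h1 : ρ ^ n ≤ 1 := pow_le_one₀ hρ.1.le hρ.2.le
      have h2 : 0 ≤ ρ ^ n := pow_nonneg hρ.1.le n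
      rw [← ofReal_pow, ← ofReal_one, ← ofReal_sub, norm_real, Real.norm_eq_abs, abs_le]
      constructor <;> linarith
  rw [tsum_zero] at ht
  have ht2 := ht.sqrt
  rw [Real.sqrt_zero] at ht2
  refine ht2.congr' ?_
  filter_upwards [Ioo_mem_nhdsLT (zero_lt_one' ℝ)] with ρ hρ
  rw [← hsq ρ hρ, Real.sqrt_sq (norm_nonneg _)]

open ContinuousLinearMap (adjoint adjoint_inner_left adjoint_inner_right)

lemma adjoint_apply_apply_of_isometry (hV : ∀ x, ‖V x‖ = ‖x‖) (x : E) : adjoint V (V x) = x :=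
  ext_inner_left ℂ fun y => by rw [adjoint_inner_right, inner_map_map_of_isometry hV]

/-- The kernel of V* is orthogonal to the range of V, so its vectors are wandering. -/
lemma IsBoundedSeries.mem_convergenceSpace_of_adjoint_eq_zero (hc : IsBoundedSeries c M)
    (hV : ∀ x, ‖V x‖ = ‖x‖) {w : E} (hw : adjoint V w = 0) : w ∈ convergenceSpace c V :=
  hc.mem_convergenceSpace_of_wandering hV fun n => by
    rw [clm_pow_succ_apply, ← adjoint_inner_left, hw, inner_zero_left]

/-- V commutes with the Abel sums and, being isometric, both preserves and reflects the Cauchy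
property. -/
lemma IsBoundedSeries.map_mem_convergenceSpace_iff (hc : IsBoundedSeries c M)
    (hV : ∀ x, ‖V x‖ = ‖x‖) {x : E} : V x ∈ convergenceSpace c V ↔ x ∈ convergenceSpace c V := by
  have hV1 := norm_le_one_of_isometry hV
  have hui : IsUniformInducing V := (AddMonoidHomClass.isometry_of_norm V hV).isUniformInducing
  have he : (fun ρ : ℝ => abelSum c V ρ (V x)) =ᶠ[𝓝[<] 1] fun ρ => V (abelSum c V ρ x) := by
    filter_upwards [Ioo_mem_nhdsLT (zero_lt_one' ℝ)] with ρ hρ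
    exact (hc.abelSum_intertwine hV1 hV1 (J := V) (fun _ => rfl) hρ.1.le hρ.2 x).symm
  rw [mem_convergenceSpace_iff_cauchy, mem_convergenceSpace_iff_cauchy, Filter.map_congr he]
  rw [show (fun ρ : ℝ => V (abelSum c V ρ x)) = V ∘ fun ρ : ℝ => abelSum c V ρ x from rfl,
    ← Filter.map_map]
  exact hui.cauchy_map_iff

lemma sub_mem_ker_adjoint (hV : ∀ x, ‖V x‖ = ‖x‖) (x : E) :
    adjoint V (x - V (adjoint V x)) = 0 := by
  rw [map_sub, adjoint_apply_apply_of_isometry hV, sub_self]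

/-- x - V V* x lies in ker V*, where convergence is known; hence V V* x converges too, and V can be
cancelled. The convergence space thus reduces V. -/
lemma IsBoundedSeries.adjoint_mem_convergenceSpace (hc : IsBoundedSeries c M)
    (hV : ∀ x, ‖V x‖ = ‖x‖) {x : E} (hx : x ∈ convergenceSpace c V) :
    adjoint V x ∈ convergenceSpace c V := by
  rw [← hc.map_mem_convergenceSpace_iff hV]
  have h := (convergenceSpace c V).sub_mem hx
    (hc.mem_convergenceSpace_of_adjoint_eq_zero hV (sub_mem_ker_adjoint hV x))
  rwa [sub_sub_cancel] at h

lemma IsBoundedSeries.map_mem_orthogonal (hc : IsBoundedSeries c M) (hV : ∀ x, ‖V x‖ = ‖x‖)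
    {x : E} (hx : x ∈ (convergenceSpace c V)ᗮ) : V x ∈ (convergenceSpace c V)ᗮ := by
  rw [Submodule.mem_orthogonal] at hx ⊢
  intro u hu
  rw [← adjoint_inner_left]
  exact hx _ (hc.adjoint_mem_convergenceSpace hV hu)

lemma IsBoundedSeries.adjoint_mem_orthogonal (hc : IsBoundedSeries c M) (hV : ∀ x, ‖V x‖ = ‖x‖)
    {x : E} (hx : x ∈ (convergenceSpace c V)ᗮ) : adjoint V x ∈ (convergenceSpace c V)ᗮ := by
  rw [Submodule.mem_orthogonal] at hx ⊢
  intro u hu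
  rw [adjoint_inner_right]
  exact hx _ ((hc.map_mem_convergenceSpace_iff hV).mpr hu)

/-- V is unitary on the complement: x - V V* x lies in the convergence space and in its complement,
hence vanishes. -/
lemma IsBoundedSeries.norm_adjoint_of_mem_orthogonal (hc : IsBoundedSeries c M)
    (hV : ∀ x, ‖V x‖ = ‖x‖) {x : E} (hx : x ∈ (convergenceSpace c V)ᗮ) :
    ‖adjoint V x‖ = ‖x‖ := by
  have h1 : x - V (adjoint V x) ∈ (convergenceSpace c V)ᗮ :=
    sub_mem hx (hc.map_mem_orthogonal hV (hc.adjoint_mem_orthogonal hV hx))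
  have h2 := hc.mem_convergenceSpace_of_adjoint_eq_zero hV (sub_mem_ker_adjoint hV x)
  have h3 := (Submodule.mem_orthogonal _ _).mp h1 _ h2
  rw [inner_self_eq_zero, sub_eq_zero] at h3
  conv_rhs => rw [h3, hV]

end Isometry

end FunctionalCalculus

/-! ### The isometric dilation of a contraction -/

section Dilation

variable {E : Type*} [NormedAddCommGroup E] [InnerProductSpace ℂ E] [CompleteSpace E]

/-- `ℓ²(ℕ, E)`. -/
abbrev L2Seq (E : Type*) [NormedAddCommGroup E] : Type _ := lp (fun _ : ℕ => E) 2

omit [InnerProductSpace ℂ E] [CompleteSpace E] in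
lemma hasSum_norm_sq_L2Seq (k : L2Seq E) : HasSum (fun n => ‖k n‖ ^ 2) (‖k‖ ^ 2) := by
  have h2 : (0 : ℝ) < (2 : ℝ≥0∞).toReal := by norm_num
  have h := lp.hasSum_norm h2 k
  simpa using h

omit [InnerProductSpace ℂ E] [CompleteSpace E] in
lemma memℓp_two_of_summable {f : ℕ → E} (hf : Summable fun n => ‖f n‖ ^ 2) : Memℓp f 2 := by
  have h2 : (0 : ℝ) < (2 : ℝ≥0∞).toReal := by norm_num
  rw [memℓp_gen_iff h2]
  simpa using hf

/-- The entries of the dilation: `(k₀, k₁, …) ↦ (T k₀, D k₀, k₁, …)`. -/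
def dilationFun (T D : E →L[ℂ] E) (k : ℕ → E) : ℕ → E
  | 0 => T (k 0)
  | 1 => D (k 0)
  | n + 2 => k (n + 1)

variable {T D : E →L[ℂ] E}

/-- ‖D k₀‖² = ‖k₀‖² - ‖T k₀‖², so the first two new entries together weigh ‖k₀‖²; the other entries
are merely shifted. -/
lemma hasSum_dilationFun (hD : ∀ u v, ⟪D u, D v⟫_ℂ = ⟪u, v⟫_ℂ - ⟪T u, T v⟫_ℂ) (k : L2Seq E) :
    HasSum (fun n => ‖dilationFun T D k n‖ ^ 2) (‖k‖ ^ 2) := by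
  have h := hasSum_norm_sq_L2Seq k
  have hD0 : ‖D (k 0)‖ ^ 2 = ‖k 0‖ ^ 2 - ‖T (k 0)‖ ^ 2 := by
    have := hD (k 0) (k 0)
    simp only [inner_self_eq_norm_sq_to_K, coe_algebraMap] at this
    exact_mod_cast this
  have h1 := (hasSum_nat_add_iff' 1).mpr h
  refine (hasSum_nat_add_iff' 2).mp ?_
  have e : ‖k‖ ^ 2 - ∑ i ∈ Finset.range 2, ‖dilationFun T D k i‖ ^ 2 =
      ‖k‖ ^ 2 - ∑ i ∈ Finset.range 1, ‖k i‖ ^ 2 := by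
    rw [Finset.sum_range_succ, Finset.sum_range_one, Finset.sum_range_one]
    simp only [dilationFun, hD0]
    ring
  rw [e]
  exact h1

/-- The isometric dilation of a contraction `T` with defect operator `D`. -/
def dilation (hD : ∀ u v, ⟪D u, D v⟫_ℂ = ⟪u, v⟫_ℂ - ⟪T u, T v⟫_ℂ) : L2Seq E →ₗᵢ[ℂ] L2Seq E where
  toFun k := ⟨dilationFun T D k, memℓp_two_of_summable (hasSum_dilationFun hD k).summable⟩
  map_add' k l := by
    ext n
    rcases n with _ | _ | n
    · exact map_add T (k 0) (l 0)
    · exact map_add D (k 0) (l 0)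
    · rfl
  map_smul' a k := by
    ext n
    rcases n with _ | _ | n
    · exact map_smul T a (k 0)
    · exact map_smul D a (k 0)
    · rfl
  norm_map' k := by
    have h := (hasSum_norm_sq_L2Seq (⟨dilationFun T D k,
      memℓp_two_of_summable (hasSum_dilationFun hD k).summable⟩ : L2Seq E)).unique
      (hasSum_dilationFun hD k)
    exact (sq_eq_sq₀ (norm_nonneg _) (norm_nonneg _)).mp h

/-- The coordinate `k ↦ k₀`. -/
def evalZero (E : Type*) [NormedAddCommGroup E] [InnerProductSpace ℂ E] : L2Seq E →L[ℂ] E :=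
  lp.evalCLM ℂ (fun _ : ℕ => E) 2 0

lemma evalZero_apply (k : L2Seq E) : evalZero E k = k 0 := rfl

lemma evalZero_dilation (hD : ∀ u v, ⟪D u, D v⟫_ℂ = ⟪u, v⟫_ℂ - ⟪T u, T v⟫_ℂ) (k : L2Seq E) :
    evalZero E (dilation hD k) = T (evalZero E k) := rfl

lemma dilation_single_succ (hD : ∀ u v, ⟪D u, D v⟫_ℂ = ⟪u, v⟫_ℂ - ⟪T u, T v⟫_ℂ) (n : ℕ) (h : E) :
    dilation hD (lp.single 2 (n + 1) h) = lp.single 2 (n + 2) h := by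
  ext m
  change dilationFun T D (lp.single 2 (n + 1) h : L2Seq E) m = _
  rcases m with _ | _ | m <;> simp [dilationFun, Pi.single_apply]

lemma dilation_pow_single (hD : ∀ u v, ⟪D u, D v⟫_ℂ = ⟪u, v⟫_ℂ - ⟪T u, T v⟫_ℂ) (n : ℕ) (h : E) :
    ((dilation hD).toContinuousLinearMap ^ n) (lp.single 2 1 h) = lp.single 2 (n + 1) h := by
  induction n with
  | zero => rfl
  | succ n ih =>
    rw [clm_pow_succ_apply, ih]
    exact dilation_single_succ hD n h

variable {c : ℕ → ℂ} {M : ℝ}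

/-- Vectors in slot 1 are pushed along the slots, hence wandering; those in later slots are their
images. -/
lemma IsBoundedSeries.single_mem_convergenceSpace (hc : IsBoundedSeries c M)
    (hD : ∀ u v, ⟪D u, D v⟫_ℂ = ⟪u, v⟫_ℂ - ⟪T u, T v⟫_ℂ) (n : ℕ) (h : E) :
    lp.single 2 (n + 1) h ∈ convergenceSpace c (dilation hD).toContinuousLinearMap := by
  have hV : ∀ x, ‖(dilation hD).toContinuousLinearMap x‖ = ‖x‖ := (dilation hD).norm_map
  induction n with
  | zero =>
    refine hc.mem_convergenceSpace_of_wandering hV fun n => ?_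
    rw [dilation_pow_single, lp.inner_single_left, lp.single_apply_ne _ _ _ (by omega),
      inner_zero_right]
  | succ n ih =>
    rw [← dilation_single_succ hD]
    exact (hc.map_mem_convergenceSpace_iff hV).mpr ih

/-- All slots other than 0 consist of vectors of convergence, so the complement lives in slot 0, the
copy of E. -/
lemma IsBoundedSeries.eq_single_of_mem_orthogonal (hc : IsBoundedSeries c M)
    (hD : ∀ u v, ⟪D u, D v⟫_ℂ = ⟪u, v⟫_ℂ - ⟪T u, T v⟫_ℂ) {x : L2Seq E}
    (hx : x ∈ (convergenceSpace c (dilation hD).toContinuousLinearMap)ᗮ) (n : ℕ) :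
    x (n + 1) = 0 := by
  have h := (Submodule.mem_orthogonal _ _).mp hx _
    (hc.single_mem_convergenceSpace hD n (x (n + 1)))
  rwa [lp.inner_single_left, inner_self_eq_zero] at h

open ContinuousLinearMap (adjoint adjoint_inner_left adjoint_inner_right)

lemma norm_eq_norm_zero_of_succ {x : L2Seq E} (hx : ∀ n, x (n + 1) = 0) : ‖x‖ = ‖x 0‖ := by
  have h : x = lp.single 2 0 (x 0) := by
    ext n
    rcases n with _ | n
    · simp
    · rw [hx, lp.single_apply_ne _ _ _ (Nat.succ_ne_zero n)]
  conv_lhs => rw [h, lp.norm_single (by norm_num)]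

/-- On vectors supported at `0` whose image under the adjoint of the dilation is supported at `0`,
this adjoint acts as the adjoint of `T`. -/
lemma adjoint_dilation_apply_zero (hD : ∀ u v, ⟪D u, D v⟫_ℂ = ⟪u, v⟫_ℂ - ⟪T u, T v⟫_ℂ)
    {x : L2Seq E} (hx : ∀ n, x (n + 1) = 0) :
    (adjoint (dilation hD).toContinuousLinearMap x) 0 = adjoint T (x 0) := by
  refine ext_inner_left ℂ fun u : E => ?_
  have h0 : x = lp.single 2 0 (x 0) := by
    ext n
    rcases n with _ | n
    · simp
    · rw [hx, lp.single_apply_ne _ _ _ (Nat.succ_ne_zero n)]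
  have e1 : ⟪u, (adjoint (dilation hD).toContinuousLinearMap x) 0⟫_ℂ =
      ⟪(lp.single 2 0 u : L2Seq E), adjoint (dilation hD).toContinuousLinearMap x⟫_ℂ :=
    (lp.inner_single_left (𝕜 := ℂ) (G := fun _ : ℕ => E) 0 u
      (adjoint (dilation hD).toContinuousLinearMap x)).symm
  have e2 : ⟪dilation hD (lp.single 2 0 u), (lp.single 2 0 (x 0) : L2Seq E)⟫_ℂ =
      ⟪(dilation hD (lp.single 2 0 u)) 0, x 0⟫_ℂ :=
    lp.inner_single_right (𝕜 := ℂ) (G := fun _ : ℕ => E) 0 (x 0) _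
  have e3 : (dilation hD (lp.single 2 0 u)) 0 = T u := by
    change T ((lp.single 2 0 u : L2Seq E) 0) = T u
    rw [lp.single_apply_self]
  rw [e1, adjoint_inner_right, adjoint_inner_right, ← e3, ← e2, ← h0]
  rfl

/-- **Sz.-Nagy–Foias**: the `H^∞` functional calculus of a completely non unitary contraction
converges strongly. -/
theorem IsBoundedSeries.exists_tendsto_abelSum (hc : IsBoundedSeries c M)
    (hT : IsCNUContraction T) (x : E) :
    ∃ y, Tendsto (fun ρ : ℝ => abelSum c T ρ x) (𝓝[<] 1) (𝓝 y) := by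
  obtain ⟨hT1, hcnu⟩ := hT
  obtain ⟨D, hD⟩ := exists_defect hT1
  set V := (dilation hD).toContinuousLinearMap with hVdef
  have hV : ∀ x, ‖V x‖ = ‖x‖ := (dilation hD).norm_map
  set G := convergenceSpace c V with hG
  have hzero : ∀ k ∈ Gᗮ, ∀ n, k (n + 1) = 0 := fun k hk n => hc.eq_single_of_mem_orthogonal hD hk n
  -- On the complement V and V* are isometric and never leave slot 0, where they act as T and T*.
  -- All ‖T^n k₀‖ and ‖T*^n k₀‖ therefore equal ‖k₀‖, and complete non unitarity gives k₀ = 0.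
  have hbot : Gᗮ = ⊥ := by
    rw [Submodule.eq_bot_iff]
    intro k hk
    have hpow : ∀ n : ℕ, (V ^ n) k ∈ Gᗮ ∧ ((V ^ n) k) 0 = (T ^ n) (k 0) := fun n => by
      induction n with
      | zero => exact ⟨hk, rfl⟩
      | succ n ih =>
        rw [clm_pow_succ_apply, clm_pow_succ_apply]
        refine ⟨hc.map_mem_orthogonal hV ih.1, ?_⟩
        rw [← ih.2]; rfl
    have hpow' : ∀ n : ℕ, (adjoint V ^ n) k ∈ Gᗮ ∧ ((adjoint V ^ n) k) 0 = (adjoint T ^ n) (k 0) ∧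
        ‖(adjoint V ^ n) k‖ = ‖k‖ := fun n => by
      induction n with
      | zero => exact ⟨hk, rfl, rfl⟩
      | succ n ih =>
        rw [clm_pow_succ_apply, clm_pow_succ_apply]
        refine ⟨hc.adjoint_mem_orthogonal hV ih.1, ?_, ?_⟩
        · rw [adjoint_dilation_apply_zero hD (hzero _ ih.1), ih.2.1]
        · rw [hc.norm_adjoint_of_mem_orthogonal hV ih.1, ih.2.2]
    have hk0 : k 0 = 0 := by
      refine hcnu (k 0) fun n => ⟨?_, ?_⟩
      · rw [← (hpow n).2, ← norm_eq_norm_zero_of_succ (hzero _ (hpow n).1),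
          norm_pow_apply_of_isometry hV, norm_eq_norm_zero_of_succ (hzero _ hk)]
      · rw [← (hpow' n).2.1, ← norm_eq_norm_zero_of_succ (hzero _ (hpow' n).1), (hpow' n).2.2,
          norm_eq_norm_zero_of_succ (hzero _ hk)]
    rw [← norm_eq_zero, norm_eq_norm_zero_of_succ (hzero _ hk), hk0, norm_zero]
  have hclosed : IsClosed (G : Set (L2Seq E)) :=
    hc.isClosed_convergenceSpace (norm_le_one_of_isometry hV)
  have htop : G = ⊤ := by
    have := hclosed.completeSpace_coe
    exact (Submodule.orthogonal_eq_bot_iff).mp hbot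
  have hmem : (lp.single 2 0 x : L2Seq E) ∈ G := htop ▸ Submodule.mem_top
  obtain ⟨y, hy⟩ := hmem
  -- `evalZero` intertwines V with T, so convergence at (x, 0, 0, …) descends to convergence at x.
  refine ⟨evalZero E y, (((evalZero E).continuous.tendsto y).comp hy).congr' ?_⟩
  filter_upwards [Ioo_mem_nhdsLT (zero_lt_one' ℝ)] with ρ hρ
  have h := hc.abelSum_intertwine (norm_le_one_of_isometry hV) hT1 (J := evalZero E)
    (evalZero_dilation hD) hρ.1.le hρ.2 (lp.single 2 0 x)
  rw [Function.comp_apply, h, evalZero_apply, lp.single_apply_self]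

lemma IsHInf.tendsto_funcCalc {f : ℂ → ℂ} (hf : IsHInf f) (hT : IsCNUContraction T) (x : E) :
    Tendsto (fun ρ : ℝ => abelSum (taylorCoeff f) T ρ x) (𝓝[<] 1) (𝓝 (funcCalc f T x)) := by
  obtain ⟨M, hM⟩ := hf.exists_isBoundedSeries
  exact tendsto_nhds_limUnder (hM.exists_tendsto_abelSum hT x)

end Dilation

/-! ### Traces of powers -/

section TracePowers

open Polynomial in
/-- The determinant of `p(M)` is the product of `p(λ)` over the eigenvalues `λ` of `M`. -/
lemma det_aeval_eq_prod_roots {n K : Type*} [Fintype n] [DecidableEq n] [Field K] [IsAlgClosed K]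
    (M : Matrix n n K) (p : K[X]) :
    (aeval M p).det = (M.charpoly.roots.map fun a => p.eval a).prod := by
  -- Both sides are multiplicative in p, and p splits, so constants and linear factors suffice.
  set φ : K[X] →* K := Matrix.detMonoidHom.comp
    ((aeval M : K[X] →ₐ[K] Matrix n n K) : K[X] →* Matrix n n K) with hφ
  set ψ : K[X] →* K :=
    { toFun := fun q => (M.charpoly.roots.map fun a => q.eval a).prod
      map_one' := by simp
      map_mul' := fun q q' => by simp [Multiset.prod_map_mul] } with hψ
  have hs : M.charpoly.Splits := IsAlgClosed.splits _
  have hcard : Multiset.card M.charpoly.roots = Fintype.card n := by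
    rw [← hs.natDegree_eq_card_roots, M.charpoly_natDegree_eq_dim]
  have hC : ∀ c : K, φ (C c) = ψ (C c) := fun c => by
    simp [hφ, hψ, Matrix.algebraMap_eq_diagonal, Matrix.det_diagonal, hcard]
  have hX : ∀ c : K, φ (X - C c) = ψ (X - C c) := fun c => by
    have h1 := M.eval_charpoly c
    have h2 : φ (X - C c) = (-1) ^ Fintype.card n * M.charpoly.eval c := by
      rw [h1, ← Matrix.det_neg]
      simp [hφ, Matrix.algebraMap_eq_diagonal, Pi.algebraMap_def]
    have h3 : M.charpoly.eval c = (M.charpoly.roots.map fun a => c - a).prod := by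
      conv_lhs => rw [hs.eq_prod_roots, M.charpoly_monic.leadingCoeff, C_1, one_mul,
        eval_multiset_prod, Multiset.map_map]
      simp
    rw [h2, h3, ← hcard]
    change _ = (M.charpoly.roots.map fun a => (X - C c).eval a).prod
    have : ∀ s : Multiset K, (-1) ^ Multiset.card s * (s.map fun a => c - a).prod =
        (s.map fun a => (X - C c).eval a).prod := fun s => by
      induction s using Multiset.induction_on with
      | empty => simp
      | cons a s ih =>
        rw [Multiset.map_cons, Multiset.map_cons, Multiset.prod_cons, Multiset.prod_cons,
          Multiset.card_cons, ← ih]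
        simp only [eval_sub, eval_X, eval_C]
        ring
    exact this _
  change φ p = ψ p
  have hp : p.Splits := IsAlgClosed.splits _
  rw [hp.eq_prod_roots, map_mul, map_mul, hC, map_multiset_prod, map_multiset_prod,
    Multiset.map_map, Multiset.map_map]
  congr 3
  funext a
  exact hX a

open Polynomial in
-- The determinant formula with p = t - X^k identifies the characteristic polynomial at every t,
-- which keeps track of algebraic multiplicities.
lemma roots_charpoly_pow {n K : Type*} [Fintype n] [DecidableEq n] [Field K] [IsAlgClosed K]
    (M : Matrix n n K) (k : ℕ) :
    (M ^ k).charpoly.roots = M.charpoly.roots.map fun a => a ^ k := by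
  have h : (M ^ k).charpoly = ((M.charpoly.roots.map fun a => a ^ k).map fun a => X - C a).prod := by
    have : Infinite K := IsAlgClosed.instInfinite
    refine Polynomial.funext fun t => ?_
    have h1 := det_aeval_eq_prod_roots M (C t - X ^ k)
    rw [Matrix.eval_charpoly, eval_multiset_prod, Multiset.map_map, Multiset.map_map]
    simpa [Matrix.algebraMap_eq_diagonal, Pi.algebraMap_def] using h1
  rw [h, roots_multiset_prod_X_sub_C]

lemma trace_pow_eq_sum_roots {V : Type*} [AddCommGroup V] [Module ℂ V] [FiniteDimensional ℂ V]
    (A : V →ₗ[ℂ] V) (k : ℕ) :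
    LinearMap.trace ℂ V (A ^ k) = (A.charpoly.roots.map fun a => a ^ k).sum := by
  set b := Module.Free.chooseBasis ℂ V
  rw [LinearMap.trace_eq_matrix_trace ℂ b, Matrix.trace_eq_sum_roots_charpoly,
    ← LinearMap.toMatrix_pow, roots_charpoly_pow, LinearMap.charpoly_toMatrix]

end TracePowers

/-! ### The trace norm -/

section TraceNorm

variable {d : ℕ}

lemma orthonormal_basisVec : Orthonormal ℂ (basisVec : Lattice d → L2 d) := by
  classical
  refine ⟨fun j => ?_, fun i j hij => ?_⟩
  · rw [basisVec, lp.norm_single (by norm_num), norm_one]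
  · simp only [basisVec]
    rw [lp.inner_single_left, lp.single_apply_ne _ _ _ hij, inner_zero_right]

lemma norm_basisVec (j : Lattice d) : ‖(basisVec j : L2 d)‖ = 1 := orthonormal_basisVec.1 j

lemma inner_basisVec_left (j : Lattice d) (x : L2 d) : ⟪basisVec j, x⟫_ℂ = x j := by
  rw [basisVec, lp.inner_single_left]
  simp

lemma hasSum_norm_inner_sq (x : L2 d) :
    HasSum (fun k : Lattice d => ‖⟪basisVec k, x⟫_ℂ‖ ^ 2) (‖x‖ ^ 2) := by
  have h2 : (0 : ℝ) < (2 : ℝ≥0∞).toReal := by norm_num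
  have h := lp.hasSum_norm h2 x
  simpa [inner_basisVec_left] using h

open ContinuousLinearMap (adjoint adjoint_inner_left adjoint_inner_right)

section Polar

variable {E : Type*} [NormedAddCommGroup E] [InnerProductSpace ℂ E] [CompleteSpace E]

open ContinuousLinearMap (adjoint adjoint_inner_left adjoint_inner_right)

lemma norm_operatorAbs_apply (G : E →L[ℂ] E) (x : E) : ‖operatorAbs G x‖ = ‖G x‖ := by
  have h : ⟪operatorAbs G x, operatorAbs G x⟫_ℂ = ⟪G x, G x⟫_ℂ := by
    have hs : IsSelfAdjoint (operatorAbs G) := (CFC.abs_nonneg G).isSelfAdjoint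
    rw [← adjoint_inner_right, ← adjoint_inner_right, ← ContinuousLinearMap.star_eq_adjoint,
      hs.star_eq, ← ContinuousLinearMap.star_eq_adjoint, ← clm_mul_apply, ← clm_mul_apply,
      operatorAbs, CFC.abs_mul_abs]
  simp only [inner_self_eq_norm_sq_to_K, coe_algebraMap] at h
  have h' : ‖operatorAbs G x‖ ^ 2 = ‖G x‖ ^ 2 := by exact_mod_cast h
  exact (sq_eq_sq₀ (norm_nonneg _) (norm_nonneg _)).mp h'

/-- A symmetric square root of `|G|`. -/
lemma exists_sqrt_operatorAbs (G : E →L[ℂ] E) :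
    ∃ R : E →L[ℂ] E, (∀ x y, ⟪R x, y⟫_ℂ = ⟪x, R y⟫_ℂ) ∧ ∀ x, operatorAbs G x = R (R x) := by
  have hsa : IsSelfAdjoint (CFC.sqrt (operatorAbs G)) := (CFC.sqrt_nonneg _).isSelfAdjoint
  refine ⟨CFC.sqrt (operatorAbs G), fun x y => ?_, fun x => ?_⟩
  · rw [← adjoint_inner_right, ← ContinuousLinearMap.star_eq_adjoint, hsa.star_eq]
  · have h0 : 0 ≤ operatorAbs G := CFC.abs_nonneg G
    rw [← clm_mul_apply, CFC.sqrt_mul_sqrt_self _ h0]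

/-- An approximate polar decomposition. -/
lemma exists_approx_polar (G : E →L[ℂ] E) {ε : ℝ} (hε : 0 < ε) :
    ∃ U : E →L[ℂ] E, ‖U‖ ≤ 1 ∧ ‖G - U * operatorAbs G‖ ≤ ε := by
  set S := operatorAbs G with hS
  have hS0 : 0 ≤ S := CFC.abs_nonneg G
  -- U = G (|G| + ε)⁻¹ stands in for the polar partial isometry. It is a contraction because ‖G w‖ =
  -- ‖|G| w‖ ≤ ‖(|G| + ε) w‖, and G - U |G| = ε U.
  have hpos : IsStrictlyPositive (S + algebraMap ℝ (E →L[ℂ] E) ε) :=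
    IsStrictlyPositive.nonneg_add hS0 (isStrictlyPositive_algebraMap hε)
  obtain ⟨u, hu⟩ := hpos.isUnit
  set Q : E →L[ℂ] E := ((u⁻¹ : (E →L[ℂ] E)ˣ) : E →L[ℂ] E) with hQ
  have hQ1 : (S + algebraMap ℝ (E →L[ℂ] E) ε) * Q = 1 := by rw [← hu, hQ, Units.mul_inv]
  have hQ2 : Q * (S + algebraMap ℝ (E →L[ℂ] E) ε) = 1 := by rw [← hu, hQ, Units.inv_mul]
  have halg : ∀ w : E, (algebraMap ℝ (E →L[ℂ] E) ε) w = (ε : ℂ) • w := fun w => by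
    rw [Algebra.algebraMap_eq_smul_one, Complex.coe_smul]; rfl
  have hle : ∀ w : E, ‖S w‖ ≤ ‖(S + algebraMap ℝ (E →L[ℂ] E) ε) w‖ := fun w => by
    have hp : 0 ≤ (⟪S w, w⟫_ℂ).re :=
      ((ContinuousLinearMap.isPositive_iff_complex S).mp
        ((ContinuousLinearMap.nonneg_iff_isPositive S).mp hS0) w).2
    rw [add_apply, halg]
    refine le_of_sq_le_sq ?_ (norm_nonneg _)
    rw [@norm_add_sq ℂ]
    have : RCLike.re ⟪S w, (ε : ℂ) • w⟫_ℂ = ε * (⟪S w, w⟫_ℂ).re := by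
      rw [inner_smul_right]; simp
    rw [this]
    nlinarith [sq_nonneg ‖(ε : ℂ) • w‖, mul_nonneg hε.le hp]
  have hU : ‖G * Q‖ ≤ 1 := ContinuousLinearMap.opNorm_le_bound _ zero_le_one fun v => by
    rw [clm_mul_apply, ← norm_operatorAbs_apply, one_mul]
    refine (hle (Q v)).trans_eq ?_
    rw [← clm_mul_apply, hQ1]; rfl
  refine ⟨G * Q, hU, ?_⟩
  have e : G - G * Q * S = G * Q * algebraMap ℝ (E →L[ℂ] E) ε := by
    have h1 : G * Q * (S + algebraMap ℝ (E →L[ℂ] E) ε) = G := by rw [mul_assoc, hQ2, mul_one]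
    rw [mul_add] at h1
    exact sub_eq_of_eq_add' h1.symm
  rw [e]
  refine ContinuousLinearMap.opNorm_le_bound _ hε.le fun v => ?_
  rw [clm_mul_apply, halg]
  refine ((G * Q).le_of_opNorm_le hU _).trans_eq ?_
  rw [one_mul, norm_smul, norm_real, Real.norm_of_nonneg hε.le]

end Polar

open ContinuousLinearMap (adjoint adjoint_inner_left adjoint_inner_right)

/-- The Hilbert–Schmidt norm of `R B` is at most that of `R`, for `R` symmetric and `B` a
contraction. -/
lemma sum_norm_sq_le_of_symmetric {R B : L2 d →L[ℂ] L2 d} (hR : ∀ x y, ⟪R x, y⟫_ℂ = ⟪x, R y⟫_ℂ)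
    (hB : ‖B‖ ≤ 1) {t : ℝ} (ht : HasSum (fun k : Lattice d => ‖R (basisVec k)‖ ^ 2) t)
    (Λ : Finset (Lattice d)) : ∑ j ∈ Λ, ‖R (B (basisVec j))‖ ^ 2 ≤ t := by
  -- Expand in matrix elements, move R and B to the other argument, and apply Bessel's inequality
  -- for each k.
  have h1 : HasSum (fun k => ∑ j ∈ Λ, ‖⟪basisVec k, R (B (basisVec j))⟫_ℂ‖ ^ 2)
      (∑ j ∈ Λ, ‖R (B (basisVec j))‖ ^ 2) :=
    hasSum_sum fun j _ => hasSum_norm_inner_sq _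
  refine hasSum_le (fun k => ?_) h1 ht
  have h2 : ∀ j, ‖⟪(basisVec k : L2 d), R (B (basisVec j))⟫_ℂ‖ =
      ‖⟪(basisVec j : L2 d), adjoint B (R (basisVec k))⟫_ℂ‖ := fun j => by
    rw [adjoint_inner_right, ← hR, norm_inner_symm]
  simp only [h2]
  have h3 := orthonormal_basisVec.sum_inner_products_le (adjoint B (R (basisVec k))) (s := Λ)
  refine h3.trans (pow_le_pow_left₀ (norm_nonneg _) ?_ 2)
  have hB' : ‖adjoint B‖ ≤ 1 := by rwa [LinearIsometryEquiv.norm_map]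
  exact ((adjoint B).le_of_opNorm_le hB' (R (basisVec k))).trans_eq (one_mul _)

/-- Partial traces of `C G B`, for contractions `C` and `B`, are bounded by the trace norm of `G`. -/
lemma enorm_sum_inner_le_traceNorm {C G B : L2 d →L[ℂ] L2 d} (hC : ‖C‖ ≤ 1) (hB : ‖B‖ ≤ 1)
    (Λ : Finset (Lattice d)) :
    ‖∑ j ∈ Λ, ⟪(basisVec j : L2 d), C (G (B (basisVec j)))⟫_ℂ‖ₑ ≤ traceNorm G := by
  by_cases htop : traceNorm G = ∞
  · rw [htop]; exact le_top
  obtain ⟨R, hR, hRR⟩ := exists_sqrt_operatorAbs G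
  have hterm : ∀ k : Lattice d, (⟪(basisVec k : L2 d), operatorAbs G (basisVec k)⟫_ℂ).re =
      ‖R (basisVec k)‖ ^ 2 := fun k => by
    rw [hRR, ← hR, inner_self_eq_norm_sq_to_K]
    norm_cast
  simp only [traceNorm, hterm] at htop ⊢
  have hsum : Summable fun k : Lattice d => ‖R (basisVec k)‖ ^ 2 := by
    have h := ENNReal.summable_toReal htop
    simpa [ENNReal.toReal_ofReal] using h
  rw [← ENNReal.ofReal_tsum_of_nonneg (fun _ => by positivity) hsum, ← ofReal_norm]
  refine ENNReal.ofReal_le_ofReal ?_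
  set t := ∑' k : Lattice d, ‖R (basisVec k)‖ ^ 2 with ht
  have hCs : ‖adjoint C‖ ≤ 1 := by rwa [LinearIsometryEquiv.norm_map]
  -- Since G is U R² up to ε, each term is ⟪R U* C* φ_j, R B φ_j⟫ up to ε, and both Hilbert–Schmidt
  -- sums are at most t = tr |G|.
  have key : ∀ ε : ℝ, 0 < ε →
      ‖∑ j ∈ Λ, ⟪(basisVec j : L2 d), C (G (B (basisVec j)))⟫_ℂ‖ ≤ t + Λ.card * ε := by
    intro ε hε
    obtain ⟨U, hU, hGU⟩ := exists_approx_polar G hε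
    have hUC : ‖adjoint U * adjoint C‖ ≤ 1 := by
      refine (norm_mul_le _ _).trans ?_
      rw [LinearIsometryEquiv.norm_map, LinearIsometryEquiv.norm_map]
      exact mul_le_one₀ hU (norm_nonneg _) hC
    have h1 := sum_norm_sq_le_of_symmetric hR hB hsum.hasSum Λ
    have h2 := sum_norm_sq_le_of_symmetric hR hUC hsum.hasSum Λ
    have h3 : ∀ j ∈ Λ, ‖⟪(basisVec j : L2 d), C (G (B (basisVec j)))⟫_ℂ‖ ≤
        (‖R ((adjoint U * adjoint C) (basisVec j))‖ ^ 2 + ‖R (B (basisVec j))‖ ^ 2) / 2 + ε := by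
      intro j _
      have hBj : ‖B (basisVec j)‖ ≤ 1 := by
        have := B.le_of_opNorm_le hB (basisVec j)
        rwa [norm_basisVec, mul_one] at this
      have e : ⟪(basisVec j : L2 d), C (G (B (basisVec j)))⟫_ℂ =
          ⟪R ((adjoint U * adjoint C) (basisVec j)), R (B (basisVec j))⟫_ℂ +
          ⟪adjoint C (basisVec j), (G - U * operatorAbs G) (B (basisVec j))⟫_ℂ := by
        rw [hR, ← hRR, clm_mul_apply, adjoint_inner_left, sub_apply, clm_mul_apply, inner_sub_right,
          add_sub_cancel, adjoint_inner_left]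
      rw [e]
      refine (norm_add_le _ _).trans (add_le_add ?_ ?_)
      · refine (norm_inner_le_norm _ _).trans ?_
        nlinarith [sq_nonneg (‖R ((adjoint U * adjoint C) (basisVec j))‖ - ‖R (B (basisVec j))‖)]
      · refine (norm_inner_le_norm _ _).trans ?_
        have h4 := (adjoint C).le_of_opNorm_le hCs (basisVec j)
        rw [norm_basisVec, mul_one] at h4
        have h5 := (G - U * operatorAbs G).le_of_opNorm_le hGU (B (basisVec j))
        have h6 : ε * ‖B (basisVec j)‖ ≤ ε := mul_le_of_le_one_right hε.le hBj
        calc _ ≤ 1 * ε := mul_le_mul h4 (h5.trans h6) (norm_nonneg _) zero_le_one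
          _ = ε := one_mul ε
    calc _ ≤ ∑ j ∈ Λ, ‖⟪(basisVec j : L2 d), C (G (B (basisVec j)))⟫_ℂ‖ := norm_sum_le _ _
      _ ≤ ∑ j ∈ Λ, ((‖R ((adjoint U * adjoint C) (basisVec j))‖ ^ 2 +
          ‖R (B (basisVec j))‖ ^ 2) / 2 + ε) := Finset.sum_le_sum h3
      _ ≤ t + Λ.card * ε := by
        rw [Finset.sum_add_distrib, ← Finset.sum_div, Finset.sum_add_distrib, Finset.sum_const,
          nsmul_eq_mul]
        linarith
  have hlim : Tendsto (fun ε : ℝ => t + Λ.card * ε) (𝓝[>] 0) (𝓝 (t + Λ.card * 0)) :=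
    (Continuous.tendsto (by fun_prop) 0).mono_left nhdsWithin_le_nhds
  rw [mul_zero, add_zero] at hlim
  exact ge_of_tendsto hlim (by filter_upwards [self_mem_nhdsWithin] with ε hε using key ε hε)

end TraceNorm

/-! ### Finite volume comparison -/

section FiniteVolume

variable {d : ℕ} {Λ : Finset (Lattice d)}

lemma basisVec_mem_boxSpace {j : Lattice d} (hj : j ∈ Λ) : basisVec j ∈ boxSpace Λ :=
  Submodule.subset_span ⟨j, hj, rfl⟩

/-- The canonical orthonormal basis of `H_Λ`. -/
lemma exists_orthonormalBasis_boxSpace (Λ : Finset (Lattice d)) :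
    ∃ b : OrthonormalBasis Λ ℂ (boxSpace Λ), ∀ j : Λ, (b j : L2 d) = basisVec (j : Lattice d) := by
  have ho : Orthonormal ℂ fun j : Λ =>
      (⟨basisVec (j : Lattice d), basisVec_mem_boxSpace j.2⟩ : boxSpace Λ) := by
    have h := orthonormal_basisVec.comp (fun j : Λ => (j : Lattice d)) Subtype.val_injective
    refine ⟨fun j => h.1 j, fun i j hij => h.2 hij⟩
  refine ⟨OrthonormalBasis.mk ho ?_, fun j => by rw [OrthonormalBasis.coe_mk]⟩
  rintro ⟨x, hx⟩ -
  induction hx using Submodule.span_induction with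
  | mem x hx =>
    obtain ⟨j, hj, rfl⟩ := hx
    exact Submodule.subset_span ⟨⟨j, hj⟩, rfl⟩
  | zero => exact zero_mem _
  | add x y hx hy h1 h2 => exact add_mem h1 h2
  | smul a x hx h => exact Submodule.smul_mem _ a h

lemma finrank_boxSpace (Λ : Finset (Lattice d)) : Module.finrank ℂ (boxSpace Λ) = Λ.card := by
  obtain ⟨b, -⟩ := exists_orthonormalBasis_boxSpace Λ
  rw [Module.finrank_eq_card_basis b.toBasis, Fintype.card_coe]

/-- The extension by zero of an operator on a closed subspace. -/
def extendByZero {E : Type*} [NormedAddCommGroup E] [InnerProductSpace ℂ E]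
    (K : Submodule ℂ E) [K.HasOrthogonalProjection] (A : K →L[ℂ] K) : E →L[ℂ] E :=
  K.subtypeL ∘L A ∘L K.orthogonalProjectionOnto

section Extend

variable {E : Type*} [NormedAddCommGroup E] [InnerProductSpace ℂ E]
  {K : Submodule ℂ E} [K.HasOrthogonalProjection] {A : K →L[ℂ] K}

lemma norm_extendByZero_le (hA : ‖A‖ ≤ 1) : ‖extendByZero K A‖ ≤ 1 := by
  refine ContinuousLinearMap.opNorm_le_bound _ zero_le_one fun x => ?_
  change ‖((A (K.orthogonalProjectionOnto x) : K) : E)‖ ≤ _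
  rw [Submodule.norm_coe]
  refine (A.le_of_opNorm_le hA _).trans ?_
  gcongr
  exact (K.orthogonalProjectionOnto.le_of_opNorm_le K.orthogonalProjectionOnto_norm_le x).trans_eq
    (one_mul _)

lemma extendByZero_starProjection (x : E) :
    extendByZero K A (K.starProjection x) = extendByZero K A x := by
  change ((A (K.orthogonalProjectionOnto (K.orthogonalProjectionOnto x : E)) : K) : E) = _
  rw [Submodule.orthogonalProjectionOnto_mem_subspace_eq_self]
  rfl

/-- The summand on Kᗮ is invisible after projecting to K, so a factor of the direct sum turns into a
factor of A. -/
lemma extendByZero_pow_succ_apply (m : ℕ) (A' : Kᗮ →L[ℂ] Kᗮ) (x : E) :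
    extendByZero K (A ^ m) (directSum K A A' x) = extendByZero K (A ^ (m + 1)) x := by
  have h : K.orthogonalProjectionOnto (directSum K A A' x) = A (K.orthogonalProjectionOnto x) := by
    change K.orthogonalProjectionOnto (((A (K.orthogonalProjectionOnto x) : K) : E) +
      ((A' (Kᗮ.orthogonalProjectionOnto x) : Kᗮ) : E)) = _
    rw [map_add, Submodule.orthogonalProjectionOnto_mem_subspace_eq_self,
      Submodule.orthogonalProjectionOnto_apply_of_mem_orthogonal (Subtype.prop _),
      add_zero]
  change (((A ^ m) (K.orthogonalProjectionOnto (directSum K A A' x)) : K) : E) =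
    (((A ^ (m + 1)) (K.orthogonalProjectionOnto x) : K) : E)
  rw [h, pow_succ]
  rfl

end Extend

lemma sum_inner_extendByZero (A : boxSpace Λ →L[ℂ] boxSpace Λ) :
    ∑ j ∈ Λ, ⟪(basisVec j : L2 d), extendByZero (boxSpace Λ) A (basisVec j)⟫_ℂ =
      LinearMap.trace ℂ (boxSpace Λ) A := by
  obtain ⟨b, hb⟩ := exists_orthonormalBasis_boxSpace Λ
  rw [LinearMap.trace_eq_sum_inner _ b, ← Finset.sum_coe_sort]
  refine Finset.sum_congr rfl fun j _ => ?_
  rw [← hb]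
  change ⟪((b j : boxSpace Λ) : L2 d), ((A ((boxSpace Λ).orthogonalProjectionOnto (b j : L2 d)) :
    boxSpace Λ) : L2 d)⟫_ℂ = _
  rw [Submodule.orthogonalProjectionOnto_mem_subspace_eq_self]
  rfl

variable {T : L2 d →L[ℂ] L2 d} {A : boxSpace Λ →L[ℂ] boxSpace Λ}

/-- Telescoping: factors T are traded for A one by one, i counting those already traded. Each
exchange leaves the partial trace of A^i G T^m, which is at most ‖G‖₁ because the outer factors are
contractions. -/
lemma enorm_sum_inner_sub_le (hT : ‖T‖ ≤ 1) (hA : ‖A‖ ≤ 1)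
    (A' : (boxSpace Λ)ᗮ →L[ℂ] (boxSpace Λ)ᗮ) (i m : ℕ) :
    ‖∑ j ∈ Λ, ⟪(basisVec j : L2 d), extendByZero (boxSpace Λ) (A ^ i) ((T ^ m) (basisVec j))⟫_ℂ -
      ∑ j ∈ Λ, ⟪(basisVec j : L2 d), extendByZero (boxSpace Λ) (A ^ (i + m)) (basisVec j)⟫_ℂ‖ₑ ≤
      m * traceNorm ((boxSpace Λ).starProjection ∘L (T - directSum (boxSpace Λ) A A')) := by
  set G := (boxSpace Λ).starProjection ∘L (T - directSum (boxSpace Λ) A A') with hG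
  induction m generalizing i with
  | zero => simp
  | succ m ih =>
    have hstep : ∀ x : L2 d, extendByZero (boxSpace Λ) (A ^ i) (T x) =
        extendByZero (boxSpace Λ) (A ^ (i + 1)) x + extendByZero (boxSpace Λ) (A ^ i) (G x) := by
      intro x
      have h1 : G x = (boxSpace Λ).starProjection (T x - directSum (boxSpace Λ) A A' x) := rfl
      rw [h1, extendByZero_starProjection, map_sub, extendByZero_pow_succ_apply]
      abel
    have e : ∑ j ∈ Λ, ⟪(basisVec j : L2 d),
          extendByZero (boxSpace Λ) (A ^ i) ((T ^ (m + 1)) (basisVec j))⟫_ℂ -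
        ∑ j ∈ Λ, ⟪(basisVec j : L2 d),
          extendByZero (boxSpace Λ) (A ^ (i + (m + 1))) (basisVec j)⟫_ℂ =
        (∑ j ∈ Λ, ⟪(basisVec j : L2 d),
          extendByZero (boxSpace Λ) (A ^ (i + 1)) ((T ^ m) (basisVec j))⟫_ℂ -
        ∑ j ∈ Λ, ⟪(basisVec j : L2 d),
          extendByZero (boxSpace Λ) (A ^ (i + 1 + m)) (basisVec j)⟫_ℂ) +
        ∑ j ∈ Λ, ⟪(basisVec j : L2 d),
          extendByZero (boxSpace Λ) (A ^ i) (G ((T ^ m) (basisVec j)))⟫_ℂ := by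
      simp only [clm_pow_succ_apply, hstep, inner_add_right, Finset.sum_add_distrib,
        show i + (m + 1) = i + 1 + m by ring]
      ring
    rw [e]
    refine (enorm_add_le _ _).trans ?_
    refine (add_le_add (ih (i + 1)) (enorm_sum_inner_le_traceNorm
      (norm_extendByZero_le (norm_pow_le_one hA i)) (norm_pow_le_one hT m) Λ)).trans_eq ?_
    push_cast
    ring

/-- The local trace of `T ^ k` differs from the trace of `A ^ k` by at most `k ‖P F‖₁`. -/
lemma enorm_sum_inner_pow_sub_trace_le (hT : ‖T‖ ≤ 1) (hA : ‖A‖ ≤ 1)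
    (A' : (boxSpace Λ)ᗮ →L[ℂ] (boxSpace Λ)ᗮ) (k : ℕ) :
    ‖∑ j ∈ Λ, ⟪(basisVec j : L2 d), (T ^ k) (basisVec j)⟫_ℂ -
      ((A : boxSpace Λ →ₗ[ℂ] boxSpace Λ).charpoly.roots.map fun a => a ^ k).sum‖ₑ ≤
      k * traceNorm ((boxSpace Λ).starProjection ∘L (T - directSum (boxSpace Λ) A A')) := by
  have h := enorm_sum_inner_sub_le hT hA A' 0 k
  rw [sum_inner_extendByZero, zero_add] at h
  have hp : (((A ^ k : boxSpace Λ →L[ℂ] boxSpace Λ)) : boxSpace Λ →ₗ[ℂ] boxSpace Λ) =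
      (A : boxSpace Λ →ₗ[ℂ] boxSpace Λ) ^ k := by
    exact ContinuousLinearMap.toLinearMap_pow A k
  rw [hp, trace_pow_eq_sum_roots] at h
  -- For i = 0 the extended operator is the projection onto H_Λ, which fixes the left vectors φ_j.
  have e : ∑ j ∈ Λ, ⟪(basisVec j : L2 d),
      extendByZero (boxSpace Λ) (A ^ 0) ((T ^ k) (basisVec j))⟫_ℂ =
      ∑ j ∈ Λ, ⟪(basisVec j : L2 d), (T ^ k) (basisVec j)⟫_ℂ := by
    refine Finset.sum_congr rfl fun j hj => ?_
    have h2 : extendByZero (boxSpace Λ) (A ^ 0) ((T ^ k) (basisVec j)) =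
      (boxSpace Λ).starProjection ((T ^ k) (basisVec j)) := rfl
    rw [h2, ← Submodule.inner_starProjection_left_eq_right,
      Submodule.starProjection_eq_self_iff.mpr (basisVec_mem_boxSpace hj)]
  rwa [e] at h

/-! ### Eigenvalue counting measures -/

lemma exists_eigenvector_of_mem_roots_charpoly {a : ℂ}
    (ha : a ∈ (A : boxSpace Λ →ₗ[ℂ] boxSpace Λ).charpoly.roots) :
    ∃ v : boxSpace Λ, v ≠ 0 ∧ A v = a • v := by
  have h1 : Module.End.HasEigenvalue (A : boxSpace Λ →ₗ[ℂ] boxSpace Λ) a :=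
    (Module.End.hasEigenvalue_iff_isRoot_charpoly _ _).mpr (Polynomial.isRoot_of_mem_roots ha)
  obtain ⟨v, hv⟩ := h1.exists_hasEigenvector
  exact ⟨v, hv.2, hv.apply_eq_smul⟩

lemma mem_spectrum_of_mem_roots_charpoly {a : ℂ}
    (ha : a ∈ (A : boxSpace Λ →ₗ[ℂ] boxSpace Λ).charpoly.roots) : a ∈ spectrum ℂ A := by
  obtain ⟨v, hv0, hv⟩ := exists_eigenvector_of_mem_roots_charpoly ha
  rw [spectrum.mem_iff]
  rintro ⟨u, hu⟩
  have h2 : (u : boxSpace Λ →L[ℂ] boxSpace Λ) v = 0 := by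
    rw [hu, sub_apply, Algebra.algebraMap_eq_smul_one, hv]
    exact sub_self _
  have h3 : ((u⁻¹ : (boxSpace Λ →L[ℂ] boxSpace Λ)ˣ) : boxSpace Λ →L[ℂ] boxSpace Λ)
      ((u : boxSpace Λ →L[ℂ] boxSpace Λ) v) = v := by
    rw [← clm_mul_apply, Units.inv_mul]; rfl
  rw [h2, map_zero] at h3
  exact hv0 h3.symm

lemma norm_le_one_of_mem_roots_charpoly (hA : ‖A‖ ≤ 1) {a : ℂ}
    (ha : a ∈ (A : boxSpace Λ →ₗ[ℂ] boxSpace Λ).charpoly.roots) : ‖a‖ ≤ 1 := by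
  obtain ⟨v, hv0, hv⟩ := exists_eigenvector_of_mem_roots_charpoly ha
  have h := A.le_of_opNorm_le hA v
  rw [hv, norm_smul] at h
  exact le_of_mul_le_mul_right h (norm_pos_iff.mpr hv0)

lemma norm_le_of_spectralRadius_le {r : ℝ} (hr : 0 ≤ r) (hA : spectralRadius ℂ A ≤ ENNReal.ofReal r)
    {a : ℂ} (ha : a ∈ (A : boxSpace Λ →ₗ[ℂ] boxSpace Λ).charpoly.roots) : ‖a‖ ≤ r := by
  have h1 : (‖a‖₊ : ℝ≥0∞) ≤ spectralRadius ℂ A :=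
    le_iSup₂ (f := fun k (_ : k ∈ spectrum ℂ A) => (‖k‖₊ : ℝ≥0∞)) a
      (mem_spectrum_of_mem_roots_charpoly ha)
  have h2 := h1.trans hA
  rwa [← enorm_eq_nnnorm, ← ofReal_norm, ENNReal.ofReal_le_ofReal_iff hr] at h2

/-- All atoms lie in the closed disc, so restricting to it, as the `comap` in `countingMeasure`
does, loses none of them. -/
lemma integral_sum_dirac (s : Multiset ℂ) (hs : ∀ a ∈ s, ‖a‖ ≤ 1) (g : ℂ → ℂ) :
    Integrable g ((s.map (Measure.dirac : ℂ → Measure ℂ)).sum.restrict (closedBall 0 1)) ∧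
    ∫ z in closedBall 0 1, g z ∂(s.map (Measure.dirac : ℂ → Measure ℂ)).sum = (s.map g).sum := by
  classical
  induction s using Multiset.induction_on with
  | empty => simp
  | cons a s ih =>
    obtain ⟨ih1, ih2⟩ := ih fun b hb => hs b (Multiset.mem_cons_of_mem hb)
    have ha : a ∈ closedBall (0 : ℂ) 1 := by simpa using hs a (Multiset.mem_cons_self a s)
    rw [Multiset.map_cons, Multiset.map_cons, Multiset.sum_cons, Multiset.sum_cons,
      Measure.restrict_add, restrict_dirac' measurableSet_closedBall, if_pos ha]
    have hi : Integrable g (Measure.dirac a) := integrable_dirac (by simp)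
    exact ⟨hi.add_measure ih1, by rw [integral_add_measure hi ih1, integral_dirac, ih2]⟩

lemma integral_countingMeasure (hA : ‖A‖ ≤ 1) (g : ℂ → ℂ) :
    ∫ w : ClosedDisc, g w ∂(countingMeasure A) = (Λ.card : ℂ)⁻¹ *
      ((A : boxSpace Λ →ₗ[ℂ] boxSpace Λ).charpoly.roots.map g).sum := by
  have he : MeasurableEmbedding (Subtype.val : ClosedDisc → ℂ) :=
    MeasurableEmbedding.subtype_coe measurableSet_closedBall
  rw [countingMeasure, ← he.integral_map, he.map_comap, Subtype.range_coe, Measure.restrict_smul,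
    integral_smul_measure,
    (integral_sum_dirac _ (fun a ha => norm_le_one_of_mem_roots_charpoly hA ha) g).2]
  simp [ENNReal.toReal_inv]

/-- Over ℂ the characteristic polynomial splits, so the roots with multiplicity number dim H_Λ =
|Λ|. -/
lemma integral_countingMeasure_one (hA : ‖A‖ ≤ 1) (hΛ : Λ.Nonempty) :
    ∫ _ : ClosedDisc, (1 : ℂ) ∂(countingMeasure A) = 1 := by
  rw [integral_countingMeasure hA fun _ => (1 : ℂ)]
  have h : Multiset.card (A : boxSpace Λ →ₗ[ℂ] boxSpace Λ).charpoly.roots = Λ.card := by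
    rw [← (IsAlgClosed.splits _).natDegree_eq_card_roots, LinearMap.charpoly_natDegree,
      finrank_boxSpace]
  rw [Multiset.map_const', Multiset.sum_replicate, h, nsmul_eq_mul, mul_one]
  exact inv_mul_cancel₀ (by exact_mod_cast hΛ.card_pos.ne')

end FiniteVolume

/-! ### The periodic lattice -/

section LatticeBoxes

variable {d : ℕ} {γ : Fin d → Lattice d}

/-- Independence over ℤ makes the integer determinant nonzero, and this persists over ℝ. -/
lemma eq_zero_of_sum_mul_eq_zero (hγ : LinearIndependent ℤ γ) {x : Fin d → ℝ}
    (hx : ∀ l, ∑ i, x i * (γ i l : ℝ) = 0) : x = 0 := by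
  have hdet : (Matrix.of γ).det ≠ 0 := by
    intro h0
    obtain ⟨v, hv0, hv⟩ := Matrix.exists_vecMul_eq_zero_iff.mpr h0
    refine hv0 (funext fun i => Fintype.linearIndependent_iff.mp hγ v ?_ i)
    rw [← hv, Matrix.vecMul_eq_sum]
    rfl
  have hdet' : ((Matrix.of γ).map (Int.castRingHom ℝ)).det ≠ 0 := by
    rw [← RingHom.mapMatrix_apply, ← RingHom.map_det]
    simpa using hdet
  refine Matrix.eq_zero_of_vecMul_eq_zero hdet' ?_
  funext l
  simpa [Matrix.vecMul, dotProduct] using hx l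

lemma mem_cell {k : Lattice d} : k ∈ cell γ ↔ ∃ x : Fin d → ℝ, (∀ i, 0 ≤ x i ∧ x i < 1) ∧
    ∀ l, (k l : ℝ) = ∑ i, x i * (γ i l : ℝ) := by
  rw [cell, Set.Finite.mem_toFinset, Set.mem_ofPred_eq]

lemma cell_nonempty (γ : Fin d → Lattice d) : (cell γ).Nonempty :=
  ⟨0, mem_cell.mpr ⟨0, fun _ => by simp, fun _ => by simp⟩⟩

/-- Cell coordinates lie in [0, 1), so two of them differing by an integer agree: distinct
translates of the cell are disjoint. -/
lemma injOn_box (hγ : LinearIndependent ℤ γ) (n : ℕ) :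
    Set.InjOn (fun p : (Fin d → ℤ) × Lattice d => p.2 + ∑ i, p.1 i • γ i)
      (((Fintype.piFinset fun _ : Fin d => Finset.Icc (-(n : ℤ)) n) ×ˢ cell γ :
        Finset ((Fin d → ℤ) × Lattice d)) : Set ((Fin d → ℤ) × Lattice d)) := by
  rintro ⟨p, k⟩ hp ⟨q, k'⟩ hq h
  simp only [Finset.coe_product, Set.mem_prod, Finset.mem_coe, mem_cell] at hp hq
  obtain ⟨-, x, hx, hk⟩ := hp
  obtain ⟨-, y, hy, hk'⟩ := hq
  simp only at h
  have hz : (fun i => x i + p i - (y i + q i)) = 0 := by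
    refine eq_zero_of_sum_mul_eq_zero hγ fun l => ?_
    have hl := congrFun h l
    simp only [Pi.add_apply, Finset.sum_apply, Pi.smul_apply, smul_eq_mul] at hl
    have hl' : (k l : ℝ) + ∑ i, (p i : ℝ) * γ i l = k' l + ∑ i, (q i : ℝ) * γ i l := by
      exact_mod_cast hl
    rw [hk, hk'] at hl'
    simp only [sub_mul, add_mul, Finset.sum_sub_distrib, Finset.sum_add_distrib]
    linarith
  have hpq : p = q := by
    funext i
    have hi := congrFun hz i
    simp only [Pi.zero_apply] at hi
    have h1 : ((p i - q i : ℤ) : ℝ) < 1 := by push_cast; linarith [(hx i).1, (hy i).2]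
    have h2 : (-1 : ℝ) < ((p i - q i : ℤ) : ℝ) := by push_cast; linarith [(hx i).2, (hy i).1]
    have h1' : p i - q i < 1 := by exact_mod_cast h1
    have h2' : -1 < p i - q i := by exact_mod_cast h2
    omega
  subst hpq
  simpa using h

lemma card_box (hγ : LinearIndependent ℤ γ) (n : ℕ) :
    (box γ n).card = (Fintype.piFinset fun _ : Fin d => Finset.Icc (-(n : ℤ)) n).card *
      (cell γ).card := by
  rw [box, Finset.card_image_of_injOn (injOn_box hγ n), Finset.card_product]

lemma sum_box {R : Type*} [AddCommMonoid R] (hγ : LinearIndependent ℤ γ) (n : ℕ)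
    (F : Lattice d → R) : ∑ j ∈ box γ n, F j =
      ∑ p ∈ Fintype.piFinset fun _ : Fin d => Finset.Icc (-(n : ℤ)) n,
        ∑ b ∈ cell γ, F (b + ∑ i, p i • γ i) := by
  rw [box, Finset.sum_image (injOn_box hγ n), Finset.sum_product]

lemma box_nonempty (γ : Fin d → Lattice d) (n : ℕ) : (box γ n).Nonempty := by
  refine Finset.Nonempty.image (Finset.Nonempty.product ⟨0, ?_⟩ (cell_nonempty γ)) _
  simp

end LatticeBoxes

/-! ### Ergodic averages -/

section Ergodic

variable {d : ℕ} {X : Set ℝ} {μ : Measure X} [IsProbabilityMeasure μ]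

instance : IsProbabilityMeasure (prodLaw d μ) := by unfold prodLaw; infer_instance

lemma measurable_shift (g : Lattice d) : Measurable (shift g : Config d X → Config d X) :=
  measurable_pi_lambda _ fun k => measurable_pi_apply (k + g)

lemma map_shift (g : Lattice d) : (prodLaw d μ).map (shift g) = prodLaw d μ := by
  have h := Measure.infinitePi_map_piCongrLeft (fun _ : Lattice d => μ) (Equiv.addRight (-g))
  have e : (MeasurableEquiv.piCongrLeft (fun _ : Lattice d => X) (Equiv.addRight (-g)) :
      Config d X → Config d X) = shift g := by
    funext ω k
    have := Equiv.piCongrLeft_apply_apply (P := fun _ : Lattice d => X) (e := Equiv.addRight (-g))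
      ω (k + g)
    simp only [Equiv.coe_addRight, add_neg_cancel_right] at this
    exact this
  rw [e] at h
  exact h

lemma integral_comp_shift {F : Config d X → ℂ} (hF : Measurable F) (g : Lattice d) :
    ∫ ω, F (shift g ω) ∂(prodLaw d μ) = ∫ ω, F ω ∂(prodLaw d μ) := by
  conv_rhs => rw [← map_shift (μ := μ) g]
  rw [integral_map (measurable_shift g).aemeasurable hF.aestronglyMeasurable]

variable {T : Config d X → (L2 d →L[ℂ] L2 d)}

/-- Inserting the canonical basis between T and T^n writes the matrix element as a pointwise limit,
over finite subsets of the countable lattice, of sums of measurable products. -/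
lemma measurable_inner_pow (hT : ∀ x y : L2 d, Measurable fun ω => ⟪x, T ω y⟫_ℂ) (n : ℕ)
    (x y : L2 d) : Measurable fun ω => ⟪x, (T ω ^ n) y⟫_ℂ := by
  classical
  induction n generalizing x with
  | zero => simp only [pow_zero]; exact measurable_const
  | succ n ih =>
    have h : ∀ ω, HasSum (fun l : Lattice d => ⟪(basisVec l : L2 d), (T ω ^ n) y⟫_ℂ *
        ⟪x, T ω (basisVec l)⟫_ℂ) ⟪x, (T ω ^ (n + 1)) y⟫_ℂ := fun ω => by
      have h1 := lp.hasSum_single (p := 2) (by norm_num) ((T ω ^ n) y)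
      have h2 := (h1.mapL (T ω)).mapL (innerSL ℂ x)
      simp only [innerSL_apply_apply, ← clm_pow_succ_apply] at h2
      convert h2 using 2 with l
      · rfl
      · rw [inner_basisVec_left]
        have : (lp.single 2 l (((T ω ^ n) y) l) : L2 d) = ((T ω ^ n) y) l • basisVec l := by
          rw [basisVec, ← lp.single_smul, smul_eq_mul, mul_one]
        rw [this, map_smul, inner_smul_right]
    refine measurable_of_tendsto_metrizable' (atTop : Filter (Finset (Lattice d)))
      (f := fun s ω => ∑ l ∈ s, ⟪(basisVec l : L2 d), (T ω ^ n) y⟫_ℂ * ⟪x, T ω (basisVec l)⟫_ℂ)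
      (fun s => Finset.measurable_fun_sum s fun l _ => (ih _).mul (hT _ _)) ?_
    exact tendsto_pi_nhds.mpr fun ω => h ω

lemma translation_symm_basisVec (g b : Lattice d) :
    (translation g).symm (basisVec b) = basisVec (b + g) := by
  rw [LinearIsometryEquiv.symm_apply_eq, translation_basisVec, add_sub_cancel_right]

lemma inner_pow_shift {g : Lattice d} {ω : Config d X}
    (h : ∀ x : L2 d, T (shift g ω) x = translation g (T ω ((translation g).symm x))) (n : ℕ)
    (b : Lattice d) : ⟪(basisVec b : L2 d), (T (shift g ω) ^ n) (basisVec b)⟫_ℂ =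
      ⟪(basisVec (b + g) : L2 d), (T ω ^ n) (basisVec (b + g))⟫_ℂ := by
  have hp : ∀ x : L2 d, (T (shift g ω) ^ n) x =
      translation g ((T ω ^ n) ((translation g).symm x)) := fun x => by
    induction n with
    | zero => simp
    | succ n ih =>
      rw [clm_pow_succ_apply, clm_pow_succ_apply, ih, h, LinearIsometryEquiv.symm_apply_apply]
  rw [hp, translation_symm_basisVec, ← translation_symm_basisVec g b,
    ← (translation g).inner_map_map ((translation g).symm (basisVec b)),
    LinearIsometryEquiv.apply_symm_apply]

variable {γ : Fin d → Lattice d}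

/-- The moments `L(z ^ n)` of the density of states functional. -/
def dosMoment (μ : Measure X) (γ : Fin d → Lattice d) (T : Config d X → (L2 d →L[ℂ] L2 d))
    (n : ℕ) : ℂ :=
  ((cell γ).card : ℂ)⁻¹ *
    ∑ b ∈ cell γ, ∫ ω, ⟪(basisVec b : L2 d), (T ω ^ n) (basisVec b)⟫_ℂ ∂(prodLaw d μ)

lemma norm_inner_pow_le {S : L2 d →L[ℂ] L2 d} (hS : ‖S‖ ≤ 1) (n : ℕ) (j : Lattice d) :
    ‖⟪(basisVec j : L2 d), (S ^ n) (basisVec j)⟫_ℂ‖ ≤ 1 := by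
  refine (norm_inner_le_norm _ _).trans ?_
  have := (S ^ n).le_of_opNorm_le (norm_pow_le_one hS n) (basisVec j)
  rw [norm_basisVec, mul_one] at this
  rwa [norm_basisVec, one_mul]

lemma integrable_inner_pow (hT : ∀ x y : L2 d, Measurable fun ω => ⟪x, T ω y⟫_ℂ)
    (hT1 : ∀ ω, ‖T ω‖ ≤ 1) (n : ℕ) (j : Lattice d) :
    Integrable (fun ω => ⟪(basisVec j : L2 d), (T ω ^ n) (basisVec j)⟫_ℂ) (prodLaw d μ) :=
  Integrable.of_bound (measurable_inner_pow hT n _ _).aestronglyMeasurable 1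
    (ae_of_all _ fun ω => norm_inner_pow_le (hT1 ω) n j)

/-- The mean of the local trace per unit volume does not depend on the box. -/
lemma integral_sum_box (hγ : LinearIndependent ℤ γ)
    (hT : ∀ x y : L2 d, Measurable fun ω => ⟪x, T ω y⟫_ℂ) (hT1 : ∀ ω, ‖T ω‖ ≤ 1)
    (hT_erg : ∀ g ∈ AddSubgroup.closure (Set.range γ), ∀ ω, ∀ x : L2 d,
      T (shift g ω) x = translation g (T ω ((translation g).symm x))) (k n : ℕ) :
    ∫ ω, ((box γ n).card : ℂ)⁻¹ * ∑ j ∈ box γ n, ⟪(basisVec j : L2 d), (T ω ^ k) (basisVec j)⟫_ℂ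
      ∂(prodLaw d μ) = dosMoment μ γ T k := by
  rw [integral_const_mul, integral_finsetSum _ fun j _ => integrable_inner_pow hT hT1 k j,
    sum_box hγ, card_box hγ, dosMoment]
  have h : ∀ p : Fin d → ℤ, ∀ b : Lattice d,
      ∫ ω, ⟪(basisVec (b + ∑ i, p i • γ i) : L2 d),
        (T ω ^ k) (basisVec (b + ∑ i, p i • γ i))⟫_ℂ ∂(prodLaw d μ) =
      ∫ ω, ⟪(basisVec b : L2 d), (T ω ^ k) (basisVec b)⟫_ℂ ∂(prodLaw d μ) := by
    intro p b
    have hg : ∑ i, p i • γ i ∈ AddSubgroup.closure (Set.range γ) :=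
      sum_mem fun i _ => zsmul_mem (AddSubgroup.subset_closure (Set.mem_range_self i)) _
    rw [← integral_comp_shift (measurable_inner_pow hT k (basisVec b) (basisVec b))
      (∑ i, p i • γ i)]
    exact integral_congr_ae (ae_of_all _ fun ω => (inner_pow_shift (hT_erg _ hg ω) k b).symm)
  simp only [h, Finset.sum_const, nsmul_eq_mul]
  have hne : ((Fintype.piFinset fun _ : Fin d => Finset.Icc (-(n : ℤ)) n).card : ℂ) ≠ 0 := by
    have : (Fintype.piFinset fun _ : Fin d => Finset.Icc (-(n : ℤ)) n).Nonempty := ⟨0, by simp⟩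
    exact_mod_cast this.card_pos.ne'
  push_cast
  rw [mul_inv]
  field_simp

end Ergodic

/-! ### The averaged measure -/

section MeanMeasure

open ProbabilityTheory

/-- A measurable version of m is patched by a Dirac mass wherever its total mass is not 1, which
happens only on a null set. -/
lemma exists_markovKernel {Ω S : Type*} [MeasurableSpace Ω] [MeasurableSpace S] [Nonempty S]
    {P : Measure Ω} {m : Ω → Measure S} (hm : AEMeasurable m P)
    (hp : ∀ᵐ ω ∂P, IsProbabilityMeasure (m ω)) :
    ∃ κ : Kernel Ω S, IsMarkovKernel κ ∧ ∀ᵐ ω ∂P, m ω = κ ω := by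
  classical
  obtain ⟨s0⟩ := (inferInstance : Nonempty S)
  set m' := hm.mk m with hm'
  have hmeas : Measurable m' := hm.measurable_mk
  have hset : MeasurableSet {ω | m' ω Set.univ = 1} :=
    (Measure.measurable_coe MeasurableSet.univ).comp hmeas (measurableSet_singleton 1)
  refine ⟨⟨fun ω => if m' ω Set.univ = 1 then m' ω else Measure.dirac s0,
    Measurable.ite hset hmeas measurable_const⟩, ⟨fun ω => ?_⟩, ?_⟩
  · change IsProbabilityMeasure (if m' ω Set.univ = 1 then m' ω else Measure.dirac s0)
    split_ifs with h
    · exact ⟨h⟩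
    · infer_instance
  · filter_upwards [hm.ae_eq_mk, hp] with ω h1 h2
    change m ω = if m' ω Set.univ = 1 then m' ω else Measure.dirac s0
    rw [if_pos (by rw [hm', ← h1]; exact h2.measure_univ)]
    exact h1

lemma integral_bind {Ω S : Type*} [MeasurableSpace Ω] [MeasurableSpace S] [Nonempty S]
    {P : Measure Ω} [IsProbabilityMeasure P] {m : Ω → Measure S} (hm : AEMeasurable m P)
    (hp : ∀ᵐ ω ∂P, IsProbabilityMeasure (m ω)) {f : S → ℂ} (hf : Integrable f (P.bind m)) :
    ∫ x, f x ∂(P.bind m) = ∫ ω, ∫ x, f x ∂(m ω) ∂P := by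
  obtain ⟨κ, hκ, h⟩ := exists_markovKernel hm hp
  rw [Measure.bind_congr_right h] at hf ⊢
  rw [Measure.comp_eq_comp_const_apply] at hf ⊢
  rw [Kernel.integral_comp hf, Kernel.const_apply]
  exact integral_congr_ae (h.mono fun ω hω => by simp only [hω])

end MeanMeasure

/-! ### Moments of the density of states -/

section Moments

variable {d : ℕ} {X : Set ℝ} {μ : Measure X} [IsProbabilityMeasure μ]
  {γ : Fin d → Lattice d} {T : Config d X → (L2 d →L[ℂ] L2 d)}
  {TΛ : ∀ n : ℕ, Config d X → (boxSpace (box γ n) →L[ℂ] boxSpace (box γ n))}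
  {TΛc : ∀ n : ℕ, Config d X → ((boxSpace (box γ n))ᗮ →L[ℂ] (boxSpace (box γ n))ᗮ)}
  {m : Config d X → Measure ClosedDisc}

/-- A limit of eigenvalue counting measures is a probability measure. -/
lemma isProbabilityMeasure_of_tendsto {A : ∀ n : ℕ, boxSpace (box γ n) →L[ℂ] boxSpace (box γ n)}
    (hA : ∀ n, ‖A n‖ ≤ 1) {ν : Measure ClosedDisc}
    (h : ∀ f : C(ClosedDisc, ℂ),
      Tendsto (fun n : ℕ => ∫ w, f w ∂(countingMeasure (A n))) atTop (𝓝 (∫ w, f w ∂ν))) :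
    IsProbabilityMeasure ν := by
  have h1 := h 1
  simp only [ContinuousMap.one_apply, integral_countingMeasure_one (hA _) (box_nonempty γ _)] at h1
  have h2 : ∫ _ : ClosedDisc, (1 : ℂ) ∂ν = 1 := tendsto_nhds_unique h1 tendsto_const_nhds
  rw [integral_const, real_smul, mul_one] at h2
  have h3 : ν.real Set.univ = 1 := by exact_mod_cast h2
  refine ⟨?_⟩
  -- Infinite mass would have `toReal` equal to 0, so the value 1 excludes it.
  rw [Measure.real] at h3
  exact (ENNReal.toReal_eq_one_iff _).mp h3

/-- The moments of the limiting measures are the limits of the local traces per unit volume. -/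
lemma tendsto_localTrace (hT1 : ∀ ω, ‖T ω‖ ≤ 1) (hA1 : ∀ n ω, ‖TΛ n ω‖ ≤ 1)
    (hlittle : ∀ ω, Tendsto (fun n : ℕ =>
      traceNorm ((boxSpace (box γ n)).starProjection ∘L
        (T ω - directSum (boxSpace (box γ n)) (TΛ n ω) (TΛc n ω))) / ((box γ n).card : ℝ≥0∞))
      atTop (𝓝 0)) {ω : Config d X}
    (h : ∀ f : C(ClosedDisc, ℂ),
      Tendsto (fun n : ℕ => ∫ w, f w ∂(countingMeasure (TΛ n ω))) atTop (𝓝 (∫ w, f w ∂(m ω))))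
    (k : ℕ) :
    Tendsto (fun n : ℕ => ((box γ n).card : ℂ)⁻¹ *
      ∑ j ∈ box γ n, ⟪(basisVec j : L2 d), (T ω ^ k) (basisVec j)⟫_ℂ) atTop
      (𝓝 (∫ w : ClosedDisc, (w : ℂ) ^ k ∂(m ω))) := by
  have h1 := h ⟨fun w => (w : ℂ) ^ k, by fun_prop⟩
  simp only [ContinuousMap.coe_mk] at h1
  refine tendsto_of_tendsto_of_dist h1 ?_
  have hbound : ∀ n : ℕ, ‖((box γ n).card : ℂ)⁻¹ *
      ∑ j ∈ box γ n, ⟪(basisVec j : L2 d), (T ω ^ k) (basisVec j)⟫_ℂ -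
        ∫ w : ClosedDisc, (w : ℂ) ^ k ∂(countingMeasure (TΛ n ω))‖ₑ ≤
      k * (traceNorm ((boxSpace (box γ n)).starProjection ∘L
        (T ω - directSum (boxSpace (box γ n)) (TΛ n ω) (TΛc n ω))) / ((box γ n).card : ℝ≥0∞)) := by
    intro n
    have hc : ((box γ n).card : ℂ) ≠ 0 := by exact_mod_cast (box_nonempty γ n).card_pos.ne'
    rw [integral_countingMeasure (hA1 n ω) fun z => z ^ k, ← mul_sub, enorm_mul, enorm_inv hc,
      mul_comm, ← mul_div_assoc, div_eq_mul_inv]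
    have hcard : ‖((box γ n).card : ℂ)‖ₑ = ((box γ n).card : ℝ≥0∞) := by
      rw [← ofReal_norm, Complex.norm_natCast, ENNReal.ofReal_natCast]
    rw [hcard]
    exact mul_le_mul_left (enorm_sum_inner_pow_sub_trace_le (hT1 ω) (hA1 n ω) (TΛc n ω) k) _
  have hlim : Tendsto (fun n : ℕ => (k : ℝ≥0∞) *
      (traceNorm ((boxSpace (box γ n)).starProjection ∘L
        (T ω - directSum (boxSpace (box γ n)) (TΛ n ω) (TΛc n ω))) / ((box γ n).card : ℝ≥0∞)))
      atTop (𝓝 0) := by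
    have := ENNReal.Tendsto.const_mul (a := (k : ℝ≥0∞)) (hlittle ω)
      (Or.inr (ENNReal.natCast_ne_top k))
    rwa [mul_zero] at this
  have h2 := tendsto_of_tendsto_of_tendsto_of_le_of_le tendsto_const_nhds hlim
    (fun _ => zero_le) hbound
  have h3 := (ENNReal.tendsto_toReal ENNReal.zero_ne_top).comp h2
  simpa [Function.comp_def, dist_eq_norm, norm_sub_rev] using h3

/-- The moments of the density of states functional are those of the averaged measure. -/
theorem dosMoment_eq_integral (hγ : LinearIndependent ℤ γ)
    (hT : ∀ x y : L2 d, Measurable fun ω => ⟪x, T ω y⟫_ℂ) (hT1 : ∀ ω, ‖T ω‖ ≤ 1)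
    (hT_erg : ∀ g ∈ AddSubgroup.closure (Set.range γ), ∀ ω, ∀ x : L2 d,
      T (shift g ω) x = translation g (T ω ((translation g).symm x)))
    (hm : AEMeasurable m (prodLaw d μ)) (hp : ∀ᵐ ω ∂(prodLaw d μ), IsProbabilityMeasure (m ω))
    (hlim : ∀ᵐ ω ∂(prodLaw d μ), ∀ k : ℕ, Tendsto (fun n : ℕ => ((box γ n).card : ℂ)⁻¹ *
      ∑ j ∈ box γ n, ⟪(basisVec j : L2 d), (T ω ^ k) (basisVec j)⟫_ℂ) atTop
      (𝓝 (∫ w : ClosedDisc, (w : ℂ) ^ k ∂(m ω)))) (k : ℕ) :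
    dosMoment μ γ T k = ∫ w : ClosedDisc, (w : ℂ) ^ k ∂(meanMeasure μ m) := by
  have hP : IsProbabilityMeasure (meanMeasure μ m) := isProbabilityMeasure_bind hm hp
  have hint : Integrable (fun w : ClosedDisc => (w : ℂ) ^ k) (meanMeasure μ m) := by
    refine Integrable.of_bound (Continuous.aestronglyMeasurable (by fun_prop)) 1
      (ae_of_all _ fun w => ?_)
    rw [norm_pow]
    exact pow_le_one₀ (norm_nonneg _) (mem_closedBall_zero_iff.mp w.2)
  rw [meanMeasure, integral_bind hm hp hint]
  have h1 : Tendsto (fun n : ℕ => ∫ ω, ((box γ n).card : ℂ)⁻¹ *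
      ∑ j ∈ box γ n, ⟪(basisVec j : L2 d), (T ω ^ k) (basisVec j)⟫_ℂ ∂(prodLaw d μ)) atTop
      (𝓝 (∫ ω, ∫ w : ClosedDisc, (w : ℂ) ^ k ∂(m ω) ∂(prodLaw d μ))) := by
    refine tendsto_integral_of_dominated_convergence (fun _ => 1) (fun n => ?_)
      (integrable_const 1) (fun n => ae_of_all _ fun ω => ?_) (hlim.mono fun ω h => h k)
    · exact ((Finset.measurable_fun_sum _ fun j _ =>
        measurable_inner_pow hT k _ _).const_mul _).aestronglyMeasurable
    · have hc : (0 : ℝ) < (box γ n).card := by exact_mod_cast (box_nonempty γ n).card_pos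
      rw [norm_mul, norm_inv, Complex.norm_natCast, inv_mul_le_iff₀ hc, mul_one]
      refine (norm_sum_le _ _).trans ?_
      refine (Finset.sum_le_sum fun j _ => norm_inner_pow_le (hT1 ω) k j).trans_eq ?_
      simp
  -- By stationarity the expectations form a constant sequence, which must equal its limit.
  simp only [integral_sum_box hγ hT hT1 hT_erg] at h1
  exact tendsto_nhds_unique tendsto_const_nhds h1

/-- The density of states functional is the Abel sum of its moments. -/
theorem tendsto_dosFunctional {f : ℂ → ℂ} (hf : IsHInf f)
    (hT : ∀ x y : L2 d, Measurable fun ω => ⟪x, T ω y⟫_ℂ) (hTc : ∀ ω, IsCNUContraction (T ω)) :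
    Tendsto (fun ρ : ℝ => ∑' n : ℕ, taylorCoeff f n * (ρ : ℂ) ^ n * dosMoment μ γ T n) (𝓝[<] 1)
      (𝓝 (dosFunctional μ γ T f)) := by
  obtain ⟨M, hM⟩ := hf.exists_isBoundedSeries
  have hT1 : ∀ ω, ‖T ω‖ ≤ 1 := fun ω => (hTc ω).1
  set c := taylorCoeff f with hc
  have hI : ∀ᶠ ρ : ℝ in 𝓝[<] 1, ρ ∈ Set.Ioo (0 : ℝ) 1 := Ioo_mem_nhdsLT (zero_lt_one' ℝ)
  have hser : ∀ ρ ∈ Set.Ioo (0 : ℝ) 1, ∀ ω, ∀ b : Lattice d,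
      HasSum (fun n => c n * (ρ : ℂ) ^ n * ⟪(basisVec b : L2 d), (T ω ^ n) (basisVec b)⟫_ℂ)
        ⟪(basisVec b : L2 d), abelSum c (T ω) ρ (basisVec b)⟫_ℂ := fun ρ hρ ω b => by
    have h := (hM.hasSum_abelSum_apply (hT1 ω) hρ.1.le hρ.2 (basisVec b)).mapL
      (innerSL ℂ (basisVec b))
    simpa only [innerSL_apply_apply, inner_smul_right] using h
  have hmeas : ∀ ρ ∈ Set.Ioo (0 : ℝ) 1, ∀ b : Lattice d, Measurable fun ω =>
      ⟪(basisVec b : L2 d), abelSum c (T ω) ρ (basisVec b)⟫_ℂ := fun ρ hρ b => by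
    refine measurable_of_tendsto_metrizable (f := fun N ω => ∑ n ∈ Finset.range N,
      c n * (ρ : ℂ) ^ n * ⟪(basisVec b : L2 d), (T ω ^ n) (basisVec b)⟫_ℂ)
      (fun N => Finset.measurable_fun_sum _ fun n _ =>
        (measurable_inner_pow hT n _ _).const_mul _) ?_
    exact tendsto_pi_nhds.mpr fun ω => (hser ρ hρ ω b).tendsto_sum_nat
  have hint : ∀ ρ ∈ Set.Ioo (0 : ℝ) 1, ∀ b : Lattice d,
      HasSum (fun n => c n * (ρ : ℂ) ^ n *
        ∫ ω, ⟪(basisVec b : L2 d), (T ω ^ n) (basisVec b)⟫_ℂ ∂(prodLaw d μ))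
        (∫ ω, ⟪(basisVec b : L2 d), abelSum c (T ω) ρ (basisVec b)⟫_ℂ ∂(prodLaw d μ)) := by
    intro ρ hρ b
    simp only [← integral_const_mul]
    refine hasSum_integral_of_dominated_convergence (fun n _ => ‖c n * (ρ : ℂ) ^ n‖) (fun n => ?_)
      (fun n => ae_of_all _ fun ω => ?_) (ae_of_all _ fun _ =>
        hM.summable_norm_mul_pow hρ.1.le hρ.2) (integrable_const _)
      (ae_of_all _ fun ω => hser ρ hρ ω b)
    · exact ((measurable_inner_pow hT n _ _).const_mul _).aestronglyMeasurable
    · rw [norm_mul]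
      exact mul_le_of_le_one_right (norm_nonneg _) (norm_inner_pow_le (hT1 ω) n b)
  have hlim : ∀ b : Lattice d, Tendsto (fun ρ : ℝ =>
      ∫ ω, ⟪(basisVec b : L2 d), abelSum c (T ω) ρ (basisVec b)⟫_ℂ ∂(prodLaw d μ)) (𝓝[<] 1)
      (𝓝 (∫ ω, ⟪(basisVec b : L2 d), funcCalc f (T ω) (basisVec b)⟫_ℂ ∂(prodLaw d μ))) := by
    intro b
    -- Von Neumann's inequality supplies the dominating constant M, uniformly in ρ and ω.
    refine tendsto_integral_filter_of_dominated_convergence (fun _ => M) ?_ ?_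
      (integrable_const M) (ae_of_all _ fun ω => ?_)
    · filter_upwards [hI] with ρ hρ using (hmeas ρ hρ b).aestronglyMeasurable
    · filter_upwards [hI] with ρ hρ
      refine ae_of_all _ fun ω => (norm_inner_le_norm _ _).trans ?_
      have := hM.norm_abelSum_apply_le (hT1 ω) hρ.1.le hρ.2 (basisVec b)
      rw [norm_basisVec, mul_one] at this
      rwa [norm_basisVec, one_mul]
    · exact ((innerSL ℂ (basisVec b : L2 d)).continuous.tendsto _).comp
        (hf.tendsto_funcCalc (hTc ω) (basisVec b))
  have hsum := (tendsto_finsetSum (cell γ) fun b _ => hlim b).const_mul ((cell γ).card : ℂ)⁻¹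
  refine hsum.congr' ?_
  filter_upwards [hI] with ρ hρ
  have h := (hasSum_sum fun b (_ : b ∈ cell γ) => hint ρ hρ b).mul_left ((cell γ).card : ℂ)⁻¹
  rw [← h.tsum_eq]
  refine tsum_congr fun n => ?_
  rw [dosMoment, ← Finset.mul_sum]
  ring

end Moments

/-! ### Fatou's theorem on radial limits -/

/-- The Poisson kernel has mean 1 on the circle, so the weighted bound contributes a, while b covers
the points where the kernel itself is small. -/
lemma norm_le_of_poissonKernel_mul_norm_le {g : ℂ → ℂ} (hg : DiffContOnCl ℂ g (ball 0 1)) {z : ℂ}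
    (hz : z ∈ ball (0 : ℂ) 1) {a b : ℝ}
    (h : ∀ w : ℂ, ‖w‖ = 1 → poissonKernel 0 z w * ‖g w‖ ≤ poissonKernel 0 z w * a + b) :
    ‖g z‖ ≤ a + b := by
  have hz' : ‖z‖ < 1 := by simpa using hz
  have hne : ∀ w ∈ sphere (0 : ℂ) 1, w - z ≠ 0 := by
    intro w hw h0
    rw [sub_eq_zero.mp h0] at hw
    simp only [mem_sphere_iff_norm, sub_zero] at hw
    exact hz'.ne hw
  have hPc : ContinuousOn (fun w => poissonKernel 0 z w) (sphere 0 1) := by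
    simp only [poissonKernel_def, sub_zero]
    exact ContinuousOn.div (by fun_prop) (by fun_prop)
      fun w hw => pow_ne_zero 2 (norm_ne_zero_iff.mpr (hne w hw))
  have hPnn : ∀ w : ℂ, ‖w‖ = 1 → 0 ≤ poissonKernel 0 z w := fun w hw => by
    simp only [poissonKernel_def, sub_zero, hw]
    exact div_nonneg (by nlinarith [norm_nonneg z]) (sq_nonneg _)
  have hgc : ContinuousOn g (sphere 0 1) := hg.continuousOn_ball.mono sphere_subset_closedBall
  have hP1 : Real.circleAverage (fun w => poissonKernel 0 z w) 0 1 = 1 := by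
    have h1 := (diffContOnCl_const (c := (1 : ℂ)) (s := ball (0 : ℂ) 1)
      (𝕜 := ℂ)).circleAverage_poissonKernel_smul hz
    have h2 := Complex.ofRealCLM.circleAverage_comp_comm
      (f := fun w => poissonKernel 0 z w) (c := 0) (R := 1) (hPc.circleIntegrable zero_le_one)
    have h3 : ((Real.circleAverage (fun w => poissonKernel 0 z w) 0 1 : ℝ) : ℂ) = 1 := by
      refine h2.symm.trans (Eq.trans ?_ h1)
      congr 1
      ext w
      simp
    exact_mod_cast h3
  have hrep := hg.circleAverage_poissonKernel_smul hz
  have hle : ‖g z‖ ≤ Real.circleAverage (fun w => poissonKernel 0 z w * ‖g w‖) 0 1 := by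
    rw [← hrep, Real.circleAverage_def, Real.circleAverage_def, norm_smul, smul_eq_mul,
      Real.norm_of_nonneg (by positivity)]
    refine mul_le_mul_of_nonneg_left ?_ (by positivity)
    refine (intervalIntegral.norm_integral_le_integral_norm (by positivity)).trans (le_of_eq ?_)
    refine intervalIntegral.integral_congr fun θ _ => ?_
    simp only [Pi.smul_apply', norm_smul]
    rw [Real.norm_of_nonneg (hPnn _ (by simp))]
  refine hle.trans ?_
  have hci : CircleIntegrable (fun w => poissonKernel 0 z w * a) 0 1 :=
    (hPc.mul continuousOn_const).circleIntegrable zero_le_one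
  calc _ ≤ Real.circleAverage (fun w => poissonKernel 0 z w * a + b) 0 1 := by
        refine Real.circleAverage_mono ((hPc.mul hgc.norm).circleIntegrable zero_le_one)
          (((hPc.mul continuousOn_const).add continuousOn_const).circleIntegrable zero_le_one) ?_
        intro w hw
        exact h w (by simpa using hw)
    _ = a + b := by
        rw [Real.circleAverage_fun_add hci (continuousOn_const.circleIntegrable zero_le_one),
          Real.circleAverage_const]
        congr 1
        have := Real.circleAverage_fun_smul (a := a) (f := fun w => poissonKernel 0 z w)
          (c := 0) (R := 1)
        simp only [smul_eq_mul, hP1, mul_one] at this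
        simpa only [mul_comm] using this

/-- Core of Fatou's theorem. Let H be the first order remainder of F at ζ₀ and t = 1 - ρ. Dividing H
by w - z', with z' = (2 - ρ) ζ₀ just outside the disc, gives a function g which on the circle is at
most 2ε near ζ₀ and at most 2K elsewhere. For z near ρ ζ₀ the Poisson kernel is O(t/δ²) away from
ζ₀, so g is small at z. Hence H is small compared with t there, and Cauchy's estimate bounds H' = F'
- a. -/
lemma norm_sub_le_of_tangential {F : ℂ → ℂ} (hF : DiffContOnCl ℂ F (ball 0 1)) {ζ₀ a : ℂ}
    (hζ₀ : ‖ζ₀‖ = 1) {K ε δ : ℝ} (hδ : 0 < δ) (hε : 0 ≤ ε)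
    (hK : ∀ w : ℂ, ‖w‖ = 1 → ‖F w - F ζ₀ - a * (w - ζ₀)‖ ≤ K * ‖w - ζ₀‖)
    (hsmall : ∀ w : ℂ, ‖w‖ = 1 → ‖w - ζ₀‖ < δ →
      ‖F w - F ζ₀ - a * (w - ζ₀)‖ ≤ ε * ‖w - ζ₀‖)
    {ρ : ℝ} (hρ0 : 0 < ρ) (hρ1 : ρ < 1) :
    ‖deriv F (ρ * ζ₀) - a‖ ≤ 5 * (2 * ε + 2 * K * (48 * (1 - ρ) / δ ^ 2)) := by
  have hK0 : 0 ≤ K := by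
    have h2 := hK (-ζ₀) (by simpa using hζ₀)
    have h3 : ‖-ζ₀ - ζ₀‖ = 2 := by
      rw [show -ζ₀ - ζ₀ = -(2 * ζ₀) by ring, norm_neg, norm_mul, hζ₀]; simp
    rw [h3] at h2
    linarith [norm_nonneg (F (-ζ₀) - F ζ₀ - a * (-ζ₀ - ζ₀))]
  set H : ℂ → ℂ := fun w => F w - F ζ₀ - a * (w - ζ₀) with hH
  have hHd : DiffContOnCl ℂ H (ball 0 1) :=
    (hF.sub_const _).sub (Differentiable.diffContOnCl (by fun_prop))
  set t : ℝ := 1 - ρ with ht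
  have ht0 : 0 < t := by linarith
  set z' : ℂ := ((2 - ρ : ℝ) : ℂ) * ζ₀ with hz'
  have hz'n : ‖z'‖ = 2 - ρ := by
    rw [hz', norm_mul, hζ₀, mul_one, Complex.norm_real, Real.norm_of_nonneg (by linarith)]
  have hz'd : ‖ζ₀ - z'‖ = t := by
    rw [hz', show ζ₀ - ((2 - ρ : ℝ) : ℂ) * ζ₀ = ((ρ - 1 : ℝ) : ℂ) * ζ₀ by push_cast; ring, norm_mul,
      hζ₀, mul_one, Complex.norm_real, Real.norm_eq_abs, abs_of_nonpos (by linarith)]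
    linarith
  have hwz' : ∀ w : ℂ, ‖w‖ ≤ 1 → t ≤ ‖w - z'‖ := fun w hw => by
    have := norm_sub_norm_le z' w
    rw [norm_sub_rev] at this
    linarith
  have hne : ∀ w : ℂ, ‖w‖ ≤ 1 → w - z' ≠ 0 := fun w hw =>
    norm_pos_iff.mp (ht0.trans_le (hwz' w hw))
  set g : ℂ → ℂ := fun w => H w * (w - z')⁻¹ with hg
  have hgd : DiffContOnCl ℂ g (ball 0 1) := by
    refine ⟨hHd.1.mul (DifferentiableOn.inv (by fun_prop) fun w hw => hne w ?_),
      hHd.2.mul (ContinuousOn.inv₀ (by fun_prop) fun w hw => hne w ?_)⟩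
    · exact (mem_ball_zero_iff.mp hw).le
    · rw [closure_ball _ one_ne_zero] at hw
      exact mem_closedBall_zero_iff.mp hw
  -- The factor 2 comes from |w - ζ₀| ≤ |w - z'| + t ≤ 2 |w - z'|.
  have hgb : ∀ w : ℂ, ‖w‖ = 1 → ∀ C : ℝ, 0 ≤ C → ‖H w‖ ≤ C * ‖w - ζ₀‖ → ‖g w‖ ≤ 2 * C := by
    intro w hw C hC hle
    rw [hg]
    simp only [norm_mul, norm_inv]
    rw [← div_eq_mul_inv, div_le_iff₀ (ht0.trans_le (hwz' w hw.le))]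
    have h1 : ‖w - ζ₀‖ ≤ ‖w - z'‖ + t := by
      rw [← hz'd, norm_sub_rev ζ₀ z']
      exact norm_sub_le_norm_sub_add_norm_sub _ _ _
    nlinarith [hwz' w hw.le]
  -- 48 = 3 · 16, from 1 - |z|² ≤ 3t and δ ≤ |w - ζ₀| ≤ 4 |w - z|.
  set M : ℝ := 2 * ε + 2 * K * (48 * t / δ ^ 2) with hM
  have hρζ : ‖(ρ : ℂ) * ζ₀‖ = ρ := by
    rw [norm_mul, hζ₀, mul_one, Complex.norm_real, Real.norm_of_nonneg hρ0.le]
  have hbd : ∀ z : ℂ, ‖z - ρ * ζ₀‖ ≤ t / 2 → ‖H z‖ ≤ (5 / 2 * t) * M := by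
    intro z hz
    have hzn : ‖z‖ ≤ 1 - t / 2 := by
      have := norm_le_norm_add_norm_sub' z (ρ * ζ₀)
      rw [hρζ] at this
      linarith
    have hzn' : 1 - 3 / 2 * t ≤ ‖z‖ := by
      have := norm_sub_norm_le (ρ * ζ₀) z
      rw [hρζ, norm_sub_rev] at this
      linarith
    have hzζ : ‖z - ζ₀‖ ≤ 3 / 2 * t := by
      have h1 : ‖(ρ : ℂ) * ζ₀ - ζ₀‖ = t := by
        rw [show (ρ : ℂ) * ζ₀ - ζ₀ = ((ρ - 1 : ℝ) : ℂ) * ζ₀ by push_cast; ring, norm_mul,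
          hζ₀, mul_one, Complex.norm_real, Real.norm_eq_abs, abs_of_nonpos (by linarith)]
        linarith
      have := norm_sub_le_norm_sub_add_norm_sub z (ρ * ζ₀) ζ₀
      linarith
    have hgz : ‖g z‖ ≤ M := by
      refine norm_le_of_poissonKernel_mul_norm_le hgd (by simp; linarith) fun w hw => ?_
      have hwz : t / 2 ≤ ‖w - z‖ := by
        have := norm_sub_norm_le w z
        linarith
      have hPnn : 0 ≤ poissonKernel 0 z w := by
        simp only [poissonKernel_def, sub_zero, hw]
        exact div_nonneg (by nlinarith [norm_nonneg z]) (sq_nonneg _)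
      by_cases hlt : ‖w - ζ₀‖ < δ
      · have := hgb w hw ε hε (hsmall w hw hlt)
        have h2 : 0 ≤ 2 * K * (48 * t / δ ^ 2) := by positivity
        nlinarith
      · push Not at hlt
        have h1 := hgb w hw K hK0 (hK w hw)
        have h2 : poissonKernel 0 z w ≤ 48 * t / δ ^ 2 := by
          simp only [poissonKernel_def, sub_zero, hw]
          have h3 : ‖w - ζ₀‖ ≤ 4 * ‖w - z‖ := by
            have := norm_sub_le_norm_sub_add_norm_sub w z ζ₀
            linarith
          rw [div_le_div_iff₀ (pow_pos (by linarith) 2) (by positivity)]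
          have h4 : δ ^ 2 ≤ 16 * ‖w - z‖ ^ 2 := by nlinarith
          have h5 : 1 ^ 2 - ‖z‖ ^ 2 ≤ 3 * t := by nlinarith [norm_nonneg z]
          calc _ ≤ 3 * t * δ ^ 2 := by gcongr
            _ ≤ 3 * t * (16 * ‖w - z‖ ^ 2) := by gcongr
            _ = _ := by ring
        calc _ ≤ 48 * t / δ ^ 2 * (2 * K) := mul_le_mul h2 h1 (norm_nonneg _) (by positivity)
          _ ≤ _ := by nlinarith [mul_nonneg hPnn hε]
    have hz1 : ‖z‖ ≤ 1 := by linarith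
    have hHg : H z = (z - z') * g z := by
      rw [hg]; field_simp [hne z hz1]
    rw [hHg, norm_mul]
    refine mul_le_mul ?_ hgz (norm_nonneg _) (by positivity)
    have := norm_sub_le_norm_sub_add_norm_sub z ζ₀ z'
    linarith
  -- Dividing the bound (5/2) t M by the radius t/2 gives the factor 5 of the conclusion.
  have hderiv := norm_deriv_le_of_forall_mem_sphere_norm_le (c := (ρ : ℂ) * ζ₀) (R := t / 2)
    (f := H) (half_pos ht0) (hHd.mono (ball_subset_ball' (by
      rw [dist_zero_right, hρζ]; linarith))) (C := (5 / 2 * t) * M) fun z hz => hbd z (by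
        simpa [dist_eq_norm] using (mem_sphere.mp hz).le)
  have hFd : DifferentiableAt ℂ F (ρ * ζ₀) :=
    hF.differentiableAt isOpen_ball (by simp only [mem_ball_zero_iff]; rw [hρζ]; exact hρ1)
  have hHderiv : deriv H (ρ * ζ₀) = deriv F (ρ * ζ₀) - a := by
    refine HasDerivAt.deriv ?_
    have := (hFd.hasDerivAt.sub_const (F ζ₀)).sub
      (((hasDerivAt_id ((ρ : ℂ) * ζ₀)).sub_const ζ₀).const_mul a)
    rw [mul_one] at this
    exact this
  rw [hHderiv] at hderiv
  refine hderiv.trans (le_of_eq ?_)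
  field_simp

open InnerProductGeometry in
-- An arc is at most π/2 times its chord, which converts smallness in the angle into smallness in |w
-- - ζ₀|.
lemma exists_circleMap_eq_of_norm_eq_one {w : ℂ} (hw : ‖w‖ = 1) (θ₀ : ℝ) :
    ∃ θ : ℝ, circleMap 0 1 θ = w ∧ |θ - θ₀| ≤ Real.pi / 2 * ‖w - circleMap 0 1 θ₀‖ := by
  have h0 : ‖circleMap 0 1 θ₀‖ = 1 := norm_circleMap_one θ₀
  have hne : circleMap 0 1 θ₀ ≠ 0 := norm_ne_zero_iff.mp (by rw [h0]; exact one_ne_zero)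
  have hw0 : w ≠ 0 := norm_ne_zero_iff.mp (by rw [hw]; exact one_ne_zero)
  refine ⟨θ₀ + arg (w / circleMap 0 1 θ₀), ?_, ?_⟩
  · have h1 := norm_mul_exp_arg_mul_I (w / circleMap 0 1 θ₀)
    rw [norm_div, hw, h0, div_one, ofReal_one, one_mul] at h1
    have h2 : circleMap 0 1 (θ₀ + arg (w / circleMap 0 1 θ₀)) =
        circleMap 0 1 θ₀ * exp (arg (w / circleMap 0 1 θ₀) * I) := by
      simp [circleMap, add_mul, exp_add]
    rw [h2, h1, mul_div_cancel₀ _ hne]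
  · rw [add_sub_cancel_left, ← angle_eq_abs_arg hw0 hne]
    exact angle_le_mul_norm_sub hw h0

/-- Differentiability along the circle at one point forces a radial limit of F'. The candidate a is
dF/dθ divided by dζ/dθ = i ζ₀. -/
lemma tendsto_deriv_radial {F : ℂ → ℂ} (hF : DiffContOnCl ℂ F (ball 0 1)) {K : NNReal}
    (hK : LipschitzWith K F) {θ₀ : ℝ}
    (hθ₀ : DifferentiableAt ℝ (fun θ => F (circleMap 0 1 θ)) θ₀) :
    ∃ a, Tendsto (fun ρ : ℝ => deriv F (ρ * circleMap 0 1 θ₀)) (𝓝[<] 1) (𝓝 a) := by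
  set ζ₀ := circleMap 0 1 θ₀ with hζ₀
  have hn : ‖ζ₀‖ = 1 := norm_circleMap_one θ₀
  have hne : ζ₀ ≠ 0 := norm_ne_zero_iff.mp (by rw [hn]; exact one_ne_zero)
  obtain ⟨G', hG⟩ : ∃ G', HasDerivAt (fun θ => F (circleMap 0 1 θ)) G' θ₀ := ⟨_, hθ₀.hasDerivAt⟩
  set a : ℂ := G' / (ζ₀ * I) with ha
  have hH : HasDerivAt (fun θ => F (circleMap 0 1 θ) - F ζ₀ - a * (circleMap 0 1 θ - ζ₀)) 0 θ₀ := by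
    have h1 := (hG.sub_const (F ζ₀)).sub (((hasDerivAt_circleMap 0 1 θ₀).sub_const ζ₀).const_mul a)
    have h2 : G' - a * (circleMap 0 1 θ₀ * I) = 0 := by
      rw [← hζ₀, ha, div_mul_cancel₀ _ (mul_ne_zero hne I_ne_zero), sub_self]
    rw [h2] at h1
    exact h1
  have hsmall : ∀ ε > 0, ∃ δ > 0, ∀ w : ℂ, ‖w‖ = 1 → ‖w - ζ₀‖ < δ →
      ‖F w - F ζ₀ - a * (w - ζ₀)‖ ≤ ε * ‖w - ζ₀‖ := by
    intro ε hε
    have hc : 0 < ε * (2 / Real.pi) := by positivity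
    have h1 := (hasDerivAt_iff_isLittleO.mp hH).def hc
    obtain ⟨δ, hδ, h2⟩ := Metric.eventually_nhds_iff.mp h1
    refine ⟨δ * (2 / Real.pi), by positivity, fun w hw hlt => ?_⟩
    obtain ⟨θ, rfl, hθ⟩ := exists_circleMap_eq_of_norm_eq_one hw θ₀
    have h3 : |θ - θ₀| < δ := by
      refine hθ.trans_lt ?_
      calc _ < Real.pi / 2 * (δ * (2 / Real.pi)) := by gcongr
        _ = δ := by field_simp
    have h4 := h2 (y := θ) (by rwa [Real.dist_eq])
    simp only [← hζ₀, sub_self, mul_zero, sub_zero, smul_zero, Real.norm_eq_abs] at h4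
    refine h4.trans ?_
    calc _ ≤ ε * (2 / Real.pi) * (Real.pi / 2 * ‖circleMap 0 1 θ - circleMap 0 1 θ₀‖) := by gcongr
      _ = _ := by rw [← hζ₀]; field_simp
  have hK' : ∀ w : ℂ, ‖w‖ = 1 → ‖F w - F ζ₀ - a * (w - ζ₀)‖ ≤ (K + ‖a‖) * ‖w - ζ₀‖ := by
    intro w _
    refine (norm_sub_le _ _).trans ?_
    rw [norm_mul, add_mul]
    gcongr
    exact hK.norm_sub_le w ζ₀
  refine ⟨a, Metric.tendsto_nhds.mpr fun e he => ?_⟩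
  -- With ε = e/20 the first part of the bound is 5 · 2ε = e/2; the second part tends to 0.
  obtain ⟨δ, hδ, hsm⟩ := hsmall (e / 20) (by positivity)
  have hlim : Tendsto (fun ρ : ℝ => 5 * (2 * (e / 20) + 2 * (K + ‖a‖) * (48 * (1 - ρ) / δ ^ 2)))
      (𝓝[<] 1) (𝓝 (5 * (2 * (e / 20) + 2 * (K + ‖a‖) * (48 * (1 - 1) / δ ^ 2)))) := by
    refine (Continuous.tendsto ?_ 1).mono_left nhdsWithin_le_nhds
    fun_prop
  have hlt := hlim.eventually_lt_const (u := e) (by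
    rw [sub_self, mul_zero, zero_div, mul_zero, add_zero]; linarith)
  have hpos : ∀ᶠ ρ : ℝ in 𝓝[<] 1, 0 < ρ :=
    nhdsWithin_le_nhds (lt_mem_nhds zero_lt_one)
  filter_upwards [hlt, hpos, self_mem_nhdsWithin] with ρ h1 h2 h3
  rw [dist_eq_norm]
  exact (norm_sub_le_of_tangential hF hn hδ (by positivity) hK' hsm h2 h3).trans_lt h1

/-- **Fatou's theorem**: a bounded holomorphic function on the unit disc has radial limits almost
everywhere on the unit circle. -/
theorem IsHInf.ae_exists_tendsto_radial {f : ℂ → ℂ} (hf : IsHInf f) :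
    ∀ᵐ θ : ℝ, ∃ a, Tendsto (fun ρ : ℝ => f (ρ * circleMap 0 1 θ)) (𝓝[<] 1) (𝓝 a) := by
  obtain ⟨hd, C, hC⟩ := hf
  -- A primitive of f is Lipschitz because f is bounded. Extended to the plane it is continuous up
  -- to the circle, and its restriction to the circle is Lipschitz in θ, hence differentiable almost
  -- everywhere.
  obtain ⟨F₀, hF₀⟩ := hd.isExactOn_ball
  have hlip : LipschitzOnWith C.toNNReal F₀ (ball 0 1) :=
    (convex_ball (0 : ℂ) 1).lipschitzOnWith_of_nnnorm_hasDerivWithin_le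
      (fun z hz => (hF₀ z hz).hasDerivWithinAt) fun z hz => by
        rw [← NNReal.coe_le_coe, coe_nnnorm]
        exact (hC z hz).trans (Real.le_coe_toNNReal C)
  obtain ⟨F, hF, hFeq⟩ := hlip.extend_finite_dimension
  have hderiv : ∀ z ∈ ball (0 : ℂ) 1, HasDerivAt F (f z) z := fun z hz =>
    (hF₀ z hz).congr_of_eventuallyEq
      (Filter.eventuallyEq_of_mem (isOpen_ball.mem_nhds hz) hFeq.symm)
  have hDC : DiffContOnCl ℂ F (ball 0 1) :=
    ⟨fun z hz => (hderiv z hz).differentiableAt.differentiableWithinAt, hF.continuous.continuousOn⟩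
  have hcm : LipschitzWith 1 (circleMap 0 1) := by
    simpa using lipschitzWith_circleMap 0 1
  filter_upwards [(hF.comp hcm).ae_differentiableAt_real] with θ hθ
  obtain ⟨a, ha⟩ := tendsto_deriv_radial hDC hF hθ
  refine ⟨a, ha.congr' ?_⟩
  have hpos : ∀ᶠ ρ : ℝ in 𝓝[<] 1, 0 < ρ :=
    nhdsWithin_le_nhds (lt_mem_nhds zero_lt_one)
  filter_upwards [hpos, self_mem_nhdsWithin] with ρ h2 h3
  refine (hderiv _ ?_).deriv
  rw [mem_ball_zero_iff, norm_mul, norm_circleMap_one, mul_one, Complex.norm_real,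
    Real.norm_of_nonneg h2.le]
  exact h3

lemma IsHInf.ae_tendsto_radialLimit {f : ℂ → ℂ} (hf : IsHInf f) :
    ∀ᵐ θ : ℝ, Tendsto (fun ρ : ℝ => f (ρ * circleMap 0 1 θ)) (𝓝[<] 1)
      (𝓝 (radialLimit f (circleMap 0 1 θ))) := by
  filter_upwards [hf.ae_exists_tendsto_radial] with θ hθ
  exact tendsto_nhds_limUnder hθ

lemma IsDiscAlgebra.isHInf {f : ℂ → ℂ} (hf : IsDiscAlgebra f) : IsHInf f := by
  obtain ⟨C, hC⟩ := (isCompact_closedBall (0 : ℂ) 1).exists_bound_of_continuousOn hf.1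
  exact ⟨hf.2, C, fun z hz => hC z (ball_subset_closedBall hz)⟩

/-! ### Moments of a probability measure on the closed disc -/

section Moments

variable (ν : Measure ClosedDisc) [IsProbabilityMeasure ν]

lemma norm_closedDisc_le (w : ClosedDisc) : ‖(w : ℂ)‖ ≤ 1 := mem_closedBall_zero_iff.mp w.2

lemma integrable_of_continuous {g : ClosedDisc → ℂ} (hg : Continuous g) : Integrable g ν :=
  (BoundedContinuousFunction.mkOfCompact ⟨g, hg⟩).integrable ν

lemma hasSum_taylorCoeff_mul_moment {f : ℂ → ℂ} (hf : DifferentiableOn ℂ f (ball 0 1)) {ρ : ℝ}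
    (h0 : 0 ≤ ρ) (h1 : ρ < 1) :
    HasSum (fun n => taylorCoeff f n * (ρ : ℂ) ^ n * ∫ w : ClosedDisc, (w : ℂ) ^ n ∂ν)
      (∫ w : ClosedDisc, f (ρ * w) ∂ν) := by
  simp_rw [← integral_const_mul]
  refine hasSum_integral_of_dominated_convergence
    (fun n _ => ‖taylorCoeff f n‖ * ρ ^ n) (fun n => ?_) (fun n => ae_of_all _ fun w => ?_)
    (ae_of_all _ fun _ => summable_norm_taylorCoeff hf h0 h1) ?_ (ae_of_all _ fun w => ?_)
  · exact (Continuous.aestronglyMeasurable (by fun_prop))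
  · simp only [norm_mul, norm_pow, Complex.norm_real, Real.norm_of_nonneg h0]
    exact mul_le_of_le_one_right (by positivity)
      (pow_le_one₀ (norm_nonneg _) (norm_closedDisc_le w))
  · exact integrable_const _
  · have hz : ‖(ρ : ℂ) * w‖ < 1 := by
      rw [norm_mul, Complex.norm_real, Real.norm_of_nonneg h0]
      exact (mul_le_of_le_one_right h0 (norm_closedDisc_le w)).trans_lt h1
    simpa only [mul_pow, mul_assoc] using hasSum_taylorCoeff hf hz

lemma IsDiscAlgebra.integrable {f : ℂ → ℂ} (hf : IsDiscAlgebra f) :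
    Integrable (fun w : ClosedDisc => f w) ν :=
  integrable_of_continuous ν hf.1.domRestrict

lemma eventually_mem_Ioo_zero_one : ∀ᶠ ρ : ℝ in 𝓝[<] 1, ρ ∈ Set.Ioo (0 : ℝ) 1 :=
  Ioo_mem_nhdsLT zero_lt_one

/-- The Abel sums are ∫ f(ρw) dν, and f(ρ·) tends to f boundedly on the whole closed disc; ν may
charge the unit circle. -/
lemma IsDiscAlgebra.tendsto_tsum_moment {f : ℂ → ℂ} (hf : IsDiscAlgebra f) :
    Tendsto (fun ρ : ℝ => ∑' n, taylorCoeff f n * (ρ : ℂ) ^ n * ∫ w : ClosedDisc, (w : ℂ) ^ n ∂ν)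
      (𝓝[<] 1) (𝓝 (∫ w : ClosedDisc, f w ∂ν)) := by
  obtain ⟨C, hC⟩ := (isCompact_closedBall (0 : ℂ) 1).exists_bound_of_continuousOn hf.1
  have hmem : ∀ ρ ∈ Set.Ioo (0 : ℝ) 1, ∀ w : ClosedDisc, (ρ : ℂ) * w ∈ closedBall (0 : ℂ) 1 := by
    intro ρ hρ w
    rw [mem_closedBall_zero_iff, norm_mul, Complex.norm_real, Real.norm_of_nonneg hρ.1.le]
    exact mul_le_one₀ hρ.2.le (norm_nonneg _) (norm_closedDisc_le w)
  have key : Tendsto (fun ρ : ℝ => ∫ w : ClosedDisc, f (ρ * w) ∂ν) (𝓝[<] 1)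
      (𝓝 (∫ w : ClosedDisc, f w ∂ν)) := by
    refine tendsto_integral_filter_of_dominated_convergence (fun _ => C) ?_ ?_
      (integrable_const _) (ae_of_all _ fun w => ?_)
    · filter_upwards [eventually_mem_Ioo_zero_one] with ρ hρ
      exact (hf.1.comp_continuous (by fun_prop) (hmem ρ hρ)).aestronglyMeasurable
    · filter_upwards [eventually_mem_Ioo_zero_one] with ρ hρ
      exact ae_of_all _ fun w => hC _ (hmem ρ hρ w)
    · have h1 : Tendsto (fun ρ : ℝ => (ρ : ℂ) * w) (𝓝[<] 1) (𝓝[closedBall 0 1] (w : ℂ)) := by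
        refine tendsto_nhdsWithin_iff.mpr ⟨?_, ?_⟩
        · have : Continuous fun ρ : ℝ => (ρ : ℂ) * w := by fun_prop
          simpa using (this.tendsto 1).mono_left nhdsWithin_le_nhds
        · filter_upwards [eventually_mem_Ioo_zero_one] with ρ hρ using hmem ρ hρ w
      exact (hf.1 w w.2).tendsto.comp h1
  refine key.congr' ?_
  filter_upwards [eventually_mem_Ioo_zero_one] with ρ hρ
  exact (hasSum_taylorCoeff_mul_moment ν hf.2 hρ.1.le hρ.2).tsum_eq.symm

/-! ### Measures supported in a smaller disc -/

variable {ν} {r : ℝ}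

lemma norm_moment_le (hν : ∀ᵐ w : ClosedDisc ∂ν, ‖(w : ℂ)‖ ≤ r) (n : ℕ) :
    ‖∫ w : ClosedDisc, (w : ℂ) ^ n ∂ν‖ ≤ r ^ n := by
  have h := norm_integral_le_of_norm_le_const (μ := ν) (f := fun w : ClosedDisc => (w : ℂ) ^ n)
    (C := r ^ n) (hν.mono fun w hw => by rw [norm_pow]; gcongr)
  simpa using h

lemma norm_mul_lt_one {z : ℂ} (h0 : 0 < r) (hz : z ∈ ball (0 : ℂ) (1 / r)) : ‖z‖ * r < 1 := by
  rwa [mem_ball_zero_iff, lt_div_iff₀ h0] at hz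

/-- Expansion of the integral of a power series with argument `z w` against `ν`. -/
lemma hasSum_integral_mul_pow (hν : ∀ᵐ w : ClosedDisc ∂ν, ‖(w : ℂ)‖ ≤ r) {a : ℕ → ℂ} {g : ℂ → ℂ}
    {z : ℂ} (hz : ‖z‖ * r < 1) (ha : Summable fun n => ‖a n‖ * (‖z‖ * r) ^ n)
    (hg : ∀ u : ℂ, ‖u‖ < 1 → HasSum (fun n => a n * u ^ n) (g u)) :
    Integrable (fun w : ClosedDisc => g (z * w)) ν ∧
    HasSum (fun n => a n * z ^ n * ∫ w : ClosedDisc, (w : ℂ) ^ n ∂ν)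
      (∫ w : ClosedDisc, g (z * w) ∂ν) := by
  have hbd : ∀ᵐ w : ClosedDisc ∂ν, ∀ n, ‖a n * z ^ n * (w : ℂ) ^ n‖ ≤ ‖a n‖ * (‖z‖ * r) ^ n := by
    filter_upwards [hν] with w hw n
    rw [norm_mul, norm_mul, norm_pow, norm_pow, mul_pow, mul_assoc]
    gcongr
  have hs : ∀ᵐ w : ClosedDisc ∂ν, HasSum (fun n => a n * z ^ n * (w : ℂ) ^ n) (g (z * w)) := by
    filter_upwards [hν] with w hw
    have : ‖z * w‖ < 1 := by
      rw [norm_mul]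
      exact (mul_le_mul_of_nonneg_left hw (norm_nonneg z)).trans_lt hz
    simpa only [mul_pow, mul_assoc] using hg _ this
  have hmeas : ∀ n, AEStronglyMeasurable (fun w : ClosedDisc => a n * z ^ n * (w : ℂ) ^ n) ν :=
    fun n => Continuous.aestronglyMeasurable (by fun_prop)
  constructor
  · refine Integrable.of_bound (C := ∑' n, ‖a n‖ * (‖z‖ * r) ^ n) ?_ ?_
    · refine aestronglyMeasurable_of_tendsto_ae atTop
        (f := fun N (w : ClosedDisc) => ∑ n ∈ Finset.range N, a n * z ^ n * (w : ℂ) ^ n)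
        (fun N => Continuous.aestronglyMeasurable (by fun_prop)) ?_
      filter_upwards [hs] with w hw using hw.tendsto_sum_nat
    · filter_upwards [hs, hbd] with w hw hb
      rw [← hw.tsum_eq]
      exact tsum_of_norm_bounded ha.hasSum hb
  · simp_rw [← integral_const_mul]
    exact hasSum_integral_of_dominated_convergence (fun n _ => ‖a n‖ * (‖z‖ * r) ^ n) hmeas
      (fun n => hbd.mono fun w hw => hw n) (ae_of_all _ fun _ => ha) (integrable_const _) hs

end Moments

/-! ### Power series with geometrically decaying coefficients -/

section PowerSeries

variable {b : ℕ → ℂ} {r : ℝ}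

lemma summable_succ_mul_geometric {s : ℝ} (h0 : 0 ≤ s) (h1 : s < 1) :
    Summable fun n : ℕ => ((n : ℝ) + 1) * s ^ n := by
  have h := summable_pow_mul_geometric_of_norm_lt_one 1
    (show ‖s‖ < 1 by rwa [Real.norm_of_nonneg h0])
  have h2 := summable_geometric_of_lt_one h0 h1
  simpa only [pow_one, add_mul, one_mul] using h.add h2

lemma differentiableOn_tsum_pow (hr : 0 < r) (hb : ∀ n, ‖b n‖ ≤ r ^ n) :
    DifferentiableOn ℂ (fun z => ∑' n, b n * z ^ n) (ball 0 (1 / r)) := by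
  intro z hz
  rw [mem_ball_zero_iff] at hz
  obtain ⟨s, hzs, hs⟩ := exists_between hz
  have hs0 : 0 < s := (norm_nonneg z).trans_lt hzs
  have hrs : r * s < 1 := by
    rwa [lt_div_iff₀ hr, mul_comm] at hs
  have h := differentiableOn_tsum_of_summable_norm (F := fun n z => b n * z ^ n)
    (u := fun n => (r * s) ^ n) (U := ball 0 s)
    (summable_geometric_of_lt_one (by positivity) hrs) (fun n => by fun_prop) isOpen_ball ?_
  · exact (h.differentiableAt (isOpen_ball.mem_nhds
      (mem_ball_zero_iff.mpr hzs))).differentiableWithinAt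
  · intro n w hw
    rw [norm_mul, norm_pow, mul_pow]
    exact mul_le_mul (hb n) (pow_le_pow_left₀ (norm_nonneg w) (mem_ball_zero_iff.mp hw).le n)
      (by positivity) (by positivity)

lemma hasSum_deriv_mul_tsum_pow (hr : 0 < r) (hr1 : r < 1) (hb : ∀ n, ‖b n‖ ≤ r ^ n) {z : ℂ}
    (hz : z ∈ ball (0 : ℂ) 1) :
    HasSum (fun n : ℕ => b n * (((n : ℂ) + 1) * z ^ n))
      (deriv (fun w => w * ∑' n, b n * w ^ n) z) := by
  have h := hasSum_deriv_of_summable_norm (F := fun n z => b n * z ^ (n + 1)) (u := fun n => r ^ n)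
    (U := ball 0 1) (summable_geometric_of_lt_one hr.le hr1) (fun n => by fun_prop) isOpen_ball
    (fun n w hw => ?_) hz
  · have h1 : (fun w => w * ∑' n, b n * w ^ n) = fun w => ∑' n, b n * w ^ (n + 1) := by
      ext w
      rw [← tsum_mul_left]
      exact tsum_congr fun n => by ring
    rw [h1]
    refine h.congr_fun fun n => ?_
    simp
  · rw [norm_mul, norm_pow]
    exact (mul_le_of_le_one_right (norm_nonneg _)
      (pow_le_one₀ (norm_nonneg w) (mem_ball_zero_iff.mp hw).le)).trans (hb n)

end PowerSeries

/-! ### The density attached to a conjugate holomorphic boundary function -/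

section Density

variable {ψ : ℂ → ℂ}

/-- The Poisson kernel is real, so conjugation passes through Poisson's formula for ψ. -/
lemma poissonIntegral_conj (hψ : DiffContOnCl ℂ ψ (ball 0 1)) {z : ℂ} (hz : z ∈ ball (0 : ℂ) 1) :
    poissonIntegral (fun ζ => conj (ψ ζ)) z = conj (ψ z) := by
  have h1 := hψ.circleAverage_poissonKernel_smul hz
  have hz' : ‖z‖ < 1 := mem_ball_zero_iff.mp hz
  have hc : ContinuousOn (poissonKernel 0 z • ψ) (sphere 0 1) := by
    refine ContinuousOn.smul ?_ (hψ.continuousOn_ball.mono sphere_subset_closedBall)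
    change ContinuousOn (fun w => (‖w - 0‖ ^ 2 - ‖z - 0‖ ^ 2) / ‖(w - 0) - (z - 0)‖ ^ 2) _
    simp only [sub_zero]
    refine ContinuousOn.div (by fun_prop) (by fun_prop) fun w hw h0 => ?_
    rw [pow_eq_zero_iff two_ne_zero, norm_eq_zero, sub_eq_zero] at h0
    rw [h0, mem_sphere_zero_iff_norm] at hw
    exact hz'.ne hw
  have h2 := Complex.conjCLE.toContinuousLinearMap.circleAverage_comp_comm
    (hc.circleIntegrable zero_le_one)
  rw [h1] at h2
  refine Eq.trans ?_ h2
  rw [poissonIntegral]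
  congr 1
  ext ζ
  simp

/-- ∂_x + i ∂_y = 2 ∂̄ sends the conjugate of the holomorphic function h(w) = w ψ(w) to 2 conj(h'),
and the factor 2 turns 1/2π into 1/π. -/
lemma discDensity_conj (hψ : DiffContOnCl ℂ ψ (ball 0 1)) {z : ℂ} (hz : z ∈ ball (0 : ℂ) 1) :
    discDensity (fun ζ => conj (ψ ζ)) z =
      (1 / (Real.pi : ℂ)) * conj (deriv (fun w => w * ψ w) z) := by
  have hd : HasDerivAt (fun w => w * ψ w) (deriv (fun w => w * ψ w) z) z :=
    (differentiableAt_id.mul (hψ.differentiableAt isOpen_ball hz)).hasDerivAt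
  set D := deriv (fun w => w * ψ w) z with hD
  have hev : (fun w : ℂ => conj w * poissonIntegral (fun ζ => conj (ψ ζ)) w) =ᶠ[𝓝 z]
      fun w => conj (w * ψ w) := by
    filter_upwards [isOpen_ball.mem_nhds hz] with w hw
    rw [poissonIntegral_conj hψ hw, map_mul]
  have hf : HasFDerivAt (𝕜 := ℝ) (fun w => conj (w * ψ w))
      (Complex.conjCLE.toContinuousLinearMap ∘L
        (ContinuousLinearMap.toSpanSingleton ℂ D).restrictScalars ℝ) z :=
    Complex.conjCLE.toContinuousLinearMap.hasFDerivAt.comp z (hd.hasFDerivAt.restrictScalars ℝ)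
  rw [discDensity, hev.fderiv_eq, hf.fderiv]
  simp only [ContinuousLinearMap.comp_apply, ContinuousLinearMap.coe_restrictScalars',
    ContinuousLinearMap.toSpanSingleton_apply, ContinuousLinearEquiv.coe_coe, conjCLE_apply,
    smul_eq_mul, map_mul, conj_I, one_mul]
  have hπ : (Real.pi : ℂ) ≠ 0 := ofReal_ne_zero.mpr Real.pi_ne_zero
  field_simp
  linear_combination -(conj D) * I_sq

lemma harmonicOnNhd_discDensity_conj (hψ : DiffContOnCl ℂ ψ (ball 0 1)) :
    InnerProductSpace.HarmonicOnNhd (discDensity fun ζ => conj (ψ ζ)) (ball 0 1) := by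
  intro z hz
  have hev : (discDensity fun ζ => conj (ψ ζ)) =ᶠ[𝓝 z]
      conj (fun w => (1 / (Real.pi : ℂ)) * deriv (fun w => w * ψ w) w) := by
    filter_upwards [isOpen_ball.mem_nhds hz] with w hw
    rw [discDensity_conj hψ hw]
    simp
  rw [InnerProductSpace.harmonicAt_congr_nhds hev]
  refine AnalyticAt.harmonicAt_conj (analyticAt_const.mul (AnalyticAt.deriv ?_))
  exact (differentiableOn_id.mul hψ.1).analyticAt (isOpen_ball.mem_nhds hz)

end Density

/-! ### Polar coordinates on the unit disc -/

lemma integral_ball_eq_integral_circleAverage {u : ℂ → ℂ} (hu : ContinuousOn u (ball 0 1)) {C : ℝ}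
    (hC : ∀ z ∈ ball (0 : ℂ) 1, ‖u z‖ ≤ C) :
    ∫ z in ball (0 : ℂ) 1, u z =
      ∫ ρ in Set.Ioo (0 : ℝ) 1, (2 * Real.pi * ρ : ℂ) *
        Real.circleAverage (fun ζ => u (ρ * ζ)) 0 1 := by
  have hsymm : ∀ p : ℝ × ℝ, Complex.polarCoord.symm p = p.1 * circleMap 0 1 p.2 := by
    intro p
    rw [Complex.polarCoord_symm_apply, circleMap, exp_mul_I]
    simp
  have hnorm : ∀ ρ ∈ Set.Ioo (0 : ℝ) 1, ∀ θ : ℝ, (ρ : ℂ) * circleMap 0 1 θ ∈ ball (0 : ℂ) 1 := by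
    intro ρ hρ θ
    rw [mem_ball_zero_iff, norm_mul, norm_circleMap_one, mul_one, Complex.norm_real,
      Real.norm_of_nonneg hρ.1.le]
    exact hρ.2
  rw [← integral_indicator measurableSet_ball, ← Complex.integral_comp_polarCoord_symm]
  have h1 : ∀ p ∈ polarCoord.target, p.1 • (ball (0 : ℂ) 1).indicator u (Complex.polarCoord.symm p)
      = (Set.Iio (1 : ℝ) ×ˢ (Set.univ : Set ℝ)).indicator
        (fun p : ℝ × ℝ => (p.1 : ℂ) * u (p.1 * circleMap 0 1 p.2)) p := by
    intro p hp
    have hp0 : 0 < p.1 := hp.1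
    have hn : ‖(p.1 : ℂ) * circleMap 0 1 p.2‖ = p.1 := by
      rw [norm_mul, norm_circleMap_one, mul_one, Complex.norm_real, Real.norm_of_nonneg hp0.le]
    rw [hsymm, Complex.real_smul]
    by_cases h : p.1 < 1
    · rw [Set.indicator_of_mem (by rw [mem_ball_zero_iff, hn]; exact h),
        Set.indicator_of_mem (Set.mem_prod.mpr ⟨h, Set.mem_univ _⟩)]
    · rw [Set.indicator_of_notMem (by rw [mem_ball_zero_iff, hn]; exact h),
        Set.indicator_of_notMem (fun h' => h h'.1), mul_zero]
  rw [setIntegral_congr_fun polarCoord.open_target.measurableSet h1,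
    setIntegral_indicator (measurableSet_Iio.prod MeasurableSet.univ)]
  have h2 : polarCoord.target ∩ Set.Iio (1 : ℝ) ×ˢ (Set.univ : Set ℝ) =
      Set.Ioo (0 : ℝ) 1 ×ˢ Set.Ioo (-Real.pi) Real.pi := by
    ext p
    simp only [polarCoord_target, Set.mem_inter_iff, Set.mem_prod, Set.mem_Ioi, Set.mem_Ioo,
      Set.mem_Iio, Set.mem_univ, and_true]
    tauto
  have hint : IntegrableOn (fun p : ℝ × ℝ => (p.1 : ℂ) * u (p.1 * circleMap 0 1 p.2))
      (Set.Ioo (0 : ℝ) 1 ×ˢ Set.Ioo (-Real.pi) Real.pi) (volume.prod volume) := by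
    have hms := (measurableSet_Ioo (a := (0 : ℝ)) (b := 1)).prod
      (measurableSet_Ioo (a := -Real.pi) (b := Real.pi))
    refine IntegrableOn.of_bound (C := 1 * C) ?_ ?_ ?_
    · rw [Measure.prod_prod]
      exact ENNReal.mul_lt_top (by simp) (by simp)
    · refine ContinuousOn.aestronglyMeasurable ?_ hms
      refine ContinuousOn.mul (by fun_prop) (hu.comp (by fun_prop) ?_)
      exact fun p hp => hnorm p.1 hp.1 p.2
    · refine (ae_restrict_iff' hms).mpr (ae_of_all _ fun p hp => ?_)
      rw [norm_mul, Complex.norm_real, Real.norm_of_nonneg hp.1.1.le]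
      exact mul_le_mul hp.1.2.le (hC _ (hnorm p.1 hp.1 p.2)) (norm_nonneg _) zero_le_one
  rw [h2, Measure.volume_eq_prod, setIntegral_prod _ hint]
  refine setIntegral_congr_fun measurableSet_Ioo fun ρ _ => ?_
  simp only
  rw [integral_const_mul, ← integral_Ioc_eq_integral_Ioo,
    ← intervalIntegral.integral_of_le (by linarith [Real.pi_pos]), circleAverage_eq_integral]
  have hper : Function.Periodic (fun θ => u (ρ * circleMap 0 1 θ)) (2 * Real.pi) := fun θ => by
    simp only [periodic_circleMap 0 1 θ]
  have h3 := hper.intervalIntegral_add_eq (-Real.pi) 0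
  rw [zero_add, show -Real.pi + 2 * Real.pi = Real.pi by ring] at h3
  rw [h3, Complex.real_smul]
  have hπ : (Real.pi : ℂ) ≠ 0 := ofReal_ne_zero.mpr Real.pi_ne_zero
  push_cast
  field_simp

/-! ### Pairings with densities on the circle and on the disc -/

section Representation

variable {f : ℂ → ℂ} {M : ℕ → ℂ} {r : ℝ}

lemma summable_norm_of_le_pow (hr : 0 ≤ r) (hr1 : r < 1) (hM : ∀ n, ‖M n‖ ≤ r ^ n) :
    Summable fun n => ‖M n‖ :=
  Summable.of_nonneg_of_le (fun _ => norm_nonneg _) hM (summable_geometric_of_lt_one hr hr1)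

lemma IsHInf.exists_norm_taylorCoeff_le (hf : IsHInf f) : ∃ C, ∀ n, ‖taylorCoeff f n‖ ≤ C := by
  obtain ⟨B, hB⟩ := hf.exists_isBoundedSeries
  have h := hB.summable_sq
  refine ⟨Real.sqrt (∑' n, ‖taylorCoeff f n‖ ^ 2), fun n => Real.le_sqrt_of_sq_le ?_⟩
  exact h.le_tsum n fun _ _ => by positivity

/-- Bounded Taylor coefficients against geometrically small M_n: the Abel limit is an ordinary sum.
-/
lemma IsHInf.tendsto_tsum_taylorCoeff_mul (hf : IsHInf f) (hr : 0 ≤ r) (hr1 : r < 1)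
    (hM : ∀ n, ‖M n‖ ≤ r ^ n) :
    Tendsto (fun ρ : ℝ => ∑' n, taylorCoeff f n * (ρ : ℂ) ^ n * M n) (𝓝[<] 1)
      (𝓝 (∑' n, taylorCoeff f n * M n)) := by
  obtain ⟨C, hC⟩ := hf.exists_norm_taylorCoeff_le
  have hC0 : 0 ≤ C := (norm_nonneg _).trans (hC 0)
  refine tendsto_tsum_of_dominated_convergence (bound := fun n => C * r ^ n)
    ((summable_geometric_of_lt_one hr hr1).mul_left C) (fun n => ?_) ?_
  · have : Continuous fun ρ : ℝ => taylorCoeff f n * (ρ : ℂ) ^ n * M n := by fun_prop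
    simpa using (this.tendsto 1).mono_left nhdsWithin_le_nhds
  · filter_upwards [eventually_mem_Ioo_zero_one] with ρ hρ n
    rw [norm_mul, norm_mul, norm_pow, Complex.norm_real, Real.norm_of_nonneg hρ.1.le]
    refine mul_le_mul ?_ (hM n) (norm_nonneg _) hC0
    exact (mul_le_of_le_one_right (norm_nonneg _) (pow_le_one₀ hρ.1.le hρ.2.le)).trans (hC n)

lemma circleAverage_mul_tsum_conj_pow (hf : DifferentiableOn ℂ f (ball 0 1))
    (hM : Summable fun n => ‖M n‖) {ρ : ℝ} (hρ : ρ ∈ Set.Ioo (0 : ℝ) 1) :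
    HasSum (fun n => taylorCoeff f n * (ρ : ℂ) ^ n * M n)
      (Real.circleAverage (fun ζ => f (ρ * ζ) * ∑' n, M n * conj ζ ^ n) 0 1) := by
  have h := hasSum_circleAverage_mul_conj (a := fun n => taylorCoeff f n * (ρ : ℂ) ^ n) (b := M)
    (by simpa [abs_of_pos hρ.1] using summable_norm_taylorCoeff hf hρ.1.le hρ.2) hM
  convert h using 1
  refine Real.circleAverage_congr_sphere fun ζ hζ => ?_
  have hn : ‖(ρ : ℂ) * ζ‖ < 1 := by
    rw [abs_one, mem_sphere_zero_iff_norm] at hζ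
    rw [norm_mul, hζ, mul_one, Complex.norm_real, Real.norm_of_nonneg hρ.1.le]
    exact hρ.2
  simp only [← (hasSum_taylorCoeff hf hn).tsum_eq, mul_pow, mul_assoc]

/-- Pairing of the boundary values of `f ∈ H^∞` with an antiholomorphic function. -/
lemma IsHInf.circleAverage_radialLimit_mul (hf : IsHInf f) (hr : 0 ≤ r) (hr1 : r < 1)
    (hM : ∀ n, ‖M n‖ ≤ r ^ n) :
    CircleIntegrable (fun ζ => radialLimit f ζ * ∑' n, M n * conj ζ ^ n) 0 1 ∧
    Tendsto (fun ρ : ℝ => ∑' n, taylorCoeff f n * (ρ : ℂ) ^ n * M n) (𝓝[<] 1)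
      (𝓝 (Real.circleAverage (fun ζ => radialLimit f ζ * ∑' n, M n * conj ζ ^ n) 0 1)) := by
  have hsM : Summable fun n => ‖M n‖ := summable_norm_of_le_pow hr hr1 hM
  obtain ⟨hd, C, hC⟩ := id hf
  have hC0 : 0 ≤ C := (norm_nonneg _).trans (hC 0 (by simp))
  set q : ℝ → ℂ := fun θ => ∑' n, M n * conj (circleMap 0 1 θ) ^ n with hq
  have hqc : Continuous q := by
    refine continuous_tsum (fun n => ?_) hsM fun n θ => ?_
    · exact continuous_const.mul ((Complex.continuous_conj.comp (continuous_circleMap 0 1)).pow n)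
    · simp
  have hqb : ∀ θ, ‖q θ‖ ≤ ∑' n, ‖M n‖ := fun θ =>
    tsum_of_norm_bounded hsM.hasSum fun n => by simp
  have hmem : ∀ ρ ∈ Set.Ioo (0 : ℝ) 1, ∀ θ : ℝ, (ρ : ℂ) * circleMap 0 1 θ ∈ ball (0 : ℂ) 1 := by
    intro ρ hρ θ
    rw [mem_ball_zero_iff, norm_mul, norm_circleMap_one, mul_one, Complex.norm_real,
      Real.norm_of_nonneg hρ.1.le]
    exact hρ.2
  have hlim := hf.ae_tendsto_radialLimit
  have hmeas : ∀ ρ ∈ Set.Ioo (0 : ℝ) 1, Continuous fun θ => f (ρ * circleMap 0 1 θ) := fun ρ hρ =>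
    hd.continuousOn.comp_continuous (by fun_prop) (hmem ρ hρ)
  set C' := C * ∑' n, ‖M n‖ with hC'
  have hbd : ∀ ρ ∈ Set.Ioo (0 : ℝ) 1, ∀ θ, ‖f (ρ * circleMap 0 1 θ) * q θ‖ ≤ C' := by
    intro ρ hρ θ
    rw [norm_mul]
    exact mul_le_mul (hC _ (hmem ρ hρ θ)) (hqb θ) (norm_nonneg _) hC0
  have hrm : AEStronglyMeasurable (fun θ => radialLimit f (circleMap 0 1 θ) * q θ) volume := by
    refine AEStronglyMeasurable.mul ?_ hqc.aestronglyMeasurable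
    -- Along a sequence of radii the boundary function is an almost everywhere limit of continuous
    -- functions, hence measurable. The offset 2 keeps the radius positive at n = 0.
    have hseq : Tendsto (fun n : ℕ => 1 - 1 / ((n : ℝ) + 2)) atTop (𝓝[<] 1) := by
      refine tendsto_nhdsWithin_iff.mpr ⟨?_, Eventually.of_forall fun n => ?_⟩
      · have := (tendsto_one_div_add_atTop_nhds_zero_nat (𝕜 := ℝ)).comp (tendsto_add_atTop_nat 1)
        have h2 := this.const_sub 1
        rw [sub_zero] at h2
        refine h2.congr fun n => ?_
        simp only [Function.comp_apply]
        push_cast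
        ring
      · simp only [Set.mem_Iio, sub_lt_self_iff]
        positivity
    refine aestronglyMeasurable_of_tendsto_ae atTop
      (f := fun (n : ℕ) θ => f (((1 - 1 / ((n : ℝ) + 2) : ℝ) : ℂ) * circleMap 0 1 θ))
      (fun n => (hmeas _ ⟨?_, ?_⟩).aestronglyMeasurable) ?_
    · rw [sub_pos, div_lt_one (by positivity)]
      have : (0 : ℝ) ≤ n := n.cast_nonneg
      linarith
    · simp only [sub_lt_self_iff]
      positivity
    · filter_upwards [hlim] with θ hθ using hθ.comp hseq
  have hprod : ∀ᵐ θ : ℝ, Tendsto (fun ρ : ℝ => f (ρ * circleMap 0 1 θ) * q θ) (𝓝[<] 1)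
      (𝓝 (radialLimit f (circleMap 0 1 θ) * q θ)) := by
    filter_upwards [hlim] with θ hθ using hθ.mul_const _
  constructor
  · rw [CircleIntegrable, intervalIntegrable_iff]
    refine Measure.integrableOn_of_bounded (M := C') (by
      rw [Set.uIoc_of_le (by positivity)]; exact measure_Ioc_lt_top.ne) hrm
      (ae_restrict_of_ae ?_)
    filter_upwards [hprod] with θ hθ
    refine le_of_tendsto hθ.norm ?_
    filter_upwards [eventually_mem_Ioo_zero_one] with ρ hρ using hbd ρ hρ θ
  · have h : Tendsto (fun ρ : ℝ => Real.circleAverage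
        (fun ζ => f (ρ * ζ) * ∑' n, M n * conj ζ ^ n) 0 1) (𝓝[<] 1)
        (𝓝 (Real.circleAverage (fun ζ => radialLimit f ζ * ∑' n, M n * conj ζ ^ n) 0 1)) := by
      simp only [circleAverage_eq_integral]
      refine Tendsto.const_smul ?_ _
      refine intervalIntegral.tendsto_integral_filter_of_dominated_convergence (fun _ => C') ?_ ?_
        (by simp) (hprod.mono fun θ hθ _ => hθ)
      · filter_upwards [eventually_mem_Ioo_zero_one] with ρ hρ
        exact ((hmeas ρ hρ).mul hqc).aestronglyMeasurable
      · filter_upwards [eventually_mem_Ioo_zero_one] with ρ hρ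
        exact ae_of_all _ fun θ _ => hbd ρ hρ θ
    refine h.congr' ?_
    filter_upwards [eventually_mem_Ioo_zero_one] with ρ hρ
    exact (circleAverage_mul_tsum_conj_pow hd hsM hρ).tsum_eq.symm

/-- Pairing of `f` on the disc with an antiholomorphic density. -/
lemma IsHInf.integral_ball_mul (hf : IsHInf f) (hr : 0 < r) (hr1 : r < 1)
    (hM : ∀ n, ‖M n‖ ≤ r ^ n) {g : ℂ → ℂ}
    (hg : ∀ z ∈ ball (0 : ℂ) 1, g z = (1 / (Real.pi : ℂ)) *
      ∑' n : ℕ, M n * (((n : ℂ) + 1) * conj z ^ n)) :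
    IntegrableOn (fun z => f z * g z) (ball 0 1) ∧
    ∫ z in ball (0 : ℂ) 1, f z * g z = ∑' n, taylorCoeff f n * M n := by
  obtain ⟨hd, C, hC⟩ := id hf
  have hC0 : 0 ≤ C := (norm_nonneg _).trans (hC 0 (by simp))
  have hsum := summable_succ_mul_geometric hr.le hr1
  have hterm : ∀ n : ℕ, ∀ z : ℂ, ‖z‖ ≤ 1 →
      ‖M n * (((n : ℂ) + 1) * conj z ^ n)‖ ≤ ((n : ℝ) + 1) * r ^ n := by
    intro n z hz
    have h1 : ‖(n : ℂ) + 1‖ = (n : ℝ) + 1 := by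
      rw [← Nat.cast_succ, Complex.norm_natCast, Nat.cast_succ]
    rw [norm_mul, norm_mul, norm_pow, RCLike.norm_conj, h1, mul_comm]
    refine mul_le_mul ?_ (hM n) (norm_nonneg _) (by positivity)
    exact mul_le_of_le_one_right (by positivity) (pow_le_one₀ (norm_nonneg _) hz)
  set C₁ := ∑' n : ℕ, ((n : ℝ) + 1) * r ^ n with hC₁
  have hgc : ContinuousOn g (ball 0 1) := by
    refine ContinuousOn.congr (f := fun z => (1 / (Real.pi : ℂ)) *
      ∑' n : ℕ, M n * (((n : ℂ) + 1) * conj z ^ n)) ?_ hg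
    refine continuousOn_const.mul (continuousOn_tsum (fun n => ?_) hsum
      fun n z hz => hterm n z (mem_ball_zero_iff.mp hz).le)
    exact Continuous.continuousOn (by fun_prop)
  have hgb : ∀ z ∈ ball (0 : ℂ) 1, ‖g z‖ ≤ 1 / Real.pi * C₁ := by
    intro z hz
    rw [hg z hz, norm_mul, norm_div, norm_one, Complex.norm_real, Real.norm_of_nonneg Real.pi_nonneg]
    refine mul_le_mul_of_nonneg_left ?_ (by positivity)
    exact tsum_of_norm_bounded hsum.hasSum fun n => hterm n z (mem_ball_zero_iff.mp hz).le
  have hcont : ContinuousOn (fun z => f z * g z) (ball 0 1) := hd.continuousOn.mul hgc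
  have hb : ∀ z ∈ ball (0 : ℂ) 1, ‖f z * g z‖ ≤ C * (1 / Real.pi * C₁) := fun z hz => by
    rw [norm_mul]
    exact mul_le_mul (hC z hz) (hgb z hz) (norm_nonneg _) hC0
  refine ⟨IntegrableOn.of_bound (C := C * (1 / Real.pi * C₁)) measure_ball_lt_top
    (hcont.aestronglyMeasurable measurableSet_ball)
    ((ae_restrict_iff' measurableSet_ball).mpr (ae_of_all _ hb)), ?_⟩
  rw [integral_ball_eq_integral_circleAverage hcont hb]
  obtain ⟨C₂, hC₂⟩ := hf.exists_norm_taylorCoeff_le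
  have hC₂0 : 0 ≤ C₂ := (norm_nonneg _).trans (hC₂ 0)
  have hπ : (Real.pi : ℂ) ≠ 0 := ofReal_ne_zero.mpr Real.pi_ne_zero
  -- The angular integral leaves the weight 2(n+1) ρ^{2n+1}, whose integral over (0, 1) is 1: the
  -- factor n + 1 in the density normalises z^n on the disc.
  have hcirc : ∀ ρ ∈ Set.Ioo (0 : ℝ) 1, HasSum (fun n : ℕ => taylorCoeff f n * M n *
      (((2 * (n + 1) * ρ ^ (2 * n + 1) : ℝ)) : ℂ))
      ((2 * Real.pi * ρ : ℂ) * Real.circleAverage (fun ζ => f (ρ * ζ) * g (ρ * ζ)) 0 1) := by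
    intro ρ hρ
    have hs : Summable fun n : ℕ => ‖M n * (((n : ℂ) + 1) * (ρ : ℂ) ^ n)‖ := by
      refine Summable.of_nonneg_of_le (fun _ => norm_nonneg _) (fun n => ?_) hsum
      have := hterm n ρ (by rw [Complex.norm_real, Real.norm_of_nonneg hρ.1.le]; exact hρ.2.le)
      rwa [conj_ofReal] at this
    have h := (circleAverage_mul_tsum_conj_pow hd hs hρ).mul_left (2 * (ρ : ℂ))
    have h2 : Real.circleAverage (fun ζ => f (ρ * ζ) * g (ρ * ζ)) 0 1 =
        Real.circleAverage (fun ζ => (1 / (Real.pi : ℂ)) • (f (ρ * ζ) *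
          ∑' n : ℕ, M n * (((n : ℂ) + 1) * (ρ : ℂ) ^ n) * conj ζ ^ n)) 0 1 := by
      refine Real.circleAverage_congr_sphere fun ζ hζ => ?_
      have hn : (ρ : ℂ) * ζ ∈ ball (0 : ℂ) 1 := by
        rw [abs_one, mem_sphere_zero_iff_norm] at hζ
        rw [mem_ball_zero_iff, norm_mul, hζ, mul_one, Complex.norm_real,
          Real.norm_of_nonneg hρ.1.le]
        exact hρ.2
      rw [hg _ hn, smul_eq_mul]
      simp only [map_mul, conj_ofReal, mul_pow]
      have : ∀ n : ℕ, M n * (((n : ℂ) + 1) * ((ρ : ℂ) ^ n * conj ζ ^ n)) =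
        M n * (((n : ℂ) + 1) * (ρ : ℂ) ^ n) * conj ζ ^ n := fun n => by ring
      simp only [this]
      ring
    have h3 : (2 * Real.pi * ρ : ℂ) * Real.circleAverage (fun ζ => f (ρ * ζ) * g (ρ * ζ)) 0 1 =
        2 * ρ * Real.circleAverage (fun ζ => f (ρ * ζ) *
          ∑' n : ℕ, M n * (((n : ℂ) + 1) * (ρ : ℂ) ^ n) * conj ζ ^ n) 0 1 := by
      rw [h2, Real.circleAverage_fun_smul, smul_eq_mul]
      field_simp
    rw [h3]
    refine h.congr_fun fun n => ?_
    push_cast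
    ring
  have hmono : ∀ n : ℕ, ∀ ρ ∈ Set.Ioo (0 : ℝ) 1,
      ‖taylorCoeff f n * M n * (((2 * (n + 1) * ρ ^ (2 * n + 1) : ℝ)) : ℂ)‖ ≤
        C₂ * 2 * (((n : ℝ) + 1) * r ^ n) := by
    intro n ρ hρ
    have h0 : 0 ≤ ρ := hρ.1.le
    rw [norm_mul, norm_mul, Complex.norm_real, Real.norm_of_nonneg (by positivity)]
    calc _ ≤ C₂ * r ^ n * (2 * (n + 1) * 1) := by
          gcongr
          · exact hC₂ n
          · exact hM n
          · exact pow_le_one₀ h0 hρ.2.le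
      _ = _ := by ring
  have hfin := hasSum_integral_of_dominated_convergence (μ := volume.restrict (Set.Ioo (0 : ℝ) 1))
    (F := fun (n : ℕ) (ρ : ℝ) => taylorCoeff f n * M n *
      (((2 * (n + 1) * ρ ^ (2 * n + 1) : ℝ)) : ℂ))
    (fun n _ => C₂ * 2 * (((n : ℝ) + 1) * r ^ n))
    (fun n => (Continuous.aestronglyMeasurable (by fun_prop)))
    (fun n => (ae_restrict_iff' measurableSet_Ioo).mpr (ae_of_all _ (hmono n)))
    (ae_of_all _ fun _ => hsum.mul_left _) (integrable_const _)
    ((ae_restrict_iff' measurableSet_Ioo).mpr (ae_of_all _ hcirc))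
  rw [← hfin.tsum_eq]
  refine tsum_congr fun n => ?_
  rw [integral_const_mul, integral_complex_ofReal, ← integral_Ioc_eq_integral_Ioo,
    ← intervalIntegral.integral_of_le zero_le_one, intervalIntegral.integral_const_mul,
    integral_pow]
  have h1 : (2 * ((n : ℝ) + 1)) * ((1 ^ (2 * n + 1 + 1) - 0 ^ (2 * n + 1 + 1)) /
      (((2 * n + 1 : ℕ) : ℝ) + 1)) = 1 := by
    rw [one_pow, zero_pow (by omega), sub_zero, mul_one_div, div_eq_one_iff_eq (by positivity)]
    push_cast
    ring
  rw [h1, ofReal_one, mul_one]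

end Representation

/-! ### The Borel transform and its squared kernel -/

section BorelTransform

variable {ν : Measure ClosedDisc} [IsProbabilityMeasure ν] {r : ℝ}

lemma hasSum_geometric_one_div {u : ℂ} (hu : ‖u‖ < 1) :
    HasSum (fun n => (1 : ℂ) * u ^ n) (1 / (1 - u)) := by
  simpa using hasSum_geometric_of_norm_lt_one hu

lemma hasSum_succ_mul_geometric_one_div {u : ℂ} (hu : ‖u‖ < 1) :
    HasSum (fun n : ℕ => ((n : ℂ) + 1) * u ^ n) (1 / (1 - u) ^ 2) := by
  have h := hasSum_choose_mul_geometric_of_norm_lt_one 1 hu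
  simpa [Nat.choose_one_right] using h

/-- The geometric series at conj z yields the moments of w; conjugating it yields the kernel in z
conj(w). -/
lemma integrable_borelKernel (hr : 0 < r) (hν : ∀ᵐ w : ClosedDisc ∂ν, ‖(w : ℂ)‖ ≤ r) {z : ℂ}
    (hz : z ∈ ball (0 : ℂ) (1 / r)) :
    Integrable (fun w : ClosedDisc => 1 / (1 - z * conj (w : ℂ))) ν ∧
    ∑' n, conj (∫ w : ClosedDisc, (w : ℂ) ^ n ∂ν) * z ^ n =
      ∫ w : ClosedDisc, 1 / (1 - z * conj (w : ℂ)) ∂ν := by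
  have hz1 : ‖conj z‖ * r < 1 := by
    rw [RCLike.norm_conj]
    exact norm_mul_lt_one hr hz
  obtain ⟨h1, h2⟩ := hasSum_integral_mul_pow hν (a := fun _ => 1) (g := fun u => 1 / (1 - u)) hz1
    (by simpa using summable_geometric_of_lt_one (by positivity) hz1)
    fun u hu => hasSum_geometric_one_div hu
  have hconj : ∀ w : ClosedDisc, conj (1 / (1 - conj z * (w : ℂ))) =
      1 / (1 - z * conj (w : ℂ)) := fun w => by simp
  constructor
  · have := Complex.conjCLE.toContinuousLinearMap.integrable_comp h1
    exact this.congr (ae_of_all _ hconj)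
  · have h3 : ∫ w : ClosedDisc, 1 / (1 - z * conj (w : ℂ)) ∂ν =
        conj (∫ w : ClosedDisc, 1 / (1 - conj z * (w : ℂ)) ∂ν) := by
      rw [← integral_conj]
      simp only [hconj]
    rw [h3, ← h2.tsum_eq, conj_tsum]
    refine tsum_congr fun n => ?_
    simp [mul_comm]

lemma integrable_borelKernel_sq (hr : 0 < r) (hr1 : r < 1)
    (hν : ∀ᵐ w : ClosedDisc ∂ν, ‖(w : ℂ)‖ ≤ r) {z : ℂ} (hz : z ∈ ball (0 : ℂ) 1) :
    Integrable (fun w : ClosedDisc => 1 / (1 - conj z * (w : ℂ)) ^ 2) ν ∧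
    ∑' n : ℕ, (∫ w : ClosedDisc, (w : ℂ) ^ n ∂ν) * (((n : ℂ) + 1) * conj z ^ n) =
      ∫ w : ClosedDisc, 1 / (1 - conj z * (w : ℂ)) ^ 2 ∂ν := by
  have hz1 : ‖conj z‖ * r < 1 := by
    rw [RCLike.norm_conj]
    exact mul_lt_one_of_nonneg_of_lt_one_left (norm_nonneg z) (mem_ball_zero_iff.mp hz) hr1.le
  have hn : ∀ n : ℕ, ‖(n : ℂ) + 1‖ = (n : ℝ) + 1 := fun n => by
    rw [← Nat.cast_succ, Complex.norm_natCast, Nat.cast_succ]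
  obtain ⟨h1, h2⟩ := hasSum_integral_mul_pow hν (a := fun n : ℕ => (n : ℂ) + 1)
    (g := fun u => 1 / (1 - u) ^ 2) hz1
    (by simpa only [hn] using summable_succ_mul_geometric (by positivity) hz1)
    fun u hu => hasSum_succ_mul_geometric_one_div hu
  refine ⟨h1, ?_⟩
  rw [← h2.tsum_eq]
  exact tsum_congr fun n => by ring

lemma closedBall_subset_ball_one_div (hr : 0 < r) (hr1 : r < 1) :
    closedBall (0 : ℂ) 1 ⊆ ball 0 (1 / r) :=
  closedBall_subset_ball ((one_lt_div hr).mpr hr1)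

end BorelTransform

/-! ### Support of the limiting measures -/

section Support

variable {d : ℕ} {X : Set ℝ} {μ : Measure X} [IsProbabilityMeasure μ] {γ : Fin d → Lattice d}

/-- The continuous function max(|w| - r, 0) vanishes at every eigenvalue, so its limiting integral
is 0, and it is positive exactly where |w| > r. -/
lemma ae_norm_le_of_tendsto {A : ∀ n : ℕ, boxSpace (box γ n) →L[ℂ] boxSpace (box γ n)}
    (hA : ∀ n, ‖A n‖ ≤ 1) {ν : Measure ClosedDisc} [IsProbabilityMeasure ν]
    (h : ∀ f : C(ClosedDisc, ℂ),
      Tendsto (fun n : ℕ => ∫ w, f w ∂(countingMeasure (A n))) atTop (𝓝 (∫ w, f w ∂ν)))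
    {r : ℝ} (hr : 0 ≤ r) (hspr : ∀ n, spectralRadius ℂ (A n) ≤ ENNReal.ofReal r) :
    ∀ᵐ w : ClosedDisc ∂ν, ‖(w : ℂ)‖ ≤ r := by
  set g : ℂ → ℝ := fun w => max (‖w‖ - r) 0 with hg
  have hgc : Continuous g := by fun_prop
  have h1 := h ⟨fun w => (g w : ℂ), by fun_prop⟩
  have h0 : ∀ n : ℕ, ∫ w : ClosedDisc, ((g w : ℝ) : ℂ) ∂(countingMeasure (A n)) = 0 := fun n => by
    rw [integral_countingMeasure (hA n) fun w => (g w : ℂ)]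
    have hz : ((A n : boxSpace (box γ n) →ₗ[ℂ] boxSpace (box γ n)).charpoly.roots.map
        fun w => (g w : ℂ)).sum = 0 := by
      refine Multiset.sum_eq_zero fun x hx => ?_
      obtain ⟨a, ha, rfl⟩ := Multiset.mem_map.mp hx
      have := norm_le_of_spectralRadius_le hr (hspr n) ha
      rw [hg]
      simp [max_eq_right (sub_nonpos.mpr this)]
    rw [hz, mul_zero]
  simp only [ContinuousMap.coe_mk, h0] at h1
  have h2 : ∫ w : ClosedDisc, g w ∂ν = 0 := by
    have := tendsto_nhds_unique h1 tendsto_const_nhds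
    rw [integral_complex_ofReal] at this
    exact_mod_cast this
  have hint : Integrable (fun w : ClosedDisc => g w) ν := by
    have := (integrable_of_continuous ν (g := fun w : ClosedDisc => (g w : ℂ)) (by fun_prop)).re
    simpa using this
  have h3 : ∀ w : ClosedDisc, 0 ≤ g w := fun w => le_max_right _ _
  rw [integral_eq_zero_iff_of_nonneg h3 hint] at h2
  filter_upwards [h2] with w hw
  exact sub_nonpos.mp (max_eq_right_iff.mp hw)

lemma ae_meanMeasure_norm_le {m : Config d X → Measure ClosedDisc}
    (hm : AEMeasurable m (prodLaw d μ)) {r : ℝ}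
    (h : ∀ᵐ ω ∂(prodLaw d μ), ∀ᵐ w : ClosedDisc ∂(m ω), ‖(w : ℂ)‖ ≤ r) :
    ∀ᵐ w : ClosedDisc ∂(meanMeasure μ m), ‖(w : ℂ)‖ ≤ r := by
  have hs : MeasurableSet {w : ClosedDisc | ¬ ‖(w : ℂ)‖ ≤ r} :=
    (measurableSet_le measurable_subtype_coe.norm measurable_const).compl
  rw [ae_iff, meanMeasure, Measure.bind_apply hs hm]
  refine (lintegral_congr_ae (g := fun _ => 0) ?_).trans lintegral_zero
  filter_upwards [h] with ω hω using ae_iff.mp hω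

end Support

end DOS

end

/-! ### The main theorem -/

theorem mainTheorem7 (d : ℕ) (X : Set ℝ) (μ : Measure X) [IsProbabilityMeasure μ]
    (γ : Fin d → Lattice d) (hγ : LinearIndependent ℤ γ)
    -- the ergodic measurable random cnu contraction
    (T : Config d X → (L2 d →L[ℂ] L2 d))
    (hT_meas : ∀ x y : L2 d, Measurable fun ω => ⟪x, T ω y⟫_ℂ)
    (hT_cnu : ∀ ω, IsCNUContraction (T ω))
    (hT_erg : ∀ g ∈ AddSubgroup.closure (Set.range γ), ∀ ω, ∀ x : L2 d,
      T (shift g ω) x = translation g (T ω ((translation g).symm x)))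
    -- the finite volume decompositions
    (TΛ : ∀ n : ℕ, Config d X → (boxSpace (box γ n) →L[ℂ] boxSpace (box γ n)))
    (TΛc : ∀ n : ℕ, Config d X → ((boxSpace (box γ n))ᗮ →L[ℂ] (boxSpace (box γ n))ᗮ))
    (hTΛ_cnu : ∀ n ω, IsCNUContraction (TΛ n ω))
    (hF : ∀ n ω, IsTraceClass (T ω - directSum (boxSpace (box γ n)) (TΛ n ω) (TΛc n ω)))
    (hlittle : ∀ ω, Tendsto (fun n : ℕ =>
      traceNorm ((boxSpace (box γ n)).starProjection ∘L
        (T ω - directSum (boxSpace (box γ n)) (TΛ n ω) (TΛc n ω))) / ((box γ n).card : ℝ≥0∞))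
      atTop (𝓝 0))
    -- the almost sure weak limit of the normalised eigenvalue counting measures
    (m : Config d X → Measure ClosedDisc) (hm : AEMeasurable m (prodLaw d μ))
    (hconv : ∀ᵐ ω ∂(prodLaw d μ), ∀ f : C(ClosedDisc, ℂ),
      Tendsto (fun n : ℕ => ∫ w, f w ∂(countingMeasure (TΛ n ω))) atTop (𝓝 (∫ w, f w ∂(m ω)))) :
    (∀ f : ℂ → ℂ, IsDiscAlgebra f →
      Integrable (fun w : ClosedDisc => f w) (meanMeasure μ m) ∧
      dosFunctional μ γ T f = ∫ w : ClosedDisc, f w ∂(meanMeasure μ m)) ∧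
    (∀ r : ℝ, 0 < r → r < 1 → (∀ n ω, spectralRadius ℂ (TΛ n ω) ≤ ENNReal.ofReal r) →
      ∃ ψ : ℂ → ℂ, DifferentiableOn ℂ ψ (ball 0 (1 / r)) ∧
        -- `ψ` is the Borel transform of the averaged measure
        (∀ z ∈ ball (0 : ℂ) (1 / r),
          Integrable (fun w : ClosedDisc => 1 / (1 - z * conj (w : ℂ))) (meanMeasure μ m) ∧
          ψ z = ∫ w : ClosedDisc, 1 / (1 - z * conj (w : ℂ)) ∂(meanMeasure μ m)) ∧
        -- the complex conjugate of `ψ` represents the functional on the unit circle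
        CircleIntegrable (fun ζ => conj (ψ ζ)) 0 1 ∧
        ¬ IsHardyOneZero (fun ζ => conj (ψ ζ)) ∧
        (∀ f : ℂ → ℂ, IsHInf f →
          CircleIntegrable (fun ζ => radialLimit f ζ * conj (ψ ζ)) 0 1 ∧
          dosFunctional μ γ T f =
            Real.circleAverage (fun ζ => radialLimit f ζ * conj (ψ ζ)) 0 1) ∧
        -- the associated harmonic density represents the functional on the unit disc
        InnerProductSpace.HarmonicOnNhd (discDensity fun ζ => conj (ψ ζ)) (ball 0 1) ∧
        (∀ f : ℂ → ℂ, IsDiscAlgebra f →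
          IntegrableOn (fun z => f z * discDensity (fun ζ => conj (ψ ζ)) z) (ball 0 1) ∧
          dosFunctional μ γ T f =
            ∫ z in ball (0 : ℂ) 1, f z * discDensity (fun ζ => conj (ψ ζ)) z) ∧
        (∀ z ∈ ball (0 : ℂ) 1,
          Integrable (fun w : ClosedDisc => 1 / (1 - conj z * (w : ℂ)) ^ 2) (meanMeasure μ m) ∧
          discDensity (fun ζ => conj (ψ ζ)) z = (1 / (Real.pi : ℂ)) *
            ∫ w : ClosedDisc, 1 / (1 - conj z * (w : ℂ)) ^ 2 ∂(meanMeasure μ m))) := by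
  have hT1 : ∀ ω, ‖T ω‖ ≤ 1 := fun ω => (hT_cnu ω).1
  have hA1 : ∀ n ω, ‖TΛ n ω‖ ≤ 1 := fun n ω => (hTΛ_cnu n ω).1
  have hp : ∀ᵐ ω ∂(prodLaw d μ), IsProbabilityMeasure (m ω) := by
    filter_upwards [hconv] with ω hω
    exact isProbabilityMeasure_of_tendsto (fun n => hA1 n ω) hω
  have hlim : ∀ᵐ ω ∂(prodLaw d μ), ∀ k : ℕ, Tendsto (fun n : ℕ => ((box γ n).card : ℂ)⁻¹ *
      ∑ j ∈ box γ n, ⟪(basisVec j : L2 d), (T ω ^ k) (basisVec j)⟫_ℂ) atTop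
      (𝓝 (∫ w : ClosedDisc, (w : ℂ) ^ k ∂(m ω))) := by
    filter_upwards [hconv] with ω hω k
    exact tendsto_localTrace hT1 hA1 hlittle hω k
  set ν := meanMeasure μ m with hνdef
  have : IsProbabilityMeasure ν := isProbabilityMeasure_bind hm hp
  have hmom : ∀ k, dosMoment μ γ T k = ∫ w : ClosedDisc, (w : ℂ) ^ k ∂ν :=
    dosMoment_eq_integral hγ hT_meas hT1 hT_erg hm hp hlim
  have hL : ∀ f : ℂ → ℂ, IsHInf f → Tendsto (fun ρ : ℝ => ∑' n : ℕ, taylorCoeff f n * (ρ : ℂ) ^ n *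
      ∫ w : ClosedDisc, (w : ℂ) ^ n ∂ν) (𝓝[<] 1) (𝓝 (dosFunctional μ γ T f)) := by
    intro f hf
    simpa only [hmom] using tendsto_dosFunctional (μ := μ) (γ := γ) hf hT_meas hT_cnu
  refine ⟨fun f hf => ⟨hf.integrable ν,
    tendsto_nhds_unique (hL f hf.isHInf) (hf.tendsto_tsum_moment ν)⟩, fun r hr hr1 hspr => ?_⟩
  have hsupp : ∀ᵐ w : ClosedDisc ∂ν, ‖(w : ℂ)‖ ≤ r := by
    refine ae_meanMeasure_norm_le hm ?_
    filter_upwards [hconv, hp] with ω hω hpω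
    exact ae_norm_le_of_tendsto (fun n => hA1 n ω) hω hr.le fun n => hspr n ω
  set M : ℕ → ℂ := fun n => ∫ w : ClosedDisc, (w : ℂ) ^ n ∂ν with hMdef
  have hM : ∀ n, ‖M n‖ ≤ r ^ n := norm_moment_le hsupp
  have hM' : ∀ n, ‖conj (M n)‖ ≤ r ^ n := fun n => by
    rw [RCLike.norm_conj]
    exact hM n
  -- The conjugated moments make ψ holomorphic while conj ψ = ∑ M_n ζ̄^n is the series that pairs
  -- with f on the circle.
  set ψ : ℂ → ℂ := fun z => ∑' n, conj (M n) * z ^ n with hψdef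
  have hψd : DifferentiableOn ℂ ψ (ball 0 (1 / r)) := differentiableOn_tsum_pow hr hM'
  have hsub := closedBall_subset_ball_one_div hr hr1
  have hψc : DiffContOnCl ℂ ψ (ball 0 1) := by
    refine (hψd.mono ?_).diffContOnCl
    rwa [closure_ball _ one_ne_zero]
  have hψconj : ∀ ζ, conj (ψ ζ) = ∑' n, M n * conj ζ ^ n := fun ζ => by
    rw [hψdef]
    simp only [conj_tsum, map_mul, map_pow, conj_conj]
  have hdens : ∀ z ∈ ball (0 : ℂ) 1, discDensity (fun ζ => conj (ψ ζ)) z =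
      (1 / (Real.pi : ℂ)) * ∑' n : ℕ, M n * (((n : ℂ) + 1) * conj z ^ n) := fun z hz => by
    rw [discDensity_conj hψc hz, hψdef, ← (hasSum_deriv_mul_tsum_pow hr hr1 hM' hz).tsum_eq,
      conj_tsum]
    simp
  have hci : CircleIntegrable (fun ζ => conj (ψ ζ)) 0 1 :=
    (Complex.continuous_conj.comp_continuousOn
      (hψd.continuousOn.mono (sphere_subset_closedBall.trans hsub))).circleIntegrable zero_le_one
  have hval : ∀ f, IsHInf f → dosFunctional μ γ T f = ∑' n, taylorCoeff f n * M n := fun f hf =>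
    tendsto_nhds_unique (hL f hf) (hf.tendsto_tsum_taylorCoeff_mul hr.le hr1 hM)
  refine ⟨ψ, hψd, fun z hz => integrable_borelKernel hr hsupp hz, hci, ?_, fun f hf => ?_,
    harmonicOnNhd_discDensity_conj hψc, fun f hf => ?_, fun z hz => ?_⟩
  -- The condition for n = 0 already fails: the mean of conj ψ is conj ψ(0) = M_0 = 1, the total
  -- mass.
  · rintro ⟨-, h⟩
    have h0 := h 0
    have hmean := DiffContOnCl.circleAverage (R := 1) (by rwa [abs_one] : DiffContOnCl ℂ ψ (ball 0 |1|))
    have hc := Complex.conjCLE.toContinuousLinearMap.circleAverage_comp_comm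
      ((hψd.continuousOn.mono (sphere_subset_closedBall.trans hsub)).circleIntegrable zero_le_one)
    have hψ0 : ψ 0 = 1 := by
      rw [hψdef, hMdef]
      simp only
      rw [tsum_eq_single 0 fun n hn => by rw [zero_pow hn, mul_zero]]
      simp
    rw [hmean, hψ0] at hc
    simp only [pow_zero, one_mul] at h0
    exact one_ne_zero ((map_one conj).symm.trans (hc.symm.trans h0))
  · simp only [hψconj]
    obtain ⟨h1, h2⟩ := hf.circleAverage_radialLimit_mul hr.le hr1 hM
    exact ⟨h1, tendsto_nhds_unique (hL f hf) h2⟩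
  · obtain ⟨h1, h2⟩ := hf.isHInf.integral_ball_mul hr hr1 hM hdens
    exact ⟨h1, (hval f hf.isHInf).trans h2.symm⟩
  · obtain ⟨h1, h2⟩ := integrable_borelKernel_sq hr hr1 hsupp hz
    exact ⟨h1, by rw [hdens z hz, ← h2]⟩
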